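/- Let $f\in C^\infty\big((\mathbb R^3\setminus\{0\})\times[0,1),\mathbb R\big)$, $f=f(q,\varepsilon)$, be invariant under rotations about the $z$-axis and under the reflection $z\mapsto -z$; in cylindrical coordinates write $f=f(r,z,\varepsilon)$. Let $\omega\neq 0$ and $h$ be real with $-1<2h\omega^2<0$, and consider on $\{r>0\}$ the reduced Hamiltonian $$H_{\omega,\varepsilon}(p_r,p_z,r,z)=\tfrac12(p_r^2+p_z^2)+\frac{\omega^2}{2r^2}-\frac1{\sqrt{r^2+z^2}}+\varepsilon f(r,z,\varepsilon),$$ with Hamiltonian system $\dot x=J\nabla H_{\omega,\varepsilon}(x)$, $x=(p_r,p_z,r,z)$, $J=\begin{pmatrix}0&-I_2\\ I_2&0\end{pmatrix}$. Put $e=\sqrt{1+2h\omega^2}\in(0,1)$ and $r(\theta)=\omega^2/(1+e\cos\theta)$. With $\partial_r f(r,0,0)$ the radial derivative in the plane $z=0$ at $\varepsilon=0$, and $\partial_\varphi^2 f(\rho,0,0)=\frac{d^2}{d\varphi^2}\big|_{\varphi=0} f(\rho\cos\varphi,\rho\sin\varphi,0)$, define $$\tilde T(f)=\frac2e\int_0^\pi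 r^2(\theta)\,\partial_r f(r(\theta),0,0)\cos\theta\,d\theta,\qquad E(f)=\int_0^\pi r^2(\theta)\,\partial_\varphi^2 f(r(\theta),0,0)\,d\theta+\omega^2\tilde T(f),$$ $$D(f)=E(f)^2-\Big(\int_0^\pi r^2(\theta)\,\partial_\varphi^2 f(r(\theta),0,0)\cos 2\theta\,d\theta\Big)^2 .$$ For a periodic orbit $\xi$ with minimal period $T$ let $\gamma:[0,T]\to \mathrm{Sp}(4)$ be the fundamental solution, $\gamma(0)=I$, of $\dot y=JD^2H_{\omega,\varepsilon}(\xi(t))y$, let $\hat i(\xi)=\lim_{m\to\infty} i_1(\gamma^m)/m$ be its mean index ($i_1$ the Maslov-type, i.e. Conley–Zehnder, index and $\gamma^m$ the $m$-th iterate), and call $\hat i(\xi)/2-1$ the Seifert rotation number of $\xi$. Let $[a,b]\subset(0,\infty)$ contain $\big[\tfrac{\omega^2}{1+e},\tfrac{\omega^2}{1-e}\big]$ in its interior. Then there is $\varepsilon_0\in(0,1]$ such that for every $\varepsilon\in[0,\varepsilon_0)$ the reduced system has, up to time translation, exactly one periodic orbit $\xi_\varepsilon$ of energy $h$ contained in the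 $(p_r,r)$-plane with $r\in[a,b]$; its Seifert rotation number $\mathrm{Rot}_\varepsilon$ is well defined; its period $T_\varepsilon$ in the angle variable $\theta$ (where $r^2\dot\theta=|\omega|$) satisfies $\frac{dT_\varepsilon}{d\varepsilon}\big|_{\varepsilon=0}=\tilde T(f)$; and $$\frac{d\,\mathrm{Rot}_\varepsilon}{d\varepsilon}\Big|_{\varepsilon=0}=\begin{cases}0,& D(f)<0,\\[2pt] \dfrac{\operatorname{sign}(E(f))}{2\pi\omega^2}\sqrt{D(f)},& D(f)\ge 0,\end{cases}$$ where $\operatorname{sign}(a)=a/|a|$ for $a\ne0$, $\operatorname{sign}(0)=0$, and derivatives at $\varepsilon=0$ are one-sided ($\varepsilon\ge0$). -/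

import Mathlib

open Set Filter Topology MeasureTheory
open scoped Matrix

noncomputable section

/-! ### Symplectic paths, Maslov-type index and mean index -/

/-- Real `2n × 2n` matrices, in `n × n` blocks. The symplectic group is
`Matrix.symplecticGroup (Fin n) ℝ` and `J = (0, -I; I, 0)` is `Matrix.J (Fin n) ℝ`. -/
abbrev Mat2 (n : ℕ) := Matrix (Fin n ⊕ Fin n) (Fin n ⊕ Fin n) ℝ

/-- For `M = (A, B; C, D)` this is `det_ℂ (A + D + i (C - B))`. For symplectic `M` with polar
decomposition `M = P U` (`P` positive definite, `U = (u₁, -u₂; u₂, u₁)` orthogonal, both symplectic)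
it is a positive multiple of `det_ℂ (u₁ + i u₂)`, so its argument is the usual rotation angle. -/
def complexDet {n : ℕ} (M : Mat2 n) : ℂ :=
  (Matrix.of fun i j : Fin n =>
    (⟨M (Sum.inl i) (Sum.inl j) + M (Sum.inr i) (Sum.inr j),
      M (Sum.inr i) (Sum.inl j) - M (Sum.inl i) (Sum.inr j)⟩ : ℂ)).det

/-- `η` is a continuous path of symplectic matrices on `[a, b]`. -/
def IsSympPath {n : ℕ} (η : ℝ → Mat2 n) (a b : ℝ) : Prop :=
  ContinuousOn η (Icc a b) ∧ ∀ t ∈ Icc a b, η t ∈ Matrix.symplecticGroup (Fin n) ℝ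

/-- `x` is the total variation of angle of `complexDet (η t)` for `t` from `a` to `b`. -/
def HasRotation {n : ℕ} (η : ℝ → Mat2 n) (a b x : ℝ) : Prop :=
  ∃ θ : ℝ → ℝ, ContinuousOn θ (Icc a b) ∧
    (∀ t ∈ Icc a b, complexDet (η t) = ‖complexDet (η t)‖ * Complex.exp (θ t * Complex.I)) ∧
    x = θ b - θ a

/-- The base point `diag(2, …, 2; 1/2, …, 1/2)` of the one component of
`Sp(2n)* = {M ∈ Sp(2n) : det (M - I) ≠ 0}`. -/
def basePlus (n : ℕ) : Mat2 n :=
  Matrix.diagonal (Sum.elim (fun _ => 2) (fun _ => 2⁻¹))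

/-- The base point `diag(-2, 2, …, 2; -1/2, 1/2, …, 1/2)` of the other component of `Sp(2n)*`. -/
def baseMinus (n : ℕ) : Mat2 n :=
  Matrix.diagonal (Sum.elim (fun i => if (i : ℕ) = 0 then -2 else 2)
    (fun i => if (i : ℕ) = 0 then -2⁻¹ else 2⁻¹))

/-- `β : [0, 1] → Sp(2n)*` is a path from `M` to one of the two base points. -/
def IsClosingPath {n : ℕ} (β : ℝ → Mat2 n) (M : Mat2 n) : Prop :=
  IsSympPath β 0 1 ∧ (∀ s ∈ Icc (0 : ℝ) 1, (β s - 1).det ≠ 0) ∧ β 0 = M ∧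
    (β 1 = basePlus n ∨ β 1 = baseMinus n)

/-- `k` is the intersection number `[η : Sp(2n)⁰]` of a symplectic path `η : [a, b] → Sp(2n)` whose
endpoints lie in `Sp(2n)*` with the hypersurface `Sp(2n)⁰ = {M : det (M - I) = 0}`, co-oriented by
`d/dt M e^{tJ}` at `t = 0`. It is counted as usual by the rotation: extend `η` at both ends inside
`Sp(2n)*` (so that no intersection is added) to the base points; the total angle of the
extended path is `k π`. -/
def HasIntersectionNumber {n : ℕ} (η : ℝ → Mat2 n) (a b : ℝ) (k : ℤ) : Prop :=
  IsSympPath η a b ∧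
  ∃ (β₀ β₁ : ℝ → Mat2 n) (x₀ x x₁ : ℝ),
    IsClosingPath β₀ (η a) ∧ IsClosingPath β₁ (η b) ∧
    HasRotation β₀ 0 1 x₀ ∧ HasRotation η a b x ∧ HasRotation β₁ 0 1 x₁ ∧
    -x₀ + x + x₁ = k * Real.pi

/-- The path `ξₙ(t) = diag(2 - t/τ, (2 - t/τ)⁻¹)^{⋄ n}` from `diag(2, 1/2)^{⋄ n}` to `I`. -/
def startPath (n : ℕ) (τ t : ℝ) : Mat2 n :=
  Matrix.diagonal (Sum.elim (fun _ => 2 - t / τ) (fun _ => (2 - t / τ)⁻¹))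

/-- The concatenation `γ * ξₙ` on `[0, τ]`: first `ξₙ`, then `γ`. -/
def withStart {n : ℕ} (γ : ℝ → Mat2 n) (τ t : ℝ) : Mat2 n :=
  if t ≤ τ / 2 then startPath n τ (2 * t) else γ (2 * t - τ)

/-- `e^{-δ J} = cos δ I - sin δ J`. -/
def expNegJ (n : ℕ) (δ : ℝ) : Mat2 n :=
  Real.cos δ • (1 : Mat2 n) - Real.sin δ • Matrix.J (Fin n) ℝ

/-- `k` is the Maslov-type index `i₁(γ) = [e^{-δ J} (γ * ξₙ) : Sp(2n)⁰]`, `δ > 0` small, of the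
symplectic path `γ` on `[0, τ]` with `γ(0) = I`. -/
def IsMaslovIndex {n : ℕ} (γ : ℝ → Mat2 n) (τ : ℝ) (k : ℤ) : Prop :=
  ∀ᶠ δ in 𝓝[>] (0 : ℝ),
    HasIntersectionNumber (fun t => expNegJ n δ * withStart γ τ t) 0 τ k

/-- The iterates of `γ`: `γ(t - j τ) γ(τ)^j` for `j τ ≤ t ≤ (j + 1) τ`. -/
def iteratePath {n : ℕ} (γ : ℝ → Mat2 n) (τ t : ℝ) : Mat2 n :=
  γ (t - ⌊t / τ⌋₊ * τ) * γ τ ^ ⌊t / τ⌋₊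

/-- `x` is the mean index `lim i₁(γ^m) / m` of `γ`; here `γ^m` is `iteratePath γ τ` on `[0, m τ]`. -/
def IsMeanIndex {n : ℕ} (γ : ℝ → Mat2 n) (τ x : ℝ) : Prop :=
  ∃ i : ℕ → ℤ, (∀ m : ℕ, 1 ≤ m → IsMaslovIndex (iteratePath γ τ) (m * τ) (i m)) ∧
    Tendsto (fun m : ℕ => (i m : ℝ) / m) atTop (𝓝 x)

/-! ### Hamiltonian systems with two degrees of freedom and their periodic orbits -/

/-- Phase space, with coordinates `(p_r, p_z, r, z) = (inl 0, inl 1, inr 0, inr 1)`. -/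
abbrev PhaseSpace := Fin 2 ⊕ Fin 2 → ℝ

def partialD (H : PhaseSpace → ℝ) (i : Fin 2 ⊕ Fin 2) (x : PhaseSpace) : ℝ :=
  fderiv ℝ H x (Pi.single i 1)

def hamVectorField (H : PhaseSpace → ℝ) (x : PhaseSpace) : PhaseSpace :=
  Matrix.J (Fin 2) ℝ *ᵥ fun i => partialD H i x

def hessianMatrix (H : PhaseSpace → ℝ) (x : PhaseSpace) : Mat2 2 :=
  Matrix.of fun i j => partialD (partialD H j) i x

/-- `γ` is the fundamental solution of `y' = J D²H(ξ(t)) y`, `γ(0) = I`. -/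
def IsFundamentalSolution (H : PhaseSpace → ℝ) (ξ : ℝ → PhaseSpace) (γ : ℝ → Mat2 2) : Prop :=
  γ 0 = 1 ∧ ∀ t i j, HasDerivAt (fun s => γ s i j)
    ((Matrix.J (Fin 2) ℝ * hessianMatrix H (ξ t) * γ t) i j) t

/-- `x` is the Seifert rotation number `î(ξ)/2 - 1` of the `T`-periodic orbit `ξ`, where `î(ξ)` is
the mean index of the fundamental solution of the linearized equation on `[0, T]`. -/
def IsSeifertRotationNumber (H : PhaseSpace → ℝ) (ξ : ℝ → PhaseSpace) (T x : ℝ) : Prop :=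
  ∃ (γ : ℝ → Mat2 2) (i : ℝ), IsFundamentalSolution H ξ γ ∧ IsMeanIndex γ T i ∧ x = i / 2 - 1

/-- `ξ` is a periodic solution of the Hamiltonian system of `H`, of minimal period `T` and energy
`h`, contained in the `(p_r, r)`-plane and with `r` in `[a, b]`. -/
structure IsPlanarOrbit (H : PhaseSpace → ℝ) (h a b : ℝ) (ξ : ℝ → PhaseSpace) (T : ℝ) :
    Prop where
  solution : ∀ t, HasDerivAt ξ (hamVectorField H (ξ t)) t
  planar : ∀ t, ξ t (Sum.inl 1) = 0 ∧ ξ t (Sum.inr 1) = 0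
  confined : ∀ t, ξ t (Sum.inr 0) ∈ Icc a b
  energy : ∀ t, H (ξ t) = h
  period_pos : 0 < T
  periodic : ∀ t, ξ (t + T) = ξ t
  minimal : ∀ S, 0 < S → (∀ t, ξ (t + S) = ξ t) → T ≤ S

/-! ### The Kepler problem with a symmetric perturbation -/

/-- The perturbation: `f ∈ C^∞((ℝ³ ∖ {0}) × [0, 1))` invariant under rotations around the `z`-axis
and under reflection in the `(x, y)`-plane. -/
structure IsSymmetricPerturbation (f : EuclideanSpace ℝ (Fin 3) → ℝ → ℝ) : Prop where
  smooth : ContDiffOn ℝ ((⊤ : ℕ∞) : WithTop ℕ∞) (fun p : EuclideanSpace ℝ (Fin 3) × ℝ => f p.1 p.2)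
    (({0}ᶜ : Set (EuclideanSpace ℝ (Fin 3))) ×ˢ Ico (0 : ℝ) 1)
  rotation : ∀ r θ z ε : ℝ, 0 < r → ε ∈ Ico (0 : ℝ) 1 →
    f !₂[r * Real.cos θ, r * Real.sin θ, z] ε = f !₂[r, 0, z] ε
  reflection : ∀ x y z ε : ℝ, !₂[x, y, z] ≠ (0 : EuclideanSpace ℝ (Fin 3)) →
    ε ∈ Ico (0 : ℝ) 1 → f !₂[x, y, -z] ε = f !₂[x, y, z] ε

/-- The reduced Hamiltonian
`(p_r² + p_z²)/2 + ω²/(2 r²) - 1/√(r² + z²) + ε f(r, z, ε)`. -/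
def reducedHam (f : EuclideanSpace ℝ (Fin 3) → ℝ → ℝ) (ω ε : ℝ) (x : PhaseSpace) : ℝ :=
  (x (Sum.inl 0) ^ 2 + x (Sum.inl 1) ^ 2) / 2 + ω ^ 2 / (2 * x (Sum.inr 0) ^ 2)
    - 1 / √(x (Sum.inr 0) ^ 2 + x (Sum.inr 1) ^ 2)
    + ε * f !₂[x (Sum.inr 0), 0, x (Sum.inr 1)] ε

/-- The eccentricity `e = √(1 + 2 h ω²)`. -/
def ecc (ω h : ℝ) : ℝ := √(1 + 2 * h * ω ^ 2)

/-- The Kepler ellipse `r(θ) = ω² / (1 + e cos θ)`. -/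
def keplerRadius (ω h θ : ℝ) : ℝ := ω ^ 2 / (1 + ecc ω h * Real.cos θ)

/-- `∂f/∂r (r, 0, 0)`: derivative along the radius in the plane `z = 0`, at `ε = 0`. -/
def radialDeriv (f : EuclideanSpace ℝ (Fin 3) → ℝ → ℝ) (r : ℝ) : ℝ :=
  deriv (fun s => f !₂[s, 0, 0] 0) r

/-- `∂²f/∂φ² (ρ, 0, 0)` in spherical coordinates `r = ρ cos φ`, `z = ρ sin φ`, at `ε = 0`. -/
def latitudeDeriv2 (f : EuclideanSpace ℝ (Fin 3) → ℝ → ℝ) (ρ : ℝ) : ℝ :=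
  iteratedDeriv 2 (fun φ => f !₂[ρ * Real.cos φ, 0, ρ * Real.sin φ] 0) 0

def Ttilde (f : EuclideanSpace ℝ (Fin 3) → ℝ → ℝ) (ω h : ℝ) : ℝ :=
  2 / ecc ω h * ∫ θ in (0 : ℝ)..Real.pi,
    keplerRadius ω h θ ^ 2 * radialDeriv f (keplerRadius ω h θ) * Real.cos θ

def Efun (f : EuclideanSpace ℝ (Fin 3) → ℝ → ℝ) (ω h : ℝ) : ℝ :=
  (∫ θ in (0 : ℝ)..Real.pi,
    keplerRadius ω h θ ^ 2 * latitudeDeriv2 f (keplerRadius ω h θ)) + ω ^ 2 * Ttilde f ω h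

def Dfun (f : EuclideanSpace ℝ (Fin 3) → ℝ → ℝ) (ω h : ℝ) : ℝ :=
  Efun f ω h ^ 2 - (∫ θ in (0 : ℝ)..Real.pi,
    keplerRadius ω h θ ^ 2 * latitudeDeriv2 f (keplerRadius ω h θ) * Real.cos (2 * θ)) ^ 2

/-- The period of `ξ` in the angle variable `θ`, where `r² θ' = |ω|`. -/
def angularPeriod (ω : ℝ) (ξ : ℝ → PhaseSpace) (T : ℝ) : ℝ :=
  ∫ t in (0 : ℝ)..T, |ω| / ξ t (Sum.inr 0) ^ 2

end

/-!
The linearized equation along a planar orbit splits into two Hill equations, one in the plane and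
one transversal to it (`isFundamentalSolution_iff_eq_dsum`). For such a symplectic sum the
Maslov-type index of an iterate differs from the rotation of `complexDet`, in units of `π`, by a
bounded amount (`IsMaslovIndex.abs_sub_le`). This uses that the symplectic matrices without
eigenvalue one carry a continuous bounded `phase`, the argument of `complexDet`, which comes from
the Cayley transform. Indices exist because each such sum can be joined with a base point
(`exists_joinedIn_base`). Hence the mean index is the asymptotic rotation of the fundamental
solution, and the rotation of a block of size two can be measured on any one of its solutions
(`isMeanIndex_dsum_iff`).

The planar block has the tangent vector of the orbit as a solution, which turns exactly once per
period (`IsPericentric.hasMeanRotation_planar`). For the transversal block the angle of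
`(u', u)`, where `u = z / r` and the derivative is taken with respect to the angle `θ` of the
orbit, satisfies `A' = 1 + ε K sin² A`. Its time `T` map is the lift of a circle map, and the block
turns on average by the translation number of this map
(`IsPericentric.hasMeanRotation_transversal`). Thus the Seifert rotation number is this translation
number (`IsPericentric.isSeifertRotationNumber_iff`).

The planar orbit is found by energy conservation and reversibility. Its eccentricity vector is
constant for the Kepler problem, and varies by `O(ε)` in general. This shows that the orbit makes
one turn per period, that it stays `O(ε)`-close to the Kepler ellipse, and, by integration over the
ellipse, that the angular period is `2π + ε T̃ + o(ε)` (`KeplerPert.eventually_clock_period`). In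
the same way the circle map is `α ↦ α + 2π + ε (E - K cos 2α) + o(ε)` with `E² - K² = D / ω⁴`,
where `ω² E` is the quantity `Efun` (`KeplerPert.eventually_transAngle`).

It remains to find the first order of the translation number of such maps
(`translationNumber_asymptotics`). If `D < 0`, the vector field `E - K cos 2α` changes sign, the map
turns some points by more and others by less than a full turn, and the translation number is `1`.
If `D > 0`, the linear map `diag(1, s)` with `s² = (E + K) / (E - K)`, acting on angles, turns the
vector field into the constant `sign E √(E² - K²)`. If `D = 0`, the same change of coordinate with
`s` large or small turns it into one that is as small as desired.
-/

/-! ### Angles of curves of complex numbers -/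

/-- `θ` is a continuous choice of the argument of `z` on `s`. -/
def IsAngleOn (z : ℝ → ℂ) (θ : ℝ → ℝ) (s : Set ℝ) : Prop :=
  ContinuousOn θ s ∧ ∀ t ∈ s, z t = ‖z t‖ * Complex.exp (θ t * Complex.I)

/-- A continuous function with values in `πℤ` is constant on a preconnected set. -/
theorem eq_of_continuousOn_of_int_mul_pi {X : Type*} [TopologicalSpace X] {s : Set X}
    (hs : IsPreconnected s) {θ : X → ℝ} (hθ : ContinuousOn θ s)
    (h : ∀ t ∈ s, ∃ k : ℤ, θ t = k * Real.pi) {x y : X} (hx : x ∈ s) (hy : y ∈ s) :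
    θ x = θ y := by
  have key : ∀ x ∈ s, ∀ y ∈ s, ¬ θ x < θ y := by
    intro x hx y hy hlt
    obtain ⟨k, hk⟩ := h x hx
    obtain ⟨l, hl⟩ := h y hy
    have hpi := Real.pi_pos
    have hkl : (k : ℝ) < l := by
      rw [hk, hl] at hlt
      exact lt_of_mul_lt_mul_right hlt hpi.le
    have hkl' : (k : ℝ) + 1 ≤ l := by exact_mod_cast hkl
    have hmem : (k + 1 / 2) * Real.pi ∈ Icc (θ x) (θ y) := by
      rw [hk, hl]
      constructor <;> nlinarith
    obtain ⟨z, hz, hzθ⟩ := hs.intermediate_value hx hy hθ hmem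
    obtain ⟨m, hm⟩ := h z hz
    rw [hm] at hzθ
    have h3 := mul_right_cancel₀ hpi.ne' hzθ
    have h4 : (2 * m : ℤ) = 2 * k + 1 := by
      have : (2 * m : ℝ) = 2 * k + 1 := by linarith
      exact_mod_cast this
    omega
  exact le_antisymm (not_lt.1 (key y hy x hx)) (not_lt.1 (key x hx y hy))

theorem exists_int_mul_pi_of_exp_eq {x y c : ℝ}
    (h : Complex.exp (x * Complex.I) = c * Complex.exp (y * Complex.I)) :
    ∃ k : ℤ, x - y = k * Real.pi := by
  have h1 : Complex.exp ((x - y : ℝ) * Complex.I) = c := by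
    rw [Complex.ofReal_sub, sub_mul, Complex.exp_sub, h, mul_div_assoc,
      div_self (Complex.exp_ne_zero _), mul_one]
  have h2 : Real.sin (x - y) = 0 := by
    have := congrArg Complex.im h1
    rwa [Complex.exp_ofReal_mul_I_im, Complex.ofReal_im] at this
  obtain ⟨k, hk⟩ := Real.sin_eq_zero_iff.1 h2
  exact ⟨k, hk.symm⟩

/-- If two curves differ by nonzero real factors, their angles vary by the same amount. -/
theorem IsAngleOn.sub_eq_sub {z w : ℝ → ℂ} {θ φ : ℝ → ℝ} {a b : ℝ} (hz : IsAngleOn z θ (Icc a b))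
    (hw : IsAngleOn w φ (Icc a b)) (hab : a ≤ b)
    (h : ∀ t ∈ Icc a b, z t ≠ 0 ∧ ∃ c : ℝ, z t = c * w t) :
    θ b - θ a = φ b - φ a := by
  have key : ∀ t ∈ Icc a b, ∃ k : ℤ, θ t - φ t = k * Real.pi := by
    intro t ht
    obtain ⟨h0, c, hc⟩ := h t ht
    have h1 : (‖z t‖ : ℂ) ≠ 0 := by simpa using h0
    apply exists_int_mul_pi_of_exp_eq (c := ‖z t‖⁻¹ * c * ‖w t‖)
    have e1 : Complex.exp (θ t * Complex.I) = (‖z t‖ : ℂ)⁻¹ * z t := by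
      rw [eq_inv_mul_iff_mul_eq₀ h1]
      exact (hz.2 t ht).symm
    rw [e1, hc, hw.2 t ht]
    push_cast
    simp only [norm_mul, Complex.norm_real, Complex.norm_exp_ofReal_mul_I, norm_norm]
    push_cast
    ring
  have := eq_of_continuousOn_of_int_mul_pi isPreconnected_Icc (hz.1.sub hw.1) key
    (left_mem_Icc.2 hab) (right_mem_Icc.2 hab)
  simp only [Pi.sub_apply] at this
  linarith

/-- Passing from the angle of `w` to the angle of `z` when `z / w` stays off the negative axis. -/
theorem IsAngleOn.of_slitPlane {z w : ℝ → ℂ} {φ : ℝ → ℝ} {s : Set ℝ} (hw : IsAngleOn w φ s)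
    (hwc : ContinuousOn w s) (hzc : ContinuousOn z s)
    (h : ∀ t ∈ s, z t / w t ∈ Complex.slitPlane) :
    IsAngleOn z (fun t => φ t + (z t / w t).arg) s := by
  have hw0 : ∀ t ∈ s, w t ≠ 0 := by
    intro t ht h0
    have := h t ht
    rw [h0, div_zero] at this
    exact Complex.slitPlane_ne_zero this rfl
  refine ⟨hw.1.add fun t ht => ?_, fun t ht => ?_⟩
  · exact ContinuousAt.comp_continuousWithinAt (f := fun t => z t / w t)
      (Complex.continuousAt_arg (h t ht)) ((hzc t ht).div (hwc t ht) (hw0 t ht))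
  · have e1 := hw.2 t ht
    have e2 := Complex.norm_mul_exp_arg_mul_I (z t / w t)
    have e3 : z t = (z t / w t) * w t := by rw [div_mul_cancel₀ _ (hw0 t ht)]
    have h1 : (‖w t‖ : ℂ) ≠ 0 := by simpa using hw0 t ht
    calc z t = (z t / w t) * w t := e3
      _ = (‖z t / w t‖ * Complex.exp ((z t / w t).arg * Complex.I)) *
          (‖w t‖ * Complex.exp (φ t * Complex.I)) := by rw [e2, ← e1]
      _ = ‖z t‖ * Complex.exp ((φ t + (z t / w t).arg : ℝ) * Complex.I) := by
          rw [norm_div]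
          push_cast
          rw [add_mul, Complex.exp_add]
          field_simp

/-! ### Symplectic sums of `2 × 2` matrices -/

/-- The symplectic direct sum of `2 × 2` matrices: the `i`-th one acts on the coordinates
`(inl i, inr i)`. -/
def dsum {n : ℕ} (N : Fin n → Matrix (Fin 2) (Fin 2) ℝ) : Mat2 n :=
  Matrix.fromBlocks (Matrix.diagonal fun i => N i 0 0) (Matrix.diagonal fun i => N i 0 1)
    (Matrix.diagonal fun i => N i 1 0) (Matrix.diagonal fun i => N i 1 1)

section dsum
variable {n : ℕ} (N N' : Fin n → Matrix (Fin 2) (Fin 2) ℝ)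

theorem dsum_mul : dsum N * dsum N' = dsum fun i => N i * N' i := by
  simp [dsum, Matrix.fromBlocks_multiply, Matrix.mul_apply, Fin.sum_univ_two]

theorem dsum_sub : dsum N - dsum N' = dsum fun i => N i - N' i := by
  ext i j
  rcases i with i | i <;> rcases j with j | j <;> by_cases h : i = j <;> simp [dsum, h]

theorem dsum_one : dsum (fun _ : Fin n => 1) = 1 := by
  simp [dsum, ← Matrix.fromBlocks_one]

theorem dsum_transpose : (dsum N)ᵀ = dsum fun i => (N i)ᵀ := by
  simp [dsum, Matrix.fromBlocks_transpose]

theorem dsum_J : dsum (fun _ : Fin n => !![0, -1; 1, 0]) = Matrix.J (Fin n) ℝ := by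
  ext i j
  rcases i with i | i <;> rcases j with j | j <;>
    simp [dsum, Matrix.J, Matrix.diagonal, Matrix.one_apply]
  split_ifs <;> simp

theorem det_dsum : (dsum N).det = ∏ i, (N i).det := by
  let e : Fin n ⊕ Fin n ≃ Fin 2 × Fin n :=
    { toFun := Sum.elim (fun i => (0, i)) (fun i => (1, i))
      invFun := fun p => if p.1 = 0 then Sum.inl p.2 else Sum.inr p.2
      left_inv := by rintro (i | i) <;> simp
      right_inv := by
        rintro ⟨i, j⟩
        fin_cases i <;> simp }
  have : dsum N = (Matrix.blockDiagonal N).submatrix e e := by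
    ext i j
    rcases i with i | i <;> rcases j with j | j <;>
      simp [dsum, e, Matrix.blockDiagonal_apply, Matrix.diagonal]
  rw [this, Matrix.det_submatrix_equiv_self, Matrix.det_blockDiagonal]

theorem complexDet_dsum : complexDet (dsum N) =
    ∏ i, (⟨N i 0 0 + N i 1 1, N i 1 0 - N i 0 1⟩ : ℂ) := by
  rw [complexDet, ← Matrix.det_diagonal]
  congr 1
  ext i j
  by_cases h : i = j
  · subst h; simp [dsum]
  · simp [dsum, h, Complex.ext_iff]

theorem dsum_mem_symplecticGroup (h : ∀ i, (N i).det = 1) :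
    dsum N ∈ Matrix.symplecticGroup (Fin n) ℝ := by
  rw [SymplecticGroup.mem_iff, ← dsum_J, dsum_transpose, dsum_mul, dsum_mul]
  congr 1
  funext i
  have hi := h i
  rw [Matrix.det_fin_two] at hi
  ext j k
  fin_cases j <;> fin_cases k <;>
    simp [Matrix.mul_apply, Fin.sum_univ_two] <;> linarith

theorem continuous_dsum : Continuous (dsum : (Fin n → Matrix (Fin 2) (Fin 2) ℝ) → Mat2 n) := by
  unfold dsum
  fun_prop

theorem expNegJ_eq_dsum (δ : ℝ) : expNegJ n δ =
    dsum fun _ => !![Real.cos δ, Real.sin δ; -Real.sin δ, Real.cos δ] := by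
  rw [expNegJ, ← dsum_J, ← dsum_one]
  ext i j
  rcases i with i | i <;> rcases j with j | j <;> by_cases h : i = j <;> simp [dsum, h]

theorem continuous_expNegJ : Continuous (expNegJ n) := by
  unfold expNegJ
  fun_prop

end dsum

/-- Multiplication by `e^{-δJ}` is multiplication by the complex scalar `e^{-iδ}`. -/
theorem complexDet_expNegJ_mul {n : ℕ} (δ : ℝ) (M : Mat2 n) :
    complexDet (expNegJ n δ * M) = Complex.exp ((-(n * δ) : ℝ) * Complex.I) * complexDet M := by
  have h1 : Complex.exp ((-(n * δ) : ℝ) * Complex.I) = Complex.exp ((-δ : ℝ) * Complex.I) ^ n := by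
    rw [← Complex.exp_nat_mul]
    congr 1
    push_cast
    ring
  rw [h1, complexDet, complexDet]
  have h2 := Matrix.det_smul (Matrix.of fun i j : Fin n =>
    (⟨M (Sum.inl i) (Sum.inl j) + M (Sum.inr i) (Sum.inr j),
      M (Sum.inr i) (Sum.inl j) - M (Sum.inl i) (Sum.inr j)⟩ : ℂ))
      (Complex.exp ((-δ : ℝ) * Complex.I))
  rw [Fintype.card_fin] at h2
  rw [← h2]
  congr 1
  ext i j
  rw [expNegJ_eq_dsum]
  have hre := Complex.exp_ofReal_mul_I_re (-δ)
  have him := Complex.exp_ofReal_mul_I_im (-δ)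
  rw [Real.cos_neg] at hre
  rw [Real.sin_neg] at him
  simp only [Matrix.smul_apply, Matrix.of_apply, smul_eq_mul]
  apply Complex.ext
  · rw [Complex.mul_re, hre, him]
    simp [dsum, Matrix.mul_apply, Matrix.diagonal]
    ring
  · rw [Complex.mul_im, hre, him]
    simp [dsum, Matrix.mul_apply, Matrix.diagonal]
    ring

/-! ### The phase on the symplectic matrices without eigenvalue one -/

/-- The determinant of `S + i`, for the symmetric part of `S`. -/
noncomputable def shiftDet {m : Type*} [Fintype m] [DecidableEq m] (S : m → m → ℝ) : ℂ :=
  (Matrix.of fun i j => (((S i j + S j i) / 2 : ℝ) : ℂ) + if i = j then Complex.I else 0).det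

section shiftDet
variable {m : Type*} [Fintype m] [DecidableEq m]

theorem continuous_shiftDet : Continuous (shiftDet : (m → m → ℝ) → ℂ) := by
  unfold shiftDet
  refine Continuous.matrix_det (continuous_matrix fun i j => ?_)
  simp only [Matrix.of_apply]
  fun_prop

theorem exists_shiftDet_smul_eq_prod (S : m → m → ℝ) :
    ∃ l : m → ℝ, ∀ s : ℝ, shiftDet (s • S) = ∏ i, ((s * l i : ℝ) + Complex.I) := by
  let A : Matrix m m ℂ := Matrix.of fun i j => (((S i j + S j i) / 2 : ℝ) : ℂ)
  have hA : A.IsHermitian := by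
    ext i j
    simp only [A, Matrix.conjTranspose_apply, Matrix.of_apply, RCLike.star_def, Complex.conj_ofReal,
      add_comm]
  refine ⟨hA.eigenvalues, fun s => ?_⟩
  rcases eq_or_ne s 0 with rfl | hs
  · have : shiftDet ((0 : ℝ) • S) = (Matrix.diagonal fun _ : m => Complex.I).det := by
      unfold shiftDet
      congr 1
      ext i j
      simp [Matrix.diagonal]
    rw [this]
    simp
  have hs' : (s : ℂ) ≠ 0 := by exact_mod_cast hs
  have h1 := hA.charpoly_eq
  have h2 := Matrix.eval_charpoly A (-(Complex.I / s))
  rw [h1, Polynomial.eval_prod] at h2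
  simp only [Polynomial.eval_sub, Polynomial.eval_X, Polynomial.eval_C] at h2
  have h3 : (Matrix.of fun i j => ((((s • S) i j + (s • S) j i) / 2 : ℝ) : ℂ) +
      if i = j then Complex.I else 0) =
      (-(s : ℂ)) • (Matrix.scalar m (-(Complex.I / s)) - A) := by
    ext i j
    by_cases hij : i = j
    · subst hij
      simp [A]
      field_simp
      ring
    · simp [A, hij]
      ring
  rw [shiftDet, h3, Matrix.det_smul, ← h2, ← Finset.card_univ, ← Finset.prod_const,
    ← Finset.prod_mul_distrib]
  refine Finset.prod_congr rfl fun i _ => ?_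
  push_cast
  field_simp
  simp

theorem shiftDet_ne_zero (S : m → m → ℝ) : shiftDet S ≠ 0 := by
  obtain ⟨l, hl⟩ := exists_shiftDet_smul_eq_prod S
  rw [← one_smul ℝ S, hl]
  refine Finset.prod_ne_zero_iff.2 fun i _ h => ?_
  simpa using congrArg Complex.im h

/-- There is a continuous logarithm of `det (S + i)` on the vector space of matrices; its imaginary
part is the sum of the arguments of `λ + i` over the eigenvalues `λ`, hence bounded. -/
theorem exists_log_shiftDet (m : Type*) [Fintype m] [DecidableEq m] :
    ∃ L : (m → m → ℝ) → ℂ, Continuous L ∧ (∀ S, Complex.exp (L S) = shiftDet S) ∧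
      ∀ S, (L S).im ∈ Icc 0 (Fintype.card m * Real.pi) := by
  have h0 : Complex.exp ((Fintype.card m * (Real.pi / 2) : ℝ) * Complex.I) =
      shiftDet (0 : m → m → ℝ) := by
    obtain ⟨l, hl⟩ := exists_shiftDet_smul_eq_prod (0 : m → m → ℝ)
    have := hl 0
    rw [smul_zero] at this
    rw [this]
    simp only [zero_mul, Complex.ofReal_zero, zero_add, Finset.prod_const, Finset.card_univ]
    rw [Complex.ofReal_mul, mul_assoc, Complex.ofReal_natCast, Complex.exp_nat_mul]
    congr 1
    push_cast
    exact Complex.exp_pi_div_two_mul_I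
  obtain ⟨L, ⟨hL0, hL⟩, -⟩ := Complex.isCoveringMapOn_exp.existsUnique_continuousMap_lifts
    (⟨shiftDet, continuous_shiftDet⟩ : C(m → m → ℝ, ℂ)) h0 (fun S => shiftDet_ne_zero S)
  have hexp : ∀ S, Complex.exp (L S) = shiftDet S := fun S => congrFun hL S
  refine ⟨L, L.continuous, hexp, fun S => ?_⟩
  obtain ⟨l, hl⟩ := exists_shiftDet_smul_eq_prod S
  have hpos : ∀ x : ℝ, 0 < ((x : ℂ) + Complex.I).im := by simp
  have hcont : Continuous fun s : ℝ => (L (s • S)).im -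
      ∑ i, (((s * l i : ℝ) : ℂ) + Complex.I).arg := by
    refine (Complex.continuous_im.comp (L.continuous.comp (by fun_prop))).sub
      (continuous_finsetSum _ fun i _ => ?_)
    rw [continuous_iff_continuousAt]
    intro s
    refine ContinuousAt.comp (f := fun s : ℝ => ((s * l i : ℝ) : ℂ) + Complex.I)
      (Complex.continuousAt_arg ?_) (by fun_prop)
    exact Or.inr (hpos _).ne'
  have key := eq_of_continuousOn_of_int_mul_pi (isPreconnected_univ (α := ℝ)) hcont.continuousOn
    (fun s _ => by
      apply exists_int_mul_pi_of_exp_eq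
        (c := (Real.exp (L (s • S)).re)⁻¹ * ∏ i, ‖((s * l i : ℝ) : ℂ) + Complex.I‖)
      have h1 := hexp (s • S)
      rw [hl] at h1
      have h2 : Complex.exp (L (s • S)) =
          Complex.exp (L (s • S)).re * Complex.exp ((L (s • S)).im * Complex.I) := by
        rw [← Complex.exp_add, Complex.re_add_im]
      have h3 : ∏ i, (((s * l i : ℝ) : ℂ) + Complex.I) =
          (∏ i, (‖((s * l i : ℝ) : ℂ) + Complex.I‖ : ℂ)) *
          Complex.exp ((∑ i, (((s * l i : ℝ) : ℂ) + Complex.I).arg : ℝ) * Complex.I) := by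
        rw [Complex.ofReal_sum, Finset.sum_mul, Complex.exp_sum, ← Finset.prod_mul_distrib]
        exact Finset.prod_congr rfl fun i _ => (Complex.norm_mul_exp_arg_mul_I _).symm
      rw [h2, h3] at h1
      push_cast at h1 ⊢
      rw [mul_assoc, ← h1, ← mul_assoc, inv_mul_cancel₀ (Complex.exp_ne_zero _), one_mul])
    (mem_univ 1) (mem_univ 0)
  simp only [one_smul, zero_smul, zero_mul, one_mul] at key
  rw [hL0] at key
  have h4 : (((Fintype.card m * (Real.pi / 2) : ℝ) : ℂ) * Complex.I).im =
      Fintype.card m * (Real.pi / 2) := by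
    rw [Complex.im_ofReal_mul, Complex.I_im, mul_one]
  have h5 : ∑ _i : m, (((0 : ℝ) : ℂ) + Complex.I).arg = Fintype.card m * (Real.pi / 2) := by
    simp
  rw [h4, h5, sub_self, sub_eq_zero] at key
  rw [key]
  refine ⟨Finset.sum_nonneg fun i _ => Complex.arg_nonneg_iff.2 (hpos _).le, ?_⟩
  refine (Finset.sum_le_sum fun i _ => Complex.arg_le_pi _).trans ?_
  simp
end shiftDet

section phase
variable {n : ℕ}

/-- The Cayley transform `J (M + 1) (M - 1)⁻¹`, a symmetric matrix when `M` is symplectic. -/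
noncomputable def cayley (M : Mat2 n) : Mat2 n :=
  Matrix.J (Fin n) ℝ * (M + 1) * (M - 1)⁻¹

theorem cayley_transpose {M : Mat2 n} (hM : M ∈ Matrix.symplecticGroup (Fin n) ℝ)
    (h1 : (M - 1).det ≠ 0) : (cayley M)ᵀ = cayley M := by
  have hN : (M - 1)⁻¹ᵀ * (M - 1)ᵀ = 1 := by
    rw [← Matrix.transpose_mul, Matrix.mul_nonsing_inv _ (isUnit_iff_ne_zero.2 h1),
      Matrix.transpose_one]
  have hJ := SymplecticGroup.mem_iff'.1 hM
  have e1 : (M - 1)ᵀ * (Matrix.J (Fin n) ℝ * (M + 1)) =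
      Mᵀ * Matrix.J (Fin n) ℝ - Matrix.J (Fin n) ℝ * M := by
    rw [Matrix.transpose_sub, Matrix.transpose_one]
    calc _ = Mᵀ * Matrix.J (Fin n) ℝ * M + Mᵀ * Matrix.J (Fin n) ℝ
        - Matrix.J (Fin n) ℝ * M - Matrix.J (Fin n) ℝ := by noncomm_ring
      _ = _ := by rw [hJ]; abel
  have e2 : cayley M = (M - 1)⁻¹ᵀ * (Mᵀ * Matrix.J (Fin n) ℝ - Matrix.J (Fin n) ℝ * M) *
      (M - 1)⁻¹ := by
    rw [← e1, ← Matrix.mul_assoc, hN, Matrix.one_mul, cayley]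
  rw [e2]
  simp only [Matrix.transpose_mul, Matrix.transpose_sub, Matrix.transpose_transpose,
    Matrix.J_transpose, Matrix.mul_neg, Matrix.neg_mul, Matrix.mul_assoc]
  congr 2
  abel

theorem continuousOn_cayley :
    ContinuousOn (cayley : Mat2 n → Mat2 n) {M | (M - 1).det ≠ 0} := by
  have : (cayley : Mat2 n → Mat2 n) = fun M => (M - 1).det⁻¹ •
      (Matrix.J (Fin n) ℝ * (M + 1) * (M - 1).adjugate) := by
    funext M
    rw [cayley, Matrix.inv_def, Ring.inverse_eq_inv', Matrix.mul_smul]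
  rw [this]
  refine ContinuousOn.smul (ContinuousOn.inv₀ ?_ fun M hM => hM) ?_
  · exact Continuous.continuousOn (Continuous.matrix_det (by fun_prop))
  · refine Continuous.continuousOn ?_
    exact (continuous_const.matrix_mul (by fun_prop)).matrix_mul
      (Continuous.matrix_adjugate (by fun_prop))

/-- Up to the factor `2ⁿ`, `complexDet M` is the determinant of the frame
`(J + i) M + (J - i)` of the graph of `M`. -/
theorem det_frame_eq (M : Mat2 n) :
    ((Matrix.J (Fin n) ℂ + Complex.I • 1) * M.map Complex.ofReal +
      (Matrix.J (Fin n) ℂ - Complex.I • 1)).det = 2 ^ n * complexDet M := by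
  set A := (M.map Complex.ofReal).toBlocks₁₁ with hA
  set B := (M.map Complex.ofReal).toBlocks₁₂ with hB
  set C := (M.map Complex.ofReal).toBlocks₂₁ with hC
  set D := (M.map Complex.ofReal).toBlocks₂₂ with hD
  have hM : M.map Complex.ofReal = Matrix.fromBlocks A B C D :=
    (Matrix.fromBlocks_toBlocks _).symm
  set L : Matrix (Fin n ⊕ Fin n) (Fin n ⊕ Fin n) ℂ :=
    Matrix.fromBlocks 1 (-(Complex.I • 1)) 0 1 with hL
  set R : Matrix (Fin n ⊕ Fin n) (Fin n ⊕ Fin n) ℂ :=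
    Matrix.fromBlocks 1 (Complex.I • 1) 0 1 with hR
  set X := (Matrix.J (Fin n) ℂ + Complex.I • 1) * M.map Complex.ofReal +
      (Matrix.J (Fin n) ℂ - Complex.I • 1) with hX
  have hII : Complex.I * Complex.I = -1 := Complex.I_mul_I
  have hLXR : L * X * R = Matrix.fromBlocks ((-2 * Complex.I) • 1) 0
      (A + Complex.I • C + 1) (Complex.I • (A + D + Complex.I • (C - B))) := by
    rw [hX, hM, hL, hR, Matrix.J, sub_eq_add_neg, ← Matrix.fromBlocks_one, Matrix.fromBlocks_smul,
      Matrix.fromBlocks_neg, Matrix.fromBlocks_add, Matrix.fromBlocks_add,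
      Matrix.fromBlocks_multiply, Matrix.fromBlocks_add, Matrix.fromBlocks_multiply,
      Matrix.fromBlocks_multiply]
    congr 1 <;> ext i j <;> simp [smul_smul, Matrix.one_apply, mul_add, ← mul_assoc, hII]
    all_goals split_ifs <;> ring
  have hdet : X.det = (L * X * R).det := by
    rw [Matrix.det_mul, Matrix.det_mul, hL, hR, Matrix.det_fromBlocks_zero₂₁,
      Matrix.det_fromBlocks_zero₂₁]
    simp
  rw [hdet, hLXR, Matrix.det_fromBlocks_zero₁₂, Matrix.det_smul, Matrix.det_smul, Matrix.det_one,
    Fintype.card_fin, mul_one, ← mul_assoc, ← mul_pow]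
  have : -2 * Complex.I * Complex.I = 2 := by rw [mul_assoc, hII]; ring
  rw [this, complexDet]
  congr 2
  ext i j
  apply Complex.ext <;> simp [hA, hB, hC, hD, Matrix.toBlocks₁₁, Matrix.toBlocks₁₂,
    Matrix.toBlocks₂₁, Matrix.toBlocks₂₂]

theorem complexDet_eq_shiftDet {M : Mat2 n} (hM : M ∈ Matrix.symplecticGroup (Fin n) ℝ)
    (h1 : (M - 1).det ≠ 0) :
    2 ^ n * complexDet M = (M - 1).det * shiftDet (cayley M) := by
  have hsym := cayley_transpose hM h1
  have e1 : cayley M * (M - 1) = Matrix.J (Fin n) ℝ * (M + 1) := by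
    rw [cayley, Matrix.mul_assoc, Matrix.nonsing_inv_mul _ (isUnit_iff_ne_zero.2 h1),
      Matrix.mul_one]
  have e2 : (Matrix.of fun i j => (((cayley M i j + cayley M j i) / 2 : ℝ) : ℂ) +
      if i = j then Complex.I else 0) = (cayley M).map Complex.ofReal + Complex.I • 1 := by
    ext i j
    have : cayley M j i = cayley M i j := by
      conv_rhs => rw [← hsym]
      rfl
    rw [Matrix.of_apply, this]
    simp [Matrix.one_apply]
  have e3 : ((M - 1).det : ℂ) = ((M - 1).map Complex.ofReal).det :=
    Complex.ofRealHom.map_det (M - 1)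
  have e4 : (cayley M).map Complex.ofReal * (M - 1).map Complex.ofReal =
      (Matrix.J (Fin n) ℝ * (M + 1)).map Complex.ofReal := by
    rw [← e1]
    exact (Matrix.map_mul (f := Complex.ofRealHom)).symm
  have e5 : (Matrix.J (Fin n) ℝ * (M + 1)).map Complex.ofReal =
      Matrix.J (Fin n) ℂ * (M.map Complex.ofReal + 1) := by
    rw [← Matrix.map_J (l := Fin n) (f := Complex.ofRealHom)]
    have h := Matrix.map_mul (f := Complex.ofRealHom) (L := Matrix.J (Fin n) ℝ) (M := M + 1)
    refine h.trans ?_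
    congr 1
    ext i j
    by_cases hij : i = j <;> simp [hij]
  have e6 : (M - 1).map Complex.ofReal = M.map Complex.ofReal - 1 := by
    ext i j
    by_cases h : i = j <;> simp [h]
  have e7 : shiftDet (cayley M) = ((cayley M).map Complex.ofReal + Complex.I • 1).det := by
    rw [← e2]
    rfl
  rw [← det_frame_eq, e3, mul_comm, e7, ← Matrix.det_mul,
    Matrix.add_mul ((cayley M).map Complex.ofReal), e4, e5, e6]
  congr 1
  simp only [Matrix.add_mul, Matrix.mul_add, Matrix.mul_sub, Matrix.mul_one, Matrix.smul_mul,
    Matrix.one_mul]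
  abel

/-- The phase of a symplectic matrix without eigenvalue one: an argument of `complexDet M` up to
sign, which depends continuously on `M` and is bounded. -/
noncomputable def phase (M : Mat2 n) : ℝ :=
  ((exists_log_shiftDet (Fin n ⊕ Fin n)).choose (cayley M)).im

theorem continuousOn_phase : ContinuousOn (phase : Mat2 n → ℝ) {M | (M - 1).det ≠ 0} :=
  (Complex.continuous_im.comp
    (exists_log_shiftDet (Fin n ⊕ Fin n)).choose_spec.1).comp_continuousOn continuousOn_cayley

theorem phase_mem_Icc (M : Mat2 n) : phase M ∈ Icc 0 (2 * n * Real.pi) := by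
  have h := (exists_log_shiftDet (Fin n ⊕ Fin n)).choose_spec.2.2 (cayley M)
  refine ⟨h.1, h.2.trans_eq ?_⟩
  rw [Fintype.card_sum, Fintype.card_fin]
  push_cast
  ring

theorem complexDet_eq_exp_phase {M : Mat2 n} (hM : M ∈ Matrix.symplecticGroup (Fin n) ℝ)
    (h1 : (M - 1).det ≠ 0) :
    ∃ c : ℝ, 0 < c ∧
      complexDet M = ((M - 1).det * c : ℝ) * Complex.exp (phase M * Complex.I) := by
  set l := (exists_log_shiftDet (Fin n ⊕ Fin n)).choose (cayley M) with hl
  refine ⟨Real.exp l.re / 2 ^ n, by positivity, ?_⟩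
  have h2 := complexDet_eq_shiftDet hM h1
  have h3 : Complex.exp l = shiftDet (cayley M) :=
    (exists_log_shiftDet (Fin n ⊕ Fin n)).choose_spec.2.1 (cayley M)
  have h4 : Complex.exp l = Complex.exp l.re * Complex.exp (phase M * Complex.I) := by
    rw [← Complex.exp_add, phase, ← hl, Complex.re_add_im]
  rw [← h3, h4] at h2
  have h5 : (2 : ℂ) ^ n ≠ 0 := pow_ne_zero _ two_ne_zero
  rw [← mul_right_inj' h5, h2]
  push_cast
  field_simp

theorem complexDet_ne_zero {M : Mat2 n} (hM : M ∈ Matrix.symplecticGroup (Fin n) ℝ)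
    (h1 : (M - 1).det ≠ 0) : complexDet M ≠ 0 := by
  obtain ⟨c, hc, h⟩ := complexDet_eq_exp_phase hM h1
  rw [h]
  have : (((M - 1).det * c : ℝ) : ℂ) ≠ 0 := by
    exact_mod_cast mul_ne_zero h1 hc.ne'
  exact mul_ne_zero this (Complex.exp_ne_zero _)

/-- Along a path that avoids the eigenvalue one, the rotation is the increment of the phase. -/
theorem HasRotation.eq_phase_sub {β : ℝ → Mat2 n} {a b x : ℝ} (hab : a ≤ b)
    (hβ : IsSympPath β a b) (h1 : ∀ t ∈ Icc a b, (β t - 1).det ≠ 0) (h : HasRotation β a b x) :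
    x = phase (β b) - phase (β a) := by
  obtain ⟨θ, hθ, hdet, rfl⟩ := h
  have h2 : IsAngleOn (fun t => Complex.exp (phase (β t) * Complex.I)) (fun t => phase (β t))
      (Icc a b) :=
    ⟨continuousOn_phase.comp hβ.1 h1, fun t _ => by simp [Complex.norm_exp_ofReal_mul_I]⟩
  refine IsAngleOn.sub_eq_sub (z := fun t => complexDet (β t)) ⟨hθ, hdet⟩ h2 hab fun t ht => ?_
  obtain ⟨c, -, hc⟩ := complexDet_eq_exp_phase (hβ.2 t ht) (h1 t ht)
  exact ⟨complexDet_ne_zero (hβ.2 t ht) (h1 t ht), _, hc⟩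

theorem hasRotation_phase_sub {β : ℝ → Mat2 n} {a b : ℝ}
    (hβ : IsSympPath β a b) (h1 : ∀ t ∈ Icc a b, (β t - 1).det ≠ 0) :
    HasRotation β a b (phase (β b) - phase (β a)) := by
  have hc : ContinuousOn (fun t => phase (β t)) (Icc a b) := continuousOn_phase.comp hβ.1 h1
  have hd : ContinuousOn (fun t => (β t - 1).det) (Icc a b) :=
    (Continuous.matrix_det continuous_id).comp_continuousOn (hβ.1.sub continuousOn_const)
  have hsign : (∀ t ∈ Icc a b, 0 < (β t - 1).det) ∨ ∀ t ∈ Icc a b, (β t - 1).det < 0 := by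
    by_contra! hcon
    obtain ⟨⟨s, hs, hs'⟩, t, ht, ht'⟩ := hcon
    obtain ⟨r, hr, hr'⟩ := isPreconnected_Icc.intermediate_value hs ht hd ⟨hs', ht'⟩
    exact h1 r hr hr'
  rcases hsign with hsign | hsign
  · refine ⟨fun t => phase (β t), hc, fun t ht => ?_, rfl⟩
    obtain ⟨c, hc, h⟩ := complexDet_eq_exp_phase (hβ.2 t ht) (h1 t ht)
    rw [h, norm_mul, Complex.norm_exp_ofReal_mul_I, mul_one, Complex.norm_real,
      Real.norm_of_nonneg (mul_pos (hsign t ht) hc).le]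
  · refine ⟨fun t => phase (β t) + Real.pi, hc.add continuousOn_const, fun t ht => ?_, by ring⟩
    obtain ⟨c, hc, h⟩ := complexDet_eq_exp_phase (hβ.2 t ht) (h1 t ht)
    rw [h, norm_mul, Complex.norm_exp_ofReal_mul_I, mul_one, Complex.norm_real,
      Real.norm_of_nonpos (mul_neg_of_neg_of_pos (hsign t ht) hc).le, Complex.ofReal_add, add_mul,
      Complex.exp_add, Complex.exp_pi_mul_I]
    push_cast
    ring

end phase

/-! ### Connectedness of the symplectic matrices without eigenvalue one -/

/-- The matrix with complex linear part `x + i y` and antilinear part `u + i v` (both halved). -/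
noncomputable def slMat (x y u v : ℝ) : Matrix (Fin 2) (Fin 2) ℝ :=
  !![(x + u) / 2, (v - y) / 2; (v + y) / 2, (x - u) / 2]

theorem det_slMat (x y u v : ℝ) :
    (slMat x y u v).det = (x ^ 2 + y ^ 2 - (u ^ 2 + v ^ 2)) / 4 := by
  rw [slMat, Matrix.det_fin_two_of]
  ring

theorem trace_slMat (x y u v : ℝ) : (slMat x y u v).trace = x := by
  rw [slMat, Matrix.trace_fin_two_of]
  ring

theorem eq_slMat (N : Matrix (Fin 2) (Fin 2) ℝ) :
    N = slMat (N 0 0 + N 1 1) (N 1 0 - N 0 1) (N 0 0 - N 1 1) (N 0 1 + N 1 0) := by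
  ext i j
  fin_cases i <;> fin_cases j <;> simp [slMat] <;> ring

theorem Continuous.slMat {x y u v : ℝ → ℝ} (hx : Continuous x) (hy : Continuous y)
    (hu : Continuous u) (hv : Continuous v) :
    Continuous fun s => slMat (x s) (y s) (u s) (v s) := by
  refine continuous_matrix fun i j => ?_
  fin_cases i <;> fin_cases j <;> simp [_root_.slMat] <;> fun_prop

/-- A curve of matrices in coordinates, as a path in a subset of `SL(2)` given by the trace. -/
theorem joinedIn_slMat {P : ℝ → Prop} {x y u v : ℝ → ℝ} (hx : Continuous x) (hy : Continuous y)
    (hu : Continuous u) (hv : Continuous v)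
    (h : ∀ s ∈ Icc (0 : ℝ) 1, x s ^ 2 + y s ^ 2 = 4 + (u s ^ 2 + v s ^ 2) ∧ P (x s)) :
    JoinedIn {N : Matrix (Fin 2) (Fin 2) ℝ | N.det = 1 ∧ P N.trace}
      (slMat (x 0) (y 0) (u 0) (v 0)) (slMat (x 1) (y 1) (u 1) (v 1)) := by
  refine JoinedIn.ofLine (Continuous.slMat hx hy hu hv).continuousOn rfl rfl ?_
  rintro _ ⟨s, hs, rfl⟩
  obtain ⟨h1, h2⟩ := h s hs
  refine ⟨?_, ?_⟩
  · rw [det_slMat, h1]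
    ring
  · rwa [trace_slMat]

theorem joinedIn_trace_lt {N : Matrix (Fin 2) (Fin 2) ℝ} (hN : N.det = 1) (ht : N.trace < 2) :
    JoinedIn {N : Matrix (Fin 2) (Fin 2) ℝ | N.det = 1 ∧ N.trace < 2} N
      !![-2, 0; 0, -2⁻¹] := by
  set x := N 0 0 + N 1 1
  set y := N 1 0 - N 0 1
  set u := N 0 0 - N 1 1
  set v := N 0 1 + N 1 0
  have hNs : N = slMat x y u v := eq_slMat N
  have hd : x ^ 2 + y ^ 2 = 4 + (u ^ 2 + v ^ 2) := by
    rw [hNs, det_slMat] at hN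
    linarith
  have hx : x < 2 := by rwa [hNs, trace_slMat] at ht
  -- shrink the antilinear part to zero
  set ρ : ℝ → ℝ := fun s => √((4 + (1 - s) ^ 2 * (u ^ 2 + v ^ 2)) / (4 + (u ^ 2 + v ^ 2))) with hρ
  have hpos : 0 < 4 + (u ^ 2 + v ^ 2) := by positivity
  have hρ2 : ∀ s, ρ s ^ 2 = (4 + (1 - s) ^ 2 * (u ^ 2 + v ^ 2)) / (4 + (u ^ 2 + v ^ 2)) :=
    fun s => Real.sq_sqrt (by positivity)
  have hρ0 : ρ 0 = 1 := by
    simp only [hρ]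
    rw [sub_zero, one_pow, one_mul, div_self hpos.ne', Real.sqrt_one]
  have hρle : ∀ s ∈ Icc (0 : ℝ) 1, ρ s ≤ 1 := by
    intro s hs
    rw [hρ, Real.sqrt_le_one, div_le_one hpos]
    have : (1 - s) ^ 2 ≤ 1 := by
      rw [sq_le_one_iff_abs_le_one, abs_le]
      constructor <;> linarith [hs.1, hs.2]
    nlinarith [sq_nonneg u, sq_nonneg v]
  have hρc : Continuous ρ := by fun_prop
  have hxρ : ∀ s ∈ Icc (0 : ℝ) 1, ρ s * x < 2 := by
    intro s hs
    have h0 : 0 ≤ ρ s := Real.sqrt_nonneg _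
    rcases le_or_gt x 0 with h | h
    · nlinarith
    · nlinarith [hρle s hs]
  have step1 := joinedIn_slMat (P := (· < 2)) (x := fun s => ρ s * x) (y := fun s => ρ s * y)
    (u := fun s => (1 - s) * u) (v := fun s => (1 - s) * v) (by fun_prop) (by fun_prop)
    (by fun_prop) (by fun_prop) (fun s hs => ⟨by
      rw [mul_pow, mul_pow, ← mul_add, hρ2, hd]
      field_simp, hxρ s hs⟩)
  simp only [hρ0, one_mul, sub_zero, sub_self, zero_mul] at step1
  -- rotate the complex linear part, of modulus two, to `-2` without passing through `2`
  set z : ℂ := ⟨ρ 1 * x, ρ 1 * y⟩ with hz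
  have hnz : ‖z‖ = 2 := by
    rw [← sq_eq_sq₀ (norm_nonneg _) (by norm_num), Complex.sq_norm, Complex.normSq_mk]
    have := hρ2 1
    rw [sub_self, zero_pow two_ne_zero, zero_mul, add_zero] at this
    have h4 : ρ 1 * x * (ρ 1 * x) + ρ 1 * y * (ρ 1 * y) = ρ 1 ^ 2 * (x ^ 2 + y ^ 2) := by ring
    rw [h4, this, hd]
    field_simp
    norm_num
  have hzx : ρ 1 * x = 2 * Real.cos z.arg := by
    rw [← hnz, Complex.norm_mul_cos_arg]
  have hzy : ρ 1 * y = 2 * Real.sin z.arg := by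
    rw [← hnz, Complex.norm_mul_sin_arg]
  set φ := z.arg
  have hφ0 : φ ≠ 0 := by
    intro h
    have := hxρ 1 (by simp)
    rw [hzx, h, Real.cos_zero] at this
    linarith
  have hφ1 : -Real.pi < φ := Complex.neg_pi_lt_arg z
  have hφ2 : φ ≤ Real.pi := Complex.arg_le_pi z
  obtain ⟨κ, hκ1, hκ2⟩ : ∃ κ : ℝ, (Real.cos κ = -1 ∧ Real.sin κ = 0) ∧
      ∀ s ∈ Icc (0 : ℝ) 1, Real.cos ((1 - s) * φ + s * κ) < 1 := by
    have hpi := Real.pi_pos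
    have hlt : ∀ w : ℝ, w ≠ 0 → -Real.pi ≤ w → w ≤ Real.pi → Real.cos w < 1 := by
      intro w hw h1 h2
      refine lt_of_le_of_ne (Real.cos_le_one w) fun h => hw ?_
      exact (Real.cos_eq_one_iff_of_lt_of_lt (by linarith) (by linarith)).1 h
    rcases lt_or_gt_of_ne hφ0 with h | h
    · refine ⟨-Real.pi, by simp, fun s hs => hlt _ ?_ ?_ ?_⟩
      · have h1 := hs.1
        have h2 := hs.2
        rcases eq_or_lt_of_le h1 with h3 | h3
        · rw [← h3]; linarith
        · nlinarith
      · nlinarith [hs.1, hs.2]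
      · nlinarith [hs.1, hs.2]
    · refine ⟨Real.pi, by simp, fun s hs => hlt _ ?_ ?_ ?_⟩
      · have h1 := hs.1
        have h2 := hs.2
        rcases eq_or_lt_of_le h1 with h3 | h3
        · rw [← h3]; linarith
        · nlinarith
      · nlinarith [hs.1, hs.2]
      · nlinarith [hs.1, hs.2]
  have step2 := joinedIn_slMat (P := (· < 2))
    (x := fun s => 2 * Real.cos ((1 - s) * φ + s * κ))
    (y := fun s => 2 * Real.sin ((1 - s) * φ + s * κ)) (u := fun _ => 0) (v := fun _ => 0)
    (by fun_prop) (by fun_prop) (by fun_prop) (by fun_prop) (fun s hs => ⟨by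
      nlinarith [Real.sin_sq_add_cos_sq ((1 - s) * φ + s * κ)], by linarith [hκ2 s hs]⟩)
  simp only [sub_zero, one_mul, zero_mul, add_zero, sub_self, zero_add, hκ1, ← hzx, ← hzy]
    at step2
  -- move along the diagonal matrices
  have step3 := joinedIn_slMat (P := (· < 2)) (x := fun s => -√(4 + (3 / 2 * s) ^ 2))
    (y := fun _ => 0) (u := fun s => -(3 / 2 * s)) (v := fun _ => 0)
    (by fun_prop) (by fun_prop) (by fun_prop) (by fun_prop) (fun s hs => ⟨by
      rw [neg_sq, Real.sq_sqrt (by positivity)]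
      ring, by linarith [Real.sqrt_nonneg (4 + (3 / 2 * s) ^ 2)]⟩)
  have hs4 : √(4 : ℝ) = 2 := by
    rw [show (4 : ℝ) = 2 ^ 2 by norm_num, Real.sqrt_sq (by norm_num)]
  have hs5 : √(4 + (3 / 2) ^ 2 : ℝ) = 5 / 2 := by
    rw [show (4 + (3 / 2) ^ 2 : ℝ) = (5 / 2) ^ 2 by norm_num, Real.sqrt_sq (by norm_num)]
  simp only [mul_zero, mul_one, ne_eq, OfNat.ofNat_ne_zero, not_false_eq_true, zero_pow,
    add_zero, hs4, hs5, neg_zero] at step3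
  have e2 : slMat (2 * -1) (2 * 0) 0 0 = slMat (-2) 0 0 0 := by norm_num
  rw [e2] at step2
  have e3 : slMat (-(5 / 2)) 0 (-(3 / 2)) 0 = !![-2, 0; 0, -2⁻¹] := by
    rw [slMat]
    norm_num
  rw [e3] at step3
  rw [hNs]
  exact (step1.trans step2).trans step3

theorem joinedIn_two_lt_trace {N : Matrix (Fin 2) (Fin 2) ℝ} (hN : N.det = 1)
    (ht : 2 < N.trace) :
    JoinedIn {N : Matrix (Fin 2) (Fin 2) ℝ | N.det = 1 ∧ 2 < N.trace} N
      !![2, 0; 0, 2⁻¹] := by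
  set x := N 0 0 + N 1 1
  set y := N 1 0 - N 0 1
  set u := N 0 0 - N 1 1
  set v := N 0 1 + N 1 0
  have hNs : N = slMat x y u v := eq_slMat N
  have hd : x ^ 2 + y ^ 2 = 4 + (u ^ 2 + v ^ 2) := by
    rw [hNs, det_slMat] at hN
    linarith
  have hx : 2 < x := by rwa [hNs, trace_slMat] at ht
  have hx4 : 0 < x ^ 2 - 4 := by nlinarith
  -- make the complex linear part real
  set ρ : ℝ → ℝ := fun s => √((x ^ 2 - 4 + (1 - s) ^ 2 * y ^ 2) / (x ^ 2 - 4 + y ^ 2)) with hρ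
  have hpos : 0 < x ^ 2 - 4 + y ^ 2 := by positivity
  have hρ2 : ∀ s, ρ s ^ 2 = (x ^ 2 - 4 + (1 - s) ^ 2 * y ^ 2) / (x ^ 2 - 4 + y ^ 2) :=
    fun s => Real.sq_sqrt (by positivity)
  have hρ0 : ρ 0 = 1 := by
    simp only [hρ]
    rw [sub_zero, one_pow, one_mul, div_self hpos.ne', Real.sqrt_one]
  have hρc : Continuous ρ := by fun_prop
  have huv : u ^ 2 + v ^ 2 = x ^ 2 - 4 + y ^ 2 := by linarith
  have step1 := joinedIn_slMat (P := (2 < ·)) (x := fun _ => x) (y := fun s => (1 - s) * y)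
    (u := fun s => ρ s * u) (v := fun s => ρ s * v) (by fun_prop) (by fun_prop)
    (by fun_prop) (by fun_prop) (fun s hs => ⟨by
      rw [mul_pow (ρ s), mul_pow (ρ s), ← mul_add, hρ2, huv]
      field_simp
      ring, hx⟩)
  simp only [hρ0, one_mul, sub_zero, sub_self, zero_mul] at step1
  -- make the antilinear part real and positive
  set z : ℂ := ⟨ρ 1 * u, ρ 1 * v⟩ with hz
  set R := √(x ^ 2 - 4) with hR
  have hR2 : R ^ 2 = x ^ 2 - 4 := Real.sq_sqrt hx4.le
  have hRpos : 0 < R := Real.sqrt_pos.2 hx4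
  have hnz : ‖z‖ = R := by
    rw [← sq_eq_sq₀ (norm_nonneg _) hRpos.le, Complex.sq_norm, Complex.normSq_mk, hR2]
    have := hρ2 1
    rw [sub_self, zero_pow two_ne_zero, zero_mul, add_zero] at this
    have h4 : ρ 1 * u * (ρ 1 * u) + ρ 1 * v * (ρ 1 * v) = ρ 1 ^ 2 * (u ^ 2 + v ^ 2) := by ring
    rw [h4, this, huv]
    field_simp
  have hzx : ρ 1 * u = R * Real.cos z.arg := by
    rw [← hnz, Complex.norm_mul_cos_arg]
  have hzy : ρ 1 * v = R * Real.sin z.arg := by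
    rw [← hnz, Complex.norm_mul_sin_arg]
  set φ := z.arg
  have step2 := joinedIn_slMat (P := (2 < ·)) (x := fun _ => x) (y := fun _ => 0)
    (u := fun s => R * Real.cos ((1 - s) * φ)) (v := fun s => R * Real.sin ((1 - s) * φ))
    (by fun_prop) (by fun_prop) (by fun_prop) (by fun_prop) (fun s hs => ⟨by
      rw [mul_pow R, mul_pow R, ← mul_add, Real.cos_sq_add_sin_sq, hR2]
      ring, hx⟩)
  simp only [sub_zero, one_mul, sub_self, zero_mul, Real.cos_zero, Real.sin_zero, mul_one,
    mul_zero, ← hzx, ← hzy] at step2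
  -- move along the diagonal matrices
  have step3 := joinedIn_slMat (P := (2 < ·))
    (x := fun s => √(4 + ((1 - s) * R + s * (3 / 2)) ^ 2))
    (y := fun _ => 0) (u := fun s => (1 - s) * R + s * (3 / 2)) (v := fun _ => 0)
    (by fun_prop) (by fun_prop) (by fun_prop) (by fun_prop) (fun s hs => ⟨by
      rw [Real.sq_sqrt (by positivity)]
      ring, by
      have h1 : 0 < (1 - s) * R + s * (3 / 2) := by
        rcases eq_or_lt_of_le hs.1 with h3 | h3
        · rw [← h3]; linarith
        · nlinarith [hs.2]
      rw [Real.lt_sqrt (by norm_num)]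
      nlinarith⟩)
  have hs4 : √(4 + R ^ 2) = x := by
    rw [hR2, show 4 + (x ^ 2 - 4) = x ^ 2 by ring, Real.sqrt_sq (by linarith)]
  have hs5 : √(4 + (3 / 2) ^ 2 : ℝ) = 5 / 2 := by
    rw [show (4 + (3 / 2) ^ 2 : ℝ) = (5 / 2) ^ 2 by norm_num, Real.sqrt_sq (by norm_num)]
  simp only [sub_zero, one_mul, zero_mul, add_zero, sub_self, zero_add, hs4, hs5] at step3
  have e3 : slMat (5 / 2) 0 (3 / 2) 0 = !![2, 0; 0, 2⁻¹] := by
    rw [slMat]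
    norm_num
  rw [e3] at step3
  rw [hNs]
  exact (step1.trans step2).trans step3

/-- The symplectic matrices without eigenvalue one. -/
def spStar (n : ℕ) : Set (Mat2 n) :=
  {M | M ∈ Matrix.symplecticGroup (Fin n) ℝ ∧ (M - 1).det ≠ 0}

theorem det_sub_one_of_det_eq_one {N : Matrix (Fin 2) (Fin 2) ℝ} (hN : N.det = 1) :
    (N - 1).det = 2 - N.trace := by
  rw [Matrix.det_fin_two] at hN ⊢
  rw [Matrix.trace_fin_two]
  simp
  linarith

theorem dsum_mem_spStar {n : ℕ} {N : Fin n → Matrix (Fin 2) (Fin 2) ℝ}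
    (h : ∀ i, (N i).det = 1 ∧ (N i).trace ≠ 2) : dsum N ∈ spStar n := by
  refine ⟨dsum_mem_symplecticGroup _ fun i => (h i).1, ?_⟩
  rw [← dsum_one, dsum_sub, det_dsum]
  refine Finset.prod_ne_zero_iff.2 fun i _ => ?_
  rw [det_sub_one_of_det_eq_one (h i).1]
  exact sub_ne_zero.2 (h i).2.symm

theorem fromBlocks_mem_spStar {n : ℕ} {X Y : Matrix (Fin n) (Fin n) ℝ} (h : X * Yᵀ = 1)
    (hX : (X - 1).det ≠ 0) (hY : (Y - 1).det ≠ 0) :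
    Matrix.fromBlocks X 0 0 Y ∈ spStar n := by
  refine ⟨?_, ?_⟩
  · have h' : Y * Xᵀ = 1 := by
      rw [← Matrix.transpose_transpose Y, ← Matrix.transpose_mul, h, Matrix.transpose_one]
    rw [SymplecticGroup.mem_iff, Matrix.J, Matrix.fromBlocks_transpose,
      Matrix.fromBlocks_multiply, Matrix.fromBlocks_multiply]
    simp [h, h']
  · have : Matrix.fromBlocks X 0 0 Y - 1 = Matrix.fromBlocks (X - 1) 0 0 (Y - 1) := by
      rw [← Matrix.fromBlocks_one]
      ext i j
      rcases i with i | i <;> rcases j with j | j <;> simp [Matrix.one_apply]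
    rw [this, Matrix.det_fromBlocks_zero₂₁]
    exact mul_ne_zero hX hY

theorem joinedIn_dsum {n : ℕ} {S : Fin n → Set (Matrix (Fin 2) (Fin 2) ℝ)}
    {N N' : Fin n → Matrix (Fin 2) (Fin 2) ℝ} (h : ∀ i, JoinedIn (S i) (N i) (N' i))
    (hS : ∀ i, ∀ X ∈ S i, X.det = 1 ∧ X.trace ≠ 2) : JoinedIn (spStar n) (dsum N) (dsum N') := by
  have h1 : JoinedIn (Set.pi univ S) N N' := by
    refine ⟨Path.pi fun i => (h i).somePath, fun t i _ => (h i).somePath_mem t⟩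
  refine (h1.map continuous_dsum).mono ?_
  rintro _ ⟨X, hX, rfl⟩
  exact dsum_mem_spStar fun i => hS i _ (hX i (mem_univ i))

theorem joinedIn_swap : JoinedIn (spStar 2) (dsum ![!![2, 0; 0, 2⁻¹], !![-2, 0; 0, -2⁻¹]])
    (baseMinus 2) := by
  refine JoinedIn.ofLine (f := fun s => Matrix.fromBlocks
      !![2 * Real.cos (Real.pi * s), 2 * Real.sin (Real.pi * s);
        2 * Real.sin (Real.pi * s), -(2 * Real.cos (Real.pi * s))] 0 0
      !![2⁻¹ * Real.cos (Real.pi * s), 2⁻¹ * Real.sin (Real.pi * s);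
        2⁻¹ * Real.sin (Real.pi * s), -(2⁻¹ * Real.cos (Real.pi * s))]) ?_ ?_ ?_ ?_
  · refine Continuous.continuousOn (Continuous.matrix_fromBlocks (continuous_matrix fun i j => ?_)
      continuous_const continuous_const (continuous_matrix fun i j => ?_))
    all_goals fin_cases i <;> fin_cases j <;> simp <;> fun_prop
  · ext i j
    rcases i with i | i <;> rcases j with j | j <;> fin_cases i <;> fin_cases j <;>
      simp [dsum]
  · ext i j
    rcases i with i | i <;> rcases j with j | j <;> fin_cases i <;> fin_cases j <;>
      simp [baseMinus, Matrix.diagonal]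
  · rintro _ ⟨s, -, rfl⟩
    have hcs := Real.sin_sq_add_cos_sq (Real.pi * s)
    refine fromBlocks_mem_spStar ?_ ?_ ?_
    · ext i j
      fin_cases i <;> fin_cases j <;> simp [Matrix.mul_apply, Fin.sum_univ_two] <;> linarith
    · rw [Matrix.det_fin_two]
      simp
      nlinarith
    · rw [Matrix.det_fin_two]
      simp
      nlinarith

theorem joinedIn_neg_base : JoinedIn (spStar 2)
    (dsum ![!![-2, 0; 0, -2⁻¹], !![-2, 0; 0, -2⁻¹]]) (basePlus 2) := by
  refine JoinedIn.ofLine (f := fun s => Matrix.fromBlocks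
      !![-(2 * Real.cos (Real.pi * s)), 2 * Real.sin (Real.pi * s);
        -(2 * Real.sin (Real.pi * s)), -(2 * Real.cos (Real.pi * s))] 0 0
      !![-(2⁻¹ * Real.cos (Real.pi * s)), 2⁻¹ * Real.sin (Real.pi * s);
        -(2⁻¹ * Real.sin (Real.pi * s)), -(2⁻¹ * Real.cos (Real.pi * s))]) ?_ ?_ ?_ ?_
  · refine Continuous.continuousOn (Continuous.matrix_fromBlocks (continuous_matrix fun i j => ?_)
      continuous_const continuous_const (continuous_matrix fun i j => ?_))
    all_goals fin_cases i <;> fin_cases j <;> simp <;> fun_prop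
  · ext i j
    rcases i with i | i <;> rcases j with j | j <;> fin_cases i <;> fin_cases j <;>
      simp [dsum]
  · ext i j
    rcases i with i | i <;> rcases j with j | j <;> fin_cases i <;> fin_cases j <;>
      simp [basePlus, Matrix.diagonal]
  · rintro _ ⟨s, -, rfl⟩
    have hcs := Real.sin_sq_add_cos_sq (Real.pi * s)
    have hle := Real.neg_one_le_cos (Real.pi * s)
    refine fromBlocks_mem_spStar ?_ ?_ ?_
    · ext i j
      fin_cases i <;> fin_cases j <;> simp [Matrix.mul_apply, Fin.sum_univ_two] <;> linarith
    · rw [Matrix.det_fin_two]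
      simp
      nlinarith
    · rw [Matrix.det_fin_two]
      simp
      nlinarith

/-- A symplectic sum of two `2 × 2` matrices without eigenvalue one can be connected, within the
matrices without eigenvalue one, with one of the two base points. -/
theorem exists_joinedIn_base {N : Fin 2 → Matrix (Fin 2) (Fin 2) ℝ} (hN : ∀ i, (N i).det = 1)
    (ht : ∀ i, (N i).trace ≠ 2) :
    ∃ B, (B = basePlus 2 ∨ B = baseMinus 2) ∧ JoinedIn (spStar 2) (dsum N) B := by
  have hd : dsum N = dsum ![N 0, N 1] := by
    congr 1
    ext i
    fin_cases i <;> rfl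
  have hplus : dsum ![!![2, 0; 0, 2⁻¹], !![2, 0; 0, 2⁻¹]] = basePlus 2 := by
    ext i j
    rcases i with i | i <;> rcases j with j | j <;> fin_cases i <;> fin_cases j <;>
      simp [dsum, basePlus, Matrix.diagonal]
  have hminus : dsum ![!![-2, 0; 0, -2⁻¹], !![2, 0; 0, 2⁻¹]] = baseMinus 2 := by
    ext i j
    rcases i with i | i <;> rcases j with j | j <;> fin_cases i <;> fin_cases j <;>
      simp [dsum, baseMinus, Matrix.diagonal]
  rw [hd]
  rcases lt_or_gt_of_ne (ht 0) with h0 | h0 <;> rcases lt_or_gt_of_ne (ht 1) with h1 | h1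
  · refine ⟨_, Or.inl rfl, JoinedIn.trans (joinedIn_dsum (N' := ![_, _]) (S := ![_, _])
      (Fin.forall_fin_two.2 ⟨joinedIn_trace_lt (hN 0) h0, joinedIn_trace_lt (hN 1) h1⟩)
      (Fin.forall_fin_two.2 ⟨fun X hX => ⟨hX.1, hX.2.ne⟩, fun X hX => ⟨hX.1, hX.2.ne⟩⟩))
      joinedIn_neg_base⟩
  · refine ⟨_, Or.inr rfl, ?_⟩
    rw [← hminus]
    exact joinedIn_dsum (N' := ![_, _]) (S := ![_, _])
      (Fin.forall_fin_two.2 ⟨joinedIn_trace_lt (hN 0) h0, joinedIn_two_lt_trace (hN 1) h1⟩)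
      (Fin.forall_fin_two.2 ⟨fun X hX => ⟨hX.1, hX.2.ne⟩, fun X hX => ⟨hX.1, hX.2.ne'⟩⟩)
  · refine ⟨_, Or.inr rfl, JoinedIn.trans (joinedIn_dsum (N' := ![_, _]) (S := ![_, _])
      (Fin.forall_fin_two.2 ⟨joinedIn_two_lt_trace (hN 0) h0, joinedIn_trace_lt (hN 1) h1⟩)
      (Fin.forall_fin_two.2 ⟨fun X hX => ⟨hX.1, hX.2.ne'⟩, fun X hX => ⟨hX.1, hX.2.ne⟩⟩))
      joinedIn_swap⟩
  · refine ⟨_, Or.inl rfl, ?_⟩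
    rw [← hplus]
    exact joinedIn_dsum (N' := ![_, _]) (S := ![_, _])
      (Fin.forall_fin_two.2 ⟨joinedIn_two_lt_trace (hN 0) h0, joinedIn_two_lt_trace (hN 1) h1⟩)
      (Fin.forall_fin_two.2 ⟨fun X hX => ⟨hX.1, hX.2.ne'⟩, fun X hX => ⟨hX.1, hX.2.ne'⟩⟩)

theorem JoinedIn.exists_isClosingPath {n : ℕ} {M B : Mat2 n} (hj : JoinedIn (spStar n) M B)
    (hB : B = basePlus n ∨ B = baseMinus n) : ∃ β, IsClosingPath β M ∧ β 1 = B := by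
  have hmem : ∀ t ∈ Icc (0 : ℝ) 1, hj.somePath.extend t ∈ spStar n := by
    intro t ht
    rw [Path.extend_apply _ ht]
    exact hj.somePath_mem _
  refine ⟨hj.somePath.extend, ⟨⟨hj.somePath.continuous_extend.continuousOn,
    fun t ht => (hmem t ht).1⟩, fun t ht => (hmem t ht).2, Path.extend_zero _, ?_⟩, Path.extend_one _⟩
  rw [Path.extend_one]
  exact hB

/-! ### Maslov-type index and mean index of sums of planar symplectic paths -/

theorem complexDet_dsum_ne_zero {n : ℕ} {N : Fin n → Matrix (Fin 2) (Fin 2) ℝ}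
    (h : ∀ i, (N i).det = 1) : complexDet (dsum N) ≠ 0 := by
  rw [complexDet_dsum]
  refine Finset.prod_ne_zero_iff.2 fun i _ h0 => ?_
  have h1 := congrArg Complex.re h0
  have h2 := congrArg Complex.im h0
  have h3 := h i
  simp only [Complex.zero_re, Complex.zero_im] at h1 h2
  rw [Matrix.det_fin_two] at h3
  rw [show N i 1 1 = -N i 0 0 by linarith, show N i 0 1 = N i 1 0 by linarith] at h3
  nlinarith [sq_nonneg (N i 0 0), sq_nonneg (N i 1 0)]

/-- Rotating a matrix of `SL(2)` by a small negative angle removes the eigenvalue one. -/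
theorem eventually_trace_rotation_mul_ne {N : Matrix (Fin 2) (Fin 2) ℝ} :
    ∀ᶠ δ in 𝓝[>] (0 : ℝ),
      (!![Real.cos δ, Real.sin δ; -Real.sin δ, Real.cos δ] * N).trace ≠ 2 := by
  have htr : ∀ δ, (!![Real.cos δ, Real.sin δ; -Real.sin δ, Real.cos δ] * N).trace =
      Real.cos δ * (N 0 0 + N 1 1) + Real.sin δ * (N 1 0 - N 0 1) := by
    intro δ
    rw [Matrix.trace_fin_two]
    simp [Matrix.mul_apply, Fin.sum_univ_two]
    ring
  simp only [htr]
  set x := N 0 0 + N 1 1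
  set y := N 1 0 - N 0 1
  by_cases hx : x = 2
  · have hc : ∀ᶠ δ in 𝓝[>] (0 : ℝ), y * Real.cos (δ / 2) - 2 * Real.sin (δ / 2) ≠ 0 := by
      by_cases hy : y = 0
      · have h4 : ∀ᶠ δ in 𝓝[>] (0 : ℝ), δ < 2 * Real.pi :=
          eventually_nhdsWithin_of_eventually_nhds (gt_mem_nhds (by positivity))
        filter_upwards [self_mem_nhdsWithin, h4] with δ hδ hδ' h0
        have hδ : (0 : ℝ) < δ := hδ
        have := Real.sin_pos_of_pos_of_lt_pi (x := δ / 2) (by linarith) (by linarith)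
        rw [hy] at h0
        linarith
      · have h5 : ContinuousAt (fun δ => y * Real.cos (δ / 2) - 2 * Real.sin (δ / 2)) 0 := by
          fun_prop
        refine eventually_nhdsWithin_of_eventually_nhds (h5.eventually_ne ?_)
        simpa using hy
    have h4 : ∀ᶠ δ in 𝓝[>] (0 : ℝ), δ < 2 * Real.pi :=
      eventually_nhdsWithin_of_eventually_nhds (gt_mem_nhds (by positivity))
    filter_upwards [self_mem_nhdsWithin, h4, hc] with δ hδ hδ' hδc h0
    have hδ : (0 : ℝ) < δ := hδ
    have hs := Real.sin_pos_of_pos_of_lt_pi (x := δ / 2) (by linarith) (by linarith)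
    have e1 : Real.sin δ = 2 * Real.sin (δ / 2) * Real.cos (δ / 2) := by
      rw [← Real.sin_two_mul]
      congr 1
      ring
    have e2 : Real.cos δ = 1 - 2 * Real.sin (δ / 2) ^ 2 := by
      have := Real.cos_two_mul (δ / 2)
      rw [show 2 * (δ / 2) = δ by ring] at this
      linarith [Real.sin_sq_add_cos_sq (δ / 2)]
    rw [hx, e1, e2] at h0
    refine hδc ((mul_eq_zero.1 (?_ : Real.sin (δ / 2) * _ = 0)).resolve_left hs.ne')
    linarith
  · have h5 : ContinuousAt (fun δ => Real.cos δ * x + Real.sin δ * y) 0 := by fun_prop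
    refine eventually_nhdsWithin_of_eventually_nhds (h5.eventually_ne ?_)
    simpa using hx

theorem exists_int_phase_sub {n : ℕ} {M : Mat2 n} (hM : M ∈ spStar n) {c x : ℝ}
    (h : complexDet M = c * Complex.exp (x * Complex.I)) :
    ∃ k : ℤ, phase M - x = k * Real.pi := by
  obtain ⟨d, hd, h1⟩ := complexDet_eq_exp_phase hM.1 hM.2
  have h2 : (((M - 1).det * d : ℝ) : ℂ) ≠ 0 := by exact_mod_cast mul_ne_zero hM.2 hd.ne'
  apply exists_int_mul_pi_of_exp_eq (c := ((M - 1).det * d)⁻¹ * c)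
  rw [Complex.ofReal_mul, Complex.ofReal_inv, mul_assoc, ← h, h1, inv_mul_cancel_left₀ h2]

section main
variable {γ : ℝ → Mat2 2} {N : ℝ → Fin 2 → Matrix (Fin 2) (Fin 2) ℝ} {Θ : ℝ → ℝ} {τ : ℝ}

theorem startPath_eq_dsum (n : ℕ) (τ t : ℝ) :
    startPath n τ t = dsum fun _ => !![2 - t / τ, 0; 0, (2 - t / τ)⁻¹] := by
  ext i j
  rcases i with i | i <;> rcases j with j | j <;> by_cases h : i = j <;>
    simp [startPath, dsum, Matrix.diagonal, h]

theorem basePlus_eq_dsum (n : ℕ) : basePlus n = dsum fun _ => !![2, 0; 0, 2⁻¹] := by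
  ext i j
  rcases i with i | i <;> rcases j with j | j <;> by_cases h : i = j <;>
    simp [basePlus, dsum, Matrix.diagonal, h]

theorem withStart_eq_dsum (hτ : 0 < τ) (hγ : ∀ t, γ t = dsum (N t))
    (hN : ∀ t i, (N t i).det = 1) (t : ℝ) :
    ∃ X : Fin 2 → Matrix (Fin 2) (Fin 2) ℝ, (∀ i, (X i).det = 1) ∧ withStart γ τ t = dsum X := by
  rw [withStart]
  split_ifs with h
  · refine ⟨_, fun i => ?_, startPath_eq_dsum _ _ _⟩
    have h2 : 2 * t / τ ≤ 1 := by rw [div_le_one hτ]; linarith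
    rw [Matrix.det_fin_two_of, mul_inv_cancel₀ (by linarith)]
    ring
  · exact ⟨_, hN _, hγ _⟩

theorem expNegJ_mul_dsum (δ : ℝ) {n : ℕ} (X : Fin n → Matrix (Fin 2) (Fin 2) ℝ) :
    expNegJ n δ * dsum X =
      dsum fun i => !![Real.cos δ, Real.sin δ; -Real.sin δ, Real.cos δ] * X i := by
  rw [expNegJ_eq_dsum, dsum_mul]

theorem det_rotation_mul (δ : ℝ) {X : Matrix (Fin 2) (Fin 2) ℝ} (hX : X.det = 1) :
    (!![Real.cos δ, Real.sin δ; -Real.sin δ, Real.cos δ] * X).det = 1 := by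
  rw [Matrix.det_mul, hX, Matrix.det_fin_two_of]
  nlinarith [Real.sin_sq_add_cos_sq δ]

theorem continuousOn_withStart (hτ : 0 < τ) (hγc : Continuous γ) (hγ0 : γ 0 = 1) :
    ContinuousOn (withStart γ τ) (Icc 0 τ) := by
  have h1 : ContinuousOn (fun t => startPath 2 τ (2 * t)) (Icc 0 (τ / 2)) := by
    have hinv : ContinuousOn (fun t => (2 - 2 * t / τ)⁻¹) (Icc 0 (τ / 2)) := by
      refine ContinuousOn.inv₀ (by fun_prop) fun t ht => ?_
      have h2 : 2 * t / τ ≤ 1 := by rw [div_le_one hτ]; linarith [ht.2]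
      linarith
    simp only [startPath_eq_dsum]
    refine continuous_dsum.comp_continuousOn (continuousOn_pi.2 fun _ => ?_)
    refine continuousOn_pi.2 fun i => continuousOn_pi.2 fun j => ?_
    fin_cases i <;> fin_cases j <;> simp <;> first | exact hinv | fun_prop
  have h2 : ContinuousOn (fun t => γ (2 * t - τ)) (Icc (τ / 2) τ) := by fun_prop
  have h3 : ContinuousOn (withStart γ τ) (Icc 0 (τ / 2)) :=
    h1.congr fun t ht => by rw [withStart, if_pos ht.2]
  have h4 : ContinuousOn (withStart γ τ) (Icc (τ / 2) τ) := by
    refine h2.congr fun t ht => ?_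
    rw [withStart]
    split_ifs with h
    · have : t = τ / 2 := le_antisymm h ht.1
      have e : 2 * (τ / 2) = τ := by ring
      beta_reduce
      rw [this, e, sub_self, hγ0, startPath_eq_dsum, div_self hτ.ne', ← dsum_one]
      congr 1
      funext i
      norm_num
      exact Matrix.one_fin_two.symm
    · rfl
  have h5 : Icc 0 τ = Icc 0 (τ / 2) ∪ Icc (τ / 2) τ :=
    (Icc_union_Icc_eq_Icc (by linarith) (by linarith)).symm
  rw [h5]
  exact h3.union_of_isClosed h4 isClosed_Icc isClosed_Icc

/-- The angle of `complexDet` along the rotated path, started at the base point. -/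
theorem isAngleOn_withStart (hτ : 0 < τ)
    (hΘ : IsAngleOn (fun t => complexDet (γ t)) Θ univ) (hΘ0 : Θ 0 = 0) (δ : ℝ) :
    IsAngleOn (fun t => complexDet (expNegJ 2 δ * withStart γ τ t))
      (fun t => -(2 * δ) + if t ≤ τ / 2 then 0 else Θ (2 * t - τ)) (Icc 0 τ) := by
  have hc : Continuous Θ := continuousOn_univ.1 hΘ.1
  refine ⟨?_, fun t ht => ?_⟩
  · refine Continuous.continuousOn (continuous_const.add (Continuous.if_le continuous_const
      (by fun_prop) continuous_id continuous_const fun t h => ?_))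
    have h : t = τ / 2 := h
    rw [h, show 2 * (τ / 2) - τ = 0 by ring, hΘ0]
  · simp only [complexDet_expNegJ_mul]
    rw [norm_mul, Complex.norm_exp_ofReal_mul_I, one_mul]
    push_cast
    rw [add_mul, Complex.exp_add, mul_left_comm]
    congr 1
    rw [withStart]
    split_ifs with h
    · have h2 : 2 * t / τ ≤ 1 := by rw [div_le_one hτ]; linarith
      have h3 : complexDet (startPath 2 τ (2 * t)) =
          (((2 - 2 * t / τ + (2 - 2 * t / τ)⁻¹) ^ 2 : ℝ) : ℂ) := by
        rw [startPath_eq_dsum, complexDet_dsum]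
        simp only [Finset.prod_const, Finset.card_univ, Fintype.card_fin]
        rw [Complex.ofReal_pow]
        congr 1
        apply Complex.ext
        · rw [Complex.ofReal_re]; simp
        · rw [Complex.ofReal_im]; simp
      rw [h3, Complex.norm_real, Real.norm_of_nonneg (sq_nonneg _)]
      simp
    · exact hΘ.2 _ (mem_univ _)

theorem isSympPath_withStart (hτ : 0 < τ) (hγc : Continuous γ) (hγ0 : γ 0 = 1)
    (hγ : ∀ t, γ t = dsum (N t)) (hN : ∀ t i, (N t i).det = 1) (δ : ℝ) :
    IsSympPath (fun t => expNegJ 2 δ * withStart γ τ t) 0 τ := by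
  refine ⟨continuousOn_const.mul (continuousOn_withStart hτ hγc hγ0), fun t ht => ?_⟩
  obtain ⟨X, hX, h⟩ := withStart_eq_dsum hτ hγ hN t
  beta_reduce
  rw [h, expNegJ_mul_dsum]
  exact dsum_mem_symplecticGroup _ fun i => det_rotation_mul δ (hX i)

theorem hasRotation_withStart_iff (hτ : 0 < τ)
    (hγ : ∀ t, γ t = dsum (N t)) (hN : ∀ t i, (N t i).det = 1)
    (hΘ : IsAngleOn (fun t => complexDet (γ t)) Θ univ) (hΘ0 : Θ 0 = 0) (δ x : ℝ) :
    HasRotation (fun t => expNegJ 2 δ * withStart γ τ t) 0 τ x ↔ x = Θ τ := by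
  have h := isAngleOn_withStart (γ := γ) hτ hΘ hΘ0 δ
  have hend : ∀ δ : ℝ, Θ τ = (-(2 * δ) + if τ ≤ τ / 2 then 0 else Θ (2 * τ - τ)) -
      (-(2 * δ) + if 0 ≤ τ / 2 then 0 else Θ (2 * 0 - τ)) := by
    intro δ
    rw [if_neg (by linarith), if_pos (by linarith), show 2 * τ - τ = τ by ring]
    ring
  constructor
  · rintro ⟨θ, hθ, h1, rfl⟩
    rw [hend δ]
    refine IsAngleOn.sub_eq_sub ⟨hθ, h1⟩ h hτ.le fun t ht => ⟨?_, 1, by simp⟩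
    obtain ⟨X, hX, h⟩ := withStart_eq_dsum hτ hγ hN t
    beta_reduce
    rw [h, expNegJ_mul_dsum]
    exact complexDet_dsum_ne_zero fun i => det_rotation_mul δ (hX i)
  · rintro rfl
    exact ⟨_, h.1, h.2, hend δ⟩

theorem withStart_zero (hτ : 0 < τ) : withStart γ τ 0 = basePlus 2 := by
  rw [withStart, if_pos (by linarith), startPath_eq_dsum, basePlus_eq_dsum]
  simp

theorem withStart_right (hτ : 0 < τ) : withStart γ τ τ = γ τ := by
  rw [withStart, if_neg (by linarith), show 2 * τ - τ = τ by ring]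

/-- Any Maslov-type index agrees with the rotation in units of `π` up to a universal error. -/
theorem IsMaslovIndex.abs_sub_le (hτ : 0 < τ)
    (hγ : ∀ t, γ t = dsum (N t)) (hN : ∀ t i, (N t i).det = 1)
    (hΘ : IsAngleOn (fun t => complexDet (γ t)) Θ univ) (hΘ0 : Θ 0 = 0) {k : ℤ}
    (hk : IsMaslovIndex γ τ k) : |k * Real.pi - Θ τ| ≤ 8 * Real.pi := by
  obtain ⟨δ, -, β₀, β₁, x₀, x, x₁, h0, h1, hr0, hr, hr1, heq⟩ := hk.exists
  rw [hasRotation_withStart_iff hτ hγ hN hΘ hΘ0] at hr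
  have e0 := hr0.eq_phase_sub zero_le_one h0.1 h0.2.1
  have e1 := hr1.eq_phase_sub zero_le_one h1.1 h1.2.1
  have b1 := phase_mem_Icc (β₀ 0)
  have b2 := phase_mem_Icc (β₀ 1)
  have b3 := phase_mem_Icc (β₁ 0)
  have b4 := phase_mem_Icc (β₁ 1)
  push_cast at b1 b2 b3 b4
  rw [← heq, hr, abs_le]
  constructor <;> linarith [b1.1, b1.2, b2.1, b2.2, b3.1, b3.2, b4.1, b4.2]

theorem exists_isMaslovIndex (hτ : 0 < τ) (hγc : Continuous γ) (hγ0 : γ 0 = 1)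
    (hγ : ∀ t, γ t = dsum (N t)) (hN : ∀ t i, (N t i).det = 1)
    (hΘ : IsAngleOn (fun t => complexDet (γ t)) Θ univ) (hΘ0 : Θ 0 = 0) :
    ∃ k : ℤ, IsMaslovIndex γ τ k := by
  have hb : ∀ X : Fin 2 → Matrix (Fin 2) (Fin 2) ℝ, ∀ᶠ δ in 𝓝[>] (0 : ℝ), ∀ i,
      (!![Real.cos δ, Real.sin δ; -Real.sin δ, Real.cos δ] * X i).trace ≠ 2 :=
    fun X => eventually_all.2 fun i => eventually_trace_rotation_mul_ne
  obtain ⟨δ₀, hδ₀, hsub⟩ := mem_nhdsGT_iff_exists_Ioo_subset.1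
    ((hb fun _ => !![2, 0; 0, 2⁻¹]).and (hb (N τ)))
  have hδ₀ : (0 : ℝ) < δ₀ := hδ₀
  have hdet2 : (!![2, 0; 0, 2⁻¹] : Matrix (Fin 2) (Fin 2) ℝ).det = 1 := by
    rw [Matrix.det_fin_two_of]
    norm_num
  -- both ends of the rotated path stay without eigenvalue one for `0 < δ < δ₀`
  have hmem : ∀ X : Fin 2 → Matrix (Fin 2) (Fin 2) ℝ, (∀ i, (X i).det = 1) → ∀ δ,
      (∀ i, (!![Real.cos δ, Real.sin δ; -Real.sin δ, Real.cos δ] * X i).trace ≠ 2) →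
      expNegJ 2 δ * dsum X ∈ spStar 2 := by
    intro X hX δ h
    rw [expNegJ_mul_dsum]
    exact dsum_mem_spStar fun i => ⟨det_rotation_mul δ (hX i), h i⟩
  have key : ∀ X : Fin 2 → Matrix (Fin 2) (Fin 2) ℝ, (∀ i, (X i).det = 1) →
      (∀ δ ∈ Ioo 0 δ₀, ∀ i,
        (!![Real.cos δ, Real.sin δ; -Real.sin δ, Real.cos δ] * X i).trace ≠ 2) →
      ∃ B, B ∈ spStar 2 ∧ (∃ k : ℤ, phase B = k * Real.pi) ∧ ∀ δ ∈ Ioo 0 δ₀, ∃ β,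
        IsClosingPath β (expNegJ 2 δ * dsum X) ∧ β 1 = B := by
    intro X hX h
    have hm : δ₀ / 2 ∈ Ioo 0 δ₀ := ⟨by linarith, by linarith⟩
    obtain ⟨B, hB, hj⟩ := exists_joinedIn_base
      (N := fun i => !![Real.cos (δ₀ / 2), Real.sin (δ₀ / 2);
        -Real.sin (δ₀ / 2), Real.cos (δ₀ / 2)] * X i)
      (fun i => det_rotation_mul _ (hX i)) (h _ hm)
    rw [← expNegJ_mul_dsum] at hj
    refine ⟨B, hj.target_mem, ?_, fun δ hδ => ?_⟩
    · have hreal : ∃ c : ℝ, complexDet B = c := by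
        have hB' : ∃ d : Fin 2 → ℝ × ℝ, B = dsum fun i => !![(d i).1, 0; 0, (d i).2] := by
          rcases hB with rfl | rfl
          · exact ⟨fun _ => (2, 2⁻¹), basePlus_eq_dsum 2⟩
          · refine ⟨fun i => if (i : ℕ) = 0 then (-2, -2⁻¹) else (2, 2⁻¹), ?_⟩
            ext i j
            rcases i with i | i <;> rcases j with j | j <;> fin_cases i <;> fin_cases j <;>
              simp [baseMinus, dsum, Matrix.diagonal]
        obtain ⟨d, rfl⟩ := hB'
        refine ⟨∏ i, ((d i).1 + (d i).2), ?_⟩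
        rw [complexDet_dsum, Complex.ofReal_prod]
        refine Finset.prod_congr rfl fun i _ => ?_
        apply Complex.ext
        · rw [Complex.ofReal_re]; simp
        · rw [Complex.ofReal_im]; simp
      obtain ⟨c, hc⟩ := hreal
      obtain ⟨k, hk⟩ := exists_int_phase_sub hj.target_mem (c := c) (x := 0) (by simpa using hc)
      exact ⟨k, by simpa using hk⟩
    · refine JoinedIn.exists_isClosingPath (JoinedIn.trans ?_ hj) hB
      refine JoinedIn.ofLine
        (f := fun s => expNegJ 2 ((1 - s) * δ + s * (δ₀ / 2)) * dsum X) ?_ (by simp) (by simp) ?_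
      · exact Continuous.continuousOn
          ((continuous_expNegJ.comp (by fun_prop)).mul continuous_const)
      · rintro _ ⟨s, hs, rfl⟩
        refine hmem X hX _ (h _ ?_)
        rw [mem_Ioo] at hδ ⊢
        constructor <;> nlinarith [hs.1, hs.2]
  obtain ⟨B₀, hB₀, ⟨k₀, hk₀⟩, hβ₀⟩ := key (fun _ => !![2, 0; 0, 2⁻¹]) (fun _ => hdet2)
    fun δ hδ => (hsub hδ).1
  obtain ⟨B₁, hB₁, ⟨k₁, hk₁⟩, hβ₁⟩ := key (N τ) (hN τ) fun δ hδ => (hsub hδ).2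
  rw [← basePlus_eq_dsum] at hβ₀
  rw [← hγ] at hβ₁
  have hm₀ : ∀ δ ∈ Ioo 0 δ₀, expNegJ 2 δ * basePlus 2 ∈ spStar 2 := fun δ hδ => by
    rw [basePlus_eq_dsum]
    exact hmem _ (fun _ => hdet2) δ (hsub hδ).1
  have hm₁ : ∀ δ ∈ Ioo 0 δ₀, expNegJ 2 δ * γ τ ∈ spStar 2 := fun δ hδ => by
    rw [hγ]
    exact hmem _ (hN τ) δ (hsub hδ).2
  -- the total angle, as a function of `δ`
  set w : ℝ → ℝ := fun δ => -(phase B₀ - phase (expNegJ 2 δ * basePlus 2)) + Θ τ +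
    (phase B₁ - phase (expNegJ 2 δ * γ τ)) with hw
  have hwc : ContinuousOn w (Ioo 0 δ₀) := by
    have hp : ∀ M : Mat2 2, (∀ δ ∈ Ioo 0 δ₀, expNegJ 2 δ * M ∈ spStar 2) →
        ContinuousOn (fun δ => phase (expNegJ 2 δ * M)) (Ioo 0 δ₀) := fun M hM =>
      continuousOn_phase.comp (continuous_expNegJ.mul continuous_const).continuousOn
        fun δ hδ => (hM δ hδ).2
    exact ((continuousOn_const.sub (hp _ hm₀)).neg.add continuousOn_const).add
      (continuousOn_const.sub (hp _ hm₁))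
  have hwk : ∀ δ ∈ Ioo 0 δ₀, ∃ k : ℤ, w δ = k * Real.pi := by
    intro δ hδ
    have e0 : complexDet (expNegJ 2 δ * basePlus 2) =
        (((2 + 2⁻¹) ^ 2 : ℝ) : ℂ) * Complex.exp ((-(2 * δ) : ℝ) * Complex.I) := by
      rw [complexDet_expNegJ_mul, basePlus_eq_dsum, complexDet_dsum, mul_comm]
      simp only [Finset.prod_const, Finset.card_univ, Fintype.card_fin]
      congr 1
      rw [Complex.ofReal_pow]
      congr 1
      apply Complex.ext
      · rw [Complex.ofReal_re]; simp
      · rw [Complex.ofReal_im]; simp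
    have e1 : complexDet (expNegJ 2 δ * γ τ) =
        ((‖complexDet (γ τ)‖ : ℝ) : ℂ) * Complex.exp ((Θ τ - 2 * δ : ℝ) * Complex.I) := by
      rw [complexDet_expNegJ_mul]
      have := hΘ.2 τ (mem_univ τ)
      simp only at this
      conv_lhs => rw [this]
      rw [sub_eq_add_neg, Complex.ofReal_add (Θ τ), add_mul, Complex.exp_add]
      push_cast
      ring
    obtain ⟨l₀, hl₀⟩ := exists_int_phase_sub (hm₀ δ hδ) e0
    obtain ⟨l₁, hl₁⟩ := exists_int_phase_sub (hm₁ δ hδ) e1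
    refine ⟨l₀ - k₀ + k₁ - l₁, ?_⟩
    simp only [hw]
    rw [hk₀, hk₁]
    push_cast
    linarith
  obtain ⟨k, hk⟩ := hwk (δ₀ / 2) ⟨by linarith, by linarith⟩
  refine ⟨k, ?_⟩
  filter_upwards [Ioo_mem_nhdsGT hδ₀] with δ hδ
  refine ⟨isSympPath_withStart hτ hγc hγ0 hγ hN δ, ?_⟩
  obtain ⟨β₀, hc₀, he₀⟩ := hβ₀ δ hδ
  obtain ⟨β₁, hc₁, he₁⟩ := hβ₁ δ hδ
  refine ⟨β₀, β₁, _, _, _, ?_, ?_, hasRotation_phase_sub hc₀.1 hc₀.2.1,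
    (hasRotation_withStart_iff hτ hγ hN hΘ hΘ0 δ _).2 rfl,
    hasRotation_phase_sub hc₁.1 hc₁.2.1, ?_⟩
  · beta_reduce
    rwa [withStart_zero hτ]
  · beta_reduce
    rwa [withStart_right hτ]
  · rw [he₀, he₁, hc₀.2.2.1, hc₁.2.2.1, ← hk]
    exact eq_of_continuousOn_of_int_mul_pi isPreconnected_Ioo hwc hwk hδ
      ⟨by linarith, by linarith⟩

/-- For a symplectic path that is its own iteration, the mean index is the asymptotic rotation
of `complexDet` in units of `π`. -/
theorem isMeanIndex_iff {T ρ : ℝ} (hT : 0 < T) (hγc : Continuous γ) (hγ0 : γ 0 = 1)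
    (hγ : ∀ t, γ t = dsum (N t)) (hN : ∀ t i, (N t i).det = 1)
    (hiter : iteratePath γ T = γ)
    (hΘ : IsAngleOn (fun t => complexDet (γ t)) Θ univ) (hΘ0 : Θ 0 = 0)
    (hlim : Tendsto (fun m : ℕ => Θ (m * T) / m) atTop (𝓝 (ρ * Real.pi))) (x : ℝ) :
    IsMeanIndex γ T x ↔ x = ρ := by
  have hpos : ∀ m : ℕ, 1 ≤ m → 0 < m * T := fun m hm => by
    have : (0 : ℝ) < m := by exact_mod_cast hm
    positivity
  have hpi := Real.pi_pos
  have key : ∀ i : ℕ → ℤ, (∀ m : ℕ, 1 ≤ m → IsMaslovIndex γ (m * T) (i m)) →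
      Tendsto (fun m : ℕ => (i m : ℝ) / m) atTop (𝓝 ρ) := by
    intro i hi
    have h1 : Tendsto (fun m : ℕ => Θ (m * T) / m / Real.pi) atTop (𝓝 ρ) := by
      have := hlim.div_const Real.pi
      rwa [mul_div_cancel_right₀ _ hpi.ne'] at this
    have h2 : Tendsto (fun m : ℕ => (8 : ℝ) / m) atTop (𝓝 0) :=
      tendsto_const_div_atTop_nhds_zero_nat 8
    have h3 : Tendsto (fun m : ℕ => (i m : ℝ) / m - Θ (m * T) / m / Real.pi) atTop (𝓝 0) := by
      refine squeeze_zero_norm' ?_ h2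
      filter_upwards [eventually_ge_atTop 1] with m hm
      have hm' : (0 : ℝ) < m := by exact_mod_cast hm
      have h4 := (hi m hm).abs_sub_le (hpos m hm) hγ hN hΘ hΘ0
      have h5 : (i m : ℝ) / m - Θ (m * T) / m / Real.pi =
          (i m * Real.pi - Θ (m * T)) / (m * Real.pi) := by
        field_simp
      rw [h5, Real.norm_eq_abs, abs_div, abs_of_pos (mul_pos hm' hpi), div_le_div_iff₀
        (mul_pos hm' hpi) hm']
      nlinarith
    have := h3.add h1
    simpa using this
  rw [IsMeanIndex, hiter]
  constructor
  · rintro ⟨i, hi, hx⟩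
    exact tendsto_nhds_unique hx (key i hi)
  · rintro rfl
    have hex : ∀ m : ℕ, ∃ k : ℤ, 1 ≤ m → IsMaslovIndex γ (m * T) k := by
      intro m
      by_cases hm : 1 ≤ m
      · obtain ⟨k, hk⟩ := exists_isMaslovIndex (hpos m hm) hγc hγ0 hγ hN hΘ hΘ0
        exact ⟨k, fun _ => hk⟩
      · exact ⟨0, fun h => absurd h hm⟩
    choose i hi using hex
    exact ⟨i, hi, key i hi⟩
end main

/-! ### Global solutions of ordinary differential equations -/

/-- A bounded vector field that is Lipschitz in space has global solutions. -/
theorem exists_global_solution {E : Type*} [NormedAddCommGroup E] [NormedSpace ℝ E]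
    [CompleteSpace E] {v : ℝ → E → E} {K : NNReal} {B : ℝ} (hv : ∀ t, LipschitzWith K (v t))
    (hc : ∀ x, Continuous fun t => v t x) (hB : ∀ t x, ‖v t x‖ ≤ B) (x₀ : E) :
    ∃ α : ℝ → E, α 0 = x₀ ∧ ∀ t, HasDerivAt α (v t (α t)) t := by
  have hB0 : 0 ≤ B := (norm_nonneg _).trans (hB 0 x₀)
  have hloc : ∀ n : ℕ, ∃ α : ℝ → E, α 0 = x₀ ∧
      ∀ t ∈ Icc (-(n : ℝ)) n, HasDerivWithinAt α (v t (α t)) (Icc (-(n : ℝ)) n) t := by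
    intro n
    have h0 : (0 : ℝ) ∈ Icc (-(n : ℝ)) n := ⟨by simp, by simp⟩
    have hpl : IsPicardLindelof v (⟨0, h0⟩ : Icc (-(n : ℝ)) n) x₀ (B.toNNReal * n) 0 B.toNNReal K :=
      { lipschitzOnWith := fun t _ => (hv t).lipschitzOnWith
        continuousOn := fun x _ => (hc x).continuousOn
        norm_le := fun t _ x _ => by
          rw [Real.coe_toNNReal B hB0]
          exact hB t x
        mul_max_le := by simp }
    exact hpl.exists_eq_forall_mem_Icc_hasDerivWithinAt₀
  choose α hα0 hα using hloc
  have hd : ∀ (n : ℕ) (t : ℝ), |t| < n → HasDerivAt (α n) (v t (α n t)) t := by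
    intro n t ht
    rw [abs_lt] at ht
    exact (hα n t ⟨ht.1.le, ht.2.le⟩).hasDerivAt (Icc_mem_nhds ht.1 ht.2)
  have heq : ∀ m n : ℕ, m ≤ n → ∀ t : ℝ, |t| < m → α m t = α n t := by
    intro m n hmn t ht
    have hmn' : (m : ℝ) ≤ n := by exact_mod_cast hmn
    have hm0 : (0 : ℝ) < m := (abs_nonneg t).trans_lt ht
    refine ODE_solution_unique_of_mem_Ioo (v := v) (s := fun _ => univ) (K := K) (t₀ := 0)
      (a := -m) (b := m) (fun t _ => (hv t).lipschitzOnWith) ⟨by linarith, hm0⟩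
      (fun s hs => ⟨hd m s (abs_lt.2 hs), mem_univ _⟩)
      (fun s hs => ⟨hd n s ((abs_lt.2 hs).trans_le hmn'), mem_univ _⟩) ?_ (abs_lt.1 ht)
    rw [hα0, hα0]
  have heq' : ∀ m n : ℕ, ∀ t : ℝ, |t| < m → |t| < n → α m t = α n t := by
    intro m n t hm hn
    rcases le_total m n with h | h
    · exact heq m n h t hm
    · exact (heq n m h t hn).symm
  have hlt : ∀ t : ℝ, |t| < (⌈|t|⌉₊ + 1 : ℕ) := fun t => by
    push_cast
    linarith [Nat.le_ceil |t|]
  refine ⟨fun t => α (⌈|t|⌉₊ + 1) t, hα0 _, fun t => ?_⟩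
  refine (hd _ t (hlt t)).congr_of_eventuallyEq ?_
  filter_upwards [continuous_abs.continuousAt.eventually (gt_mem_nhds (hlt t))] with s hs
  exact heq' _ _ s (hlt s) hs

/-! ### Hill's equation -/

/-- `(p, z)` solves `p' = -q z`, `z' = p`. -/
def IsHill (q p z : ℝ → ℝ) : Prop :=
  ∀ t, HasDerivAt p (-(q t * z t)) t ∧ HasDerivAt z (p t) t

/-- Solutions of Hill's equation in polar coordinates: the angle solves an equation with bounded
right-hand side, and the radius is found by integration. -/
theorem exists_isHill {q : ℝ → ℝ} (hq : Continuous q) {B : ℝ} (hB : ∀ t, |q t| ≤ B) (α₀ : ℝ) :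
    ∃ p z, IsHill q p z ∧ p 0 = Real.cos α₀ ∧ z 0 = Real.sin α₀ := by
  have hB0 : 0 ≤ B := (abs_nonneg _).trans (hB 0)
  set v : ℝ → ℝ → ℝ := fun t x => Real.cos x ^ 2 + q t * Real.sin x ^ 2 with hv
  have hvd : ∀ t x, HasDerivAt (v t) ((q t - 1) * (2 * Real.sin x * Real.cos x)) x := by
    intro t x
    have h1 := (Real.hasDerivAt_cos x).pow 2
    have h2 := ((Real.hasDerivAt_sin x).pow 2).const_mul (q t)
    refine (h1.add h2).congr_deriv ?_
    simp
    ring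
  have hlip : ∀ t, LipschitzWith (2 * (B + 1)).toNNReal (v t) := by
    intro t
    refine lipschitzWith_of_nnnorm_deriv_le (fun x => (hvd t x).differentiableAt) fun x => ?_
    rw [(hvd t x).deriv, ← NNReal.coe_le_coe, coe_nnnorm, Real.norm_eq_abs, abs_mul,
      Real.coe_toNNReal _ (by positivity)]
    have h1 : |q t - 1| ≤ B + 1 := by
      have := abs_sub (q t) 1
      rw [abs_one] at this
      linarith [hB t]
    have h2 : |2 * Real.sin x * Real.cos x| ≤ 2 := by
      rw [abs_mul, abs_mul, abs_two]
      nlinarith [Real.abs_sin_le_one x, Real.abs_cos_le_one x, abs_nonneg (Real.sin x),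
        abs_nonneg (Real.cos x)]
    nlinarith [abs_nonneg (q t - 1), abs_nonneg (2 * Real.sin x * Real.cos x)]
  obtain ⟨α, hα0, hα⟩ := exists_global_solution (v := v) hlip (fun x => by fun_prop)
    (B := 1 + B) (fun t x => by
      have h1 : |q t * Real.sin x ^ 2| ≤ B := by
        rw [abs_mul, abs_of_nonneg (sq_nonneg (Real.sin x))]
        nlinarith [hB t, Real.sin_sq_le_one x, abs_nonneg (q t), sq_nonneg (Real.sin x)]
      have h2 : |Real.cos x ^ 2| ≤ 1 := by
        rw [abs_of_nonneg (sq_nonneg _)]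
        exact Real.cos_sq_le_one x
      exact (abs_add_le _ _).trans (add_le_add h2 h1)) α₀
  have hαc : Continuous α := continuous_iff_continuousAt.2 fun t => (hα t).continuousAt
  set g : ℝ → ℝ := fun t => (1 - q t) * (Real.sin (α t) * Real.cos (α t)) with hg
  have hgc : Continuous g := by fun_prop
  set l : ℝ → ℝ := fun t => ∫ s in (0 : ℝ)..t, g s with hl
  have hld : ∀ t, HasDerivAt l (g t) t := fun t =>
    intervalIntegral.integral_hasDerivAt_right (hgc.intervalIntegrable _ _)
      (hgc.stronglyMeasurableAtFilter _ _) hgc.continuousAt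
  refine ⟨fun t => Real.exp (l t) * Real.cos (α t), fun t => Real.exp (l t) * Real.sin (α t),
    fun t => ⟨?_, ?_⟩, ?_, ?_⟩
  · refine ((hld t).exp.mul (hα t).cos).congr_deriv ?_
    simp only [hv, hg]
    linear_combination (-Real.exp (l t) * Real.sin (α t) * q t) *
      (Real.sin_sq_add_cos_sq (α t))
  · refine ((hld t).exp.mul (hα t).sin).congr_deriv ?_
    simp only [hv, hg]
    linear_combination (Real.exp (l t) * Real.cos (α t)) *
      (Real.sin_sq_add_cos_sq (α t))
  · simp [hl, hα0]
  · simp [hl, hα0]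

/-- The Wronskian of two solutions of Hill's equation is constant. -/
theorem IsHill.wronskian_eq {q p z p' z' : ℝ → ℝ} (h : IsHill q p z) (h' : IsHill q p' z')
    (t : ℝ) : p t * z' t - z t * p' t = p 0 * z' 0 - z 0 * p' 0 := by
  have hd : ∀ s, HasDerivAt (fun s => p s * z' s - z s * p' s) 0 s := by
    intro s
    refine (((h s).1.mul (h' s).2).sub ((h s).2.mul (h' s).1)).congr_deriv ?_
    ring
  exact is_const_of_deriv_eq_zero (fun s => (hd s).differentiableAt) (fun s => (hd s).deriv) t 0

/-- `N` is the fundamental matrix of Hill's equation with potential `q`. -/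
def IsHillMatrix (q : ℝ → ℝ) (N : ℝ → Matrix (Fin 2) (Fin 2) ℝ) : Prop :=
  N 0 = 1 ∧ ∀ j, IsHill q (fun t => N t 0 j) fun t => N t 1 j

theorem exists_isHillMatrix {q : ℝ → ℝ} (hq : Continuous q) {B : ℝ} (hB : ∀ t, |q t| ≤ B) :
    ∃ N, IsHillMatrix q N := by
  obtain ⟨p, z, h, hp, hz⟩ := exists_isHill hq hB 0
  obtain ⟨p', z', h', hp', hz'⟩ := exists_isHill hq hB (Real.pi / 2)
  refine ⟨fun t => !![p t, p' t; z t, z' t], ?_, fun j => ?_⟩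
  · simp only [hp, hz, hp', hz', Real.cos_zero, Real.sin_zero, Real.cos_pi_div_two,
      Real.sin_pi_div_two]
    exact Matrix.one_fin_two.symm
  · fin_cases j
    · simpa using h
    · simpa using h'

namespace IsHillMatrix
variable {q : ℝ → ℝ} {N : ℝ → Matrix (Fin 2) (Fin 2) ℝ}

theorem det_eq_one (h : IsHillMatrix q N) (t : ℝ) : (N t).det = 1 := by
  have := (h.2 0).wronskian_eq (h.2 1) t
  rw [Matrix.det_fin_two]
  simp only [h.1, Matrix.one_apply_eq] at this
  simp at this
  linarith

theorem continuous (h : IsHillMatrix q N) : Continuous N := by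
  refine continuous_matrix fun i j => continuous_iff_continuousAt.2 fun t => ?_
  fin_cases i
  · exact (h.2 j t).1.continuousAt
  · exact (h.2 j t).2.continuousAt

/-- Every solution is the fundamental matrix applied to its initial value. -/
theorem eq_mul (h : IsHillMatrix q N) {p z : ℝ → ℝ} (hpz : IsHill q p z) (t : ℝ) :
    p t = N t 0 0 * p 0 + N t 0 1 * z 0 ∧ z t = N t 1 0 * p 0 + N t 1 1 * z 0 := by
  have h0 := hpz.wronskian_eq (h.2 0) t
  have h1 := hpz.wronskian_eq (h.2 1) t
  have hd := h.det_eq_one t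
  rw [Matrix.det_fin_two] at hd
  simp only [h.1] at h0 h1
  simp at h0 h1
  constructor
  · linear_combination N t 0 0 * h1 - N t 0 1 * h0 - p t * hd
  · linear_combination N t 1 0 * h1 - N t 1 1 * h0 - z t * hd

theorem eq_mul_matrix (h : IsHillMatrix q N) {X : ℝ → Matrix (Fin 2) (Fin 2) ℝ}
    (hX : ∀ j, IsHill q (fun t => X t 0 j) fun t => X t 1 j) (t : ℝ) : X t = N t * X 0 := by
  ext i j
  have := h.eq_mul (hX j) t
  fin_cases i <;> simp [Matrix.mul_apply, Fin.sum_univ_two, this]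

theorem add_period (h : IsHillMatrix q N) {T : ℝ} (hT : ∀ t, q (t + T) = q t) (t : ℝ) :
    N (t + T) = N t * N T := by
  have := h.eq_mul_matrix (X := fun t => N (t + T)) (fun j t => ?_) t
  · simpa using this
  · have h1 := h.2 j (t + T)
    rw [hT] at h1
    exact ⟨h1.1.comp_add_const t T, h1.2.comp_add_const t T⟩

theorem add_nat_mul_period (h : IsHillMatrix q N) {T : ℝ} (hT : ∀ t, q (t + T) = q t) (k : ℕ)
    (t : ℝ) : N (t + k * T) = N t * N T ^ k := by
  induction k generalizing t with
  | zero => simp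
  | succ k ih =>
    rw [pow_succ, ← Matrix.mul_assoc, ← ih, ← h.add_period hT]
    congr 1
    push_cast
    ring

/-- The rotation of the fundamental matrix, measured by its complex linear part, and the rotation
of any nonzero solution stay at bounded distance: the antilinear part is smaller. -/
theorem exists_isAngleOn (h : IsHillMatrix q N) {p z : ℝ → ℝ} (hpz : IsHill q p z) {A : ℝ → ℝ}
    (hne : ∀ t, (⟨p t, z t⟩ : ℂ) ≠ 0) (hA : IsAngleOn (fun t => (⟨p t, z t⟩ : ℂ)) A univ) :
    ∃ Θ : ℝ → ℝ, IsAngleOn (fun t => (⟨N t 0 0 + N t 1 1, N t 1 0 - N t 0 1⟩ : ℂ)) Θ univ ∧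
      Θ 0 = 0 ∧ ∃ C, ∀ t, |Θ t - A t| ≤ C := by
  have hmk : ∀ {a b : ℝ → ℝ}, Continuous a → Continuous b →
      Continuous fun t => (⟨a t, b t⟩ : ℂ) := fun {a b} ha hb => by
    simp only [Complex.mk_eq_add_mul_I]
    fun_prop
  have hp : Continuous p := continuous_iff_continuousAt.2 fun t => (hpz t).1.continuousAt
  have hz : Continuous z := continuous_iff_continuousAt.2 fun t => (hpz t).2.continuousAt
  have hNc : ∀ i j, Continuous fun t => N t i j := fun i j => h.continuous.matrix_elem i j
  set y : ℝ → ℂ := fun t => ⟨p t, z t⟩ with hy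
  set D : ℝ → ℂ := fun t => ⟨N t 0 0 + N t 1 1, N t 1 0 - N t 0 1⟩ with hD
  have hyc : Continuous y := hmk hp hz
  have hDc : Continuous D := hmk ((hNc _ _).add (hNc _ _)) ((hNc _ _).sub (hNc _ _))
  set c : ℂ := y 0 with hcdef
  have hc0 : c ≠ 0 := hne 0
  have hslit : ∀ t ∈ univ, D t * c / y t ∈ Complex.slitPlane := by
    intro t _
    left
    have h1 := h.eq_mul hpz t
    have h2 := h.det_eq_one t
    rw [Matrix.det_fin_two] at h2
    have h3 : 0 < (D t * c * (starRingEnd ℂ) (y t)).re := by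
      simp only [Complex.mul_re, Complex.mul_im, Complex.conj_re, Complex.conj_im, hD, hy, hcdef]
      rw [h1.1, h1.2]
      have h4 : 0 < p 0 ^ 2 + z 0 ^ 2 := by
        by_contra hcon
        have hp0 : p 0 = 0 := by nlinarith [sq_nonneg (p 0), sq_nonneg (z 0)]
        have hz0 : z 0 = 0 := by nlinarith [sq_nonneg (p 0), sq_nonneg (z 0)]
        exact hc0 (Complex.ext hp0 hz0)
      have h5 : 0 ≤ (N t 0 0 * p 0 + N t 0 1 * z 0) ^ 2 +
          (N t 1 0 * p 0 + N t 1 1 * z 0) ^ 2 := by positivity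
      nlinarith
    have hns : 0 < Complex.normSq (y t) := Complex.normSq_pos.2 (hne t)
    rw [Complex.div_re]
    simp only [Complex.mul_re, Complex.mul_im, Complex.conj_re, Complex.conj_im] at h3
    rw [← add_div]
    refine div_pos ?_ hns
    simp only [Complex.mul_re, Complex.mul_im]
    linarith
  have hang := hA.of_slitPlane (z := fun t => D t * c) hyc.continuousOn
    (hDc.mul continuous_const).continuousOn hslit
  set φ : ℝ → ℝ := fun t => A t + (D t * c / y t).arg with hφ
  have hD0 : D 0 = 2 := by
    simp only [hD, h.1]
    apply Complex.ext <;> norm_num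
  refine ⟨fun t => φ t - φ 0, ⟨hang.1.sub continuousOn_const, fun t _ => ?_⟩, sub_self _,
    Real.pi + |φ 0|, fun t => ?_⟩
  · have e1 := hang.2 t (mem_univ t)
    have e0 := hang.2 0 (mem_univ 0)
    simp only [hD0] at e0
    simp only [norm_mul] at e1 e0
    rw [Complex.norm_two] at e0
    push_cast at e0 e1
    have hcn : (‖c‖ : ℂ) ≠ 0 := by simpa using hc0
    have e2 : c = ‖c‖ * Complex.exp (φ 0 * Complex.I) := by
      have : (2 : ℂ) * c = 2 * (‖c‖ * Complex.exp (φ 0 * Complex.I)) := by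
        rw [e0]
        ring
      exact mul_left_cancel₀ two_ne_zero this
    have e3 : Complex.exp (φ 0 * Complex.I) ≠ 0 := Complex.exp_ne_zero _
    push_cast
    rw [sub_mul, Complex.exp_sub, ← mul_right_inj' (mul_ne_zero hcn e3)]
    have : (‖c‖ * Complex.exp (φ 0 * Complex.I)) * D t =
        ‖D t‖ * ‖c‖ * Complex.exp (φ t * Complex.I) := by
      rw [← e2, mul_comm c, e1]
    rw [this]
    field_simp
  · have e : φ t - φ 0 - A t = (D t * c / y t).arg - φ 0 := by
      simp only [hφ]
      ring
    rw [e]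
    exact (abs_sub _ _).trans (by linarith [Complex.abs_arg_le_pi (D t * c / y t)])

end IsHillMatrix

/-! ### The mean index of a decoupled periodic Hill system -/

theorem IsAngleOn.mul {z w : ℝ → ℂ} {θ φ : ℝ → ℝ} {s : Set ℝ} (hz : IsAngleOn z θ s)
    (hw : IsAngleOn w φ s) : IsAngleOn (fun t => z t * w t) (fun t => θ t + φ t) s := by
  refine ⟨hz.1.add hw.1, fun t ht => ?_⟩
  change z t * w t = (‖z t * w t‖ : ℂ) * _
  conv_lhs => rw [hz.2 t ht, hw.2 t ht]
  rw [norm_mul]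
  push_cast
  rw [add_mul, Complex.exp_add]
  ring

theorem tendsto_div_of_abs_sub_le {u v : ℕ → ℝ} {C l : ℝ} (h : ∀ m, |u m - v m| ≤ C)
    (hv : Tendsto (fun m : ℕ => v m / m) atTop (𝓝 l)) :
    Tendsto (fun m : ℕ => u m / m) atTop (𝓝 l) := by
  have h1 : Tendsto (fun m : ℕ => (u m - v m) / m) atTop (𝓝 0) := by
    refine squeeze_zero_norm (fun m => ?_) (tendsto_const_div_atTop_nhds_zero_nat C)
    rw [Real.norm_eq_abs, abs_div, Nat.abs_cast]
    exact div_le_div_of_nonneg_right (h m) (Nat.cast_nonneg m)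
  have := h1.add hv
  rw [zero_add] at this
  refine this.congr fun m => ?_
  ring

theorem iteratePath_dsum_eq {q : Fin 2 → ℝ → ℝ} {N : Fin 2 → ℝ → Matrix (Fin 2) (Fin 2) ℝ}
    (hN : ∀ i, IsHillMatrix (q i) (N i)) {T : ℝ} (hq : ∀ i t, q i (t + T) = q i t) :
    iteratePath (fun t => dsum fun i => N i t) T = fun t => dsum fun i => N i t := by
  funext t
  rw [iteratePath]
  generalize ⌊t / T⌋₊ = k
  have hpow : ∀ k : ℕ, (dsum fun i => N i T) ^ k = dsum fun i => N i T ^ k := by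
    intro k
    induction k with
    | zero => simp [dsum_one]
    | succ k ih => simp only [pow_succ, ih, dsum_mul]
  rw [hpow, dsum_mul]
  congr 1
  funext i
  rw [← (hN i).add_nat_mul_period (hq i), sub_add_cancel]

/-- The mean index of a periodic system that decouples into two Hill equations is the sum of the
mean rotations of a solution of each of them, in half turns. -/
theorem isMeanIndex_dsum_iff {q : Fin 2 → ℝ → ℝ} {N : Fin 2 → ℝ → Matrix (Fin 2) (Fin 2) ℝ}
    (hN : ∀ i, IsHillMatrix (q i) (N i)) {T : ℝ} (hT : 0 < T) (hq : ∀ i t, q i (t + T) = q i t)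
    {p z A : Fin 2 → ℝ → ℝ} {ρ : Fin 2 → ℝ} (hpz : ∀ i, IsHill (q i) (p i) (z i))
    (hne : ∀ i t, (⟨p i t, z i t⟩ : ℂ) ≠ 0)
    (hA : ∀ i, IsAngleOn (fun t => (⟨p i t, z i t⟩ : ℂ)) (A i) univ)
    (hlim : ∀ i, Tendsto (fun m : ℕ => A i (m * T) / m) atTop (𝓝 (ρ i * (2 * Real.pi)))) (x : ℝ) :
    IsMeanIndex (fun t => dsum fun i => N i t) T x ↔ x = 2 * (ρ 0 + ρ 1) := by
  have hex := fun i => (hN i).exists_isAngleOn (hpz i) (hne i) (hA i)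
  choose Θ hΘ hΘ0 C hC using hex
  refine isMeanIndex_iff (N := fun t i => N i t) (Θ := fun t => Θ 0 t + Θ 1 t) hT ?_ ?_
    (fun _ => rfl) (fun t i => (hN i).det_eq_one t) (iteratePath_dsum_eq hN hq) ?_ ?_ ?_ x
  · exact continuous_dsum.comp (continuous_pi fun i => (hN i).continuous)
  · simp only [(hN _).1]
    exact dsum_one
  · simp only [complexDet_dsum, Fin.prod_univ_two]
    exact (hΘ 0).mul (hΘ 1)
  · simp [hΘ0]
  · have h := fun i => tendsto_div_of_abs_sub_le (fun m : ℕ => hC i (m * T)) (hlim i)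
    have := (h 0).add (h 1)
    convert this using 2
    · ring
    · ring

/-! ### Derivatives of the perturbation and of the reduced Hamiltonian -/

/-- The domain of the perturbation. -/
def pertDomain : Set (EuclideanSpace ℝ (Fin 3) × ℝ) := {0}ᶜ ×ˢ Ico (0 : ℝ) 1

/-- The derivative of `F` in the direction `v` of space. -/
noncomputable def dirD (v : EuclideanSpace ℝ (Fin 3)) (F : EuclideanSpace ℝ (Fin 3) → ℝ → ℝ)
    (q : EuclideanSpace ℝ (Fin 3)) (ε : ℝ) : ℝ :=
  fderiv ℝ (fun q => F q ε) q v

/-- Smoothness up to the boundary `ε = 0` of the domain. -/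
def SmoothPert (F : EuclideanSpace ℝ (Fin 3) → ℝ → ℝ) : Prop :=
  ContDiffOn ℝ ((⊤ : ℕ∞) : WithTop ℕ∞) (fun p : EuclideanSpace ℝ (Fin 3) × ℝ => F p.1 p.2)
    pertDomain

theorem uniqueDiffOn_pertDomain : UniqueDiffOn ℝ pertDomain :=
  isOpen_compl_singleton.uniqueDiffOn.prod (uniqueDiffOn_Ico 0 1)

namespace SmoothPert
variable {F : EuclideanSpace ℝ (Fin 3) → ℝ → ℝ}

theorem hasFDerivAt_slice (hF : SmoothPert F) {q : EuclideanSpace ℝ (Fin 3)} {ε : ℝ} (hq : q ≠ 0)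
    (hε : ε ∈ Ico (0 : ℝ) 1) : HasFDerivAt (fun q => F q ε)
      ((fderivWithin ℝ (fun p : EuclideanSpace ℝ (Fin 3) × ℝ => F p.1 p.2) pertDomain (q, ε)).comp
        (ContinuousLinearMap.inl ℝ (EuclideanSpace ℝ (Fin 3)) ℝ)) q := by
  have hmem : (q, ε) ∈ pertDomain := ⟨hq, hε⟩
  have h1 := ((hF.differentiableOn (by simp)) (q, ε) hmem).hasFDerivWithinAt
  have h2 : HasFDerivWithinAt (fun q : EuclideanSpace ℝ (Fin 3) => (q, ε))
      (ContinuousLinearMap.inl ℝ (EuclideanSpace ℝ (Fin 3)) ℝ) {0}ᶜ q :=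
    (hasFDerivAt_prodMk_left q ε).hasFDerivWithinAt
  have h3 := HasFDerivWithinAt.comp q (f := fun q : EuclideanSpace ℝ (Fin 3) => (q, ε)) h1 h2
    fun x hx => ⟨hx, hε⟩
  exact h3.hasFDerivAt (isOpen_compl_singleton.mem_nhds hq)

theorem differentiableAt (hF : SmoothPert F) {q : EuclideanSpace ℝ (Fin 3)} {ε : ℝ} (hq : q ≠ 0)
    (hε : ε ∈ Ico (0 : ℝ) 1) : DifferentiableAt ℝ (fun q => F q ε) q :=
  (hF.hasFDerivAt_slice hq hε).differentiableAt

theorem dirD (hF : SmoothPert F) (v : EuclideanSpace ℝ (Fin 3)) : SmoothPert (dirD v F) := by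
  have h1 : ContDiffOn ℝ ((⊤ : ℕ∞) : WithTop ℕ∞)
      (fderivWithin ℝ (fun p : EuclideanSpace ℝ (Fin 3) × ℝ => F p.1 p.2) pertDomain)
      pertDomain := hF.fderivWithin uniqueDiffOn_pertDomain (by simp)
  have h2 := h1.clm_apply (contDiffOn_const (c := (v, (0 : ℝ))))
  refine h2.congr fun p hp => ?_
  rw [_root_.dirD, (hF.hasFDerivAt_slice hp.1 hp.2).fderiv]
  rfl

theorem hasDerivAt_comp (hF : SmoothPert F) {ε s : ℝ} {c : ℝ → EuclideanSpace ℝ (Fin 3)}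
    {v : EuclideanSpace ℝ (Fin 3)} (hc : HasDerivAt c v s) (h0 : c s ≠ 0)
    (hε : ε ∈ Ico (0 : ℝ) 1) : HasDerivAt (fun s => F (c s) ε) (_root_.dirD v F (c s) ε) s :=
  (hF.differentiableAt h0 hε).hasFDerivAt.comp_hasDerivAt s hc

end SmoothPert

/-- The unit vector in the radial direction of the half plane `θ = 0`. -/
noncomputable def eR : EuclideanSpace ℝ (Fin 3) := !₂[1, 0, 0]

/-- The unit vector along the axis of symmetry. -/
noncomputable def eZ : EuclideanSpace ℝ (Fin 3) := !₂[0, 0, 1]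

theorem vec3_ne_zero {r z : ℝ} (hr : r ≠ 0) : (!₂[r, 0, z] : EuclideanSpace ℝ (Fin 3)) ≠ 0 := by
  intro h
  have := congrArg (fun v : EuclideanSpace ℝ (Fin 3) => v 0) h
  simp at this
  exact hr this

theorem vec3_eq (r z : ℝ) : (!₂[r, 0, z] : EuclideanSpace ℝ (Fin 3)) = r • eR + z • eZ := by
  ext i
  fin_cases i <;> simp [eR, eZ]

theorem hasDerivAt_vec3_r (r z : ℝ) :
    HasDerivAt (fun s => (!₂[s, 0, z] : EuclideanSpace ℝ (Fin 3))) eR r := by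
  simp only [vec3_eq]
  simpa using ((hasDerivAt_id r).smul_const eR).add_const (z • eZ)

theorem hasDerivAt_vec3_z (r z : ℝ) :
    HasDerivAt (fun s => (!₂[r, 0, s] : EuclideanSpace ℝ (Fin 3))) eZ z := by
  simp only [vec3_eq]
  simpa using ((hasDerivAt_id z).smul_const eZ).const_add (r • eR)

section radial
variable (f : EuclideanSpace ℝ (Fin 3) → ℝ → ℝ)

/-- The perturbation on the plane `z = 0`, as a function of the radius. -/
noncomputable def radVal (r ε : ℝ) : ℝ := f !₂[r, 0, 0] ε
/-- `∂f/∂r` on the plane `z = 0`. -/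
noncomputable def radD (r ε : ℝ) : ℝ := dirD eR f !₂[r, 0, 0] ε
/-- `∂²f/∂r²` on the plane `z = 0`. -/
noncomputable def radDD (r ε : ℝ) : ℝ := dirD eR (dirD eR f) !₂[r, 0, 0] ε
/-- `∂²f/∂z²` on the plane `z = 0`. -/
noncomputable def vertDD (r ε : ℝ) : ℝ := dirD eZ (dirD eZ f) !₂[r, 0, 0] ε

variable {f}

theorem SmoothPert.continuousOn_plane {F : EuclideanSpace ℝ (Fin 3) → ℝ → ℝ}
    (hF : SmoothPert F) :
    ContinuousOn (fun p : ℝ × ℝ => F !₂[p.1, 0, 0] p.2) (Ioi 0 ×ˢ Ico (0 : ℝ) 1) := by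
  have h : Continuous fun p : ℝ × ℝ => ((!₂[p.1, 0, 0] : EuclideanSpace ℝ (Fin 3)), p.2) := by
    simp only [vec3_eq]
    fun_prop
  exact hF.continuousOn.comp h.continuousOn fun p hp => ⟨vec3_ne_zero (ne_of_gt hp.1), hp.2⟩

theorem hasDerivAt_radVal (hf : SmoothPert f) {r ε : ℝ} (hr : 0 < r) (hε : ε ∈ Ico (0 : ℝ) 1) :
    HasDerivAt (fun r => radVal f r ε) (radD f r ε) r :=
  hf.hasDerivAt_comp (hasDerivAt_vec3_r r 0) (vec3_ne_zero hr.ne') hε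

theorem hasDerivAt_radD (hf : SmoothPert f) {r ε : ℝ} (hr : 0 < r) (hε : ε ∈ Ico (0 : ℝ) 1) :
    HasDerivAt (fun r => radD f r ε) (radDD f r ε) r :=
  (hf.dirD eR).hasDerivAt_comp (hasDerivAt_vec3_r r 0) (vec3_ne_zero hr.ne') hε

theorem radialDeriv_eq (hf : SmoothPert f) {r : ℝ} (hr : 0 < r) :
    radialDeriv f r = radD f r 0 :=
  (hasDerivAt_radVal hf hr ⟨le_rfl, one_pos⟩).deriv

theorem IsSymmetricPerturbation.smoothPert (hf : IsSymmetricPerturbation f) : SmoothPert f :=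
  hf.smooth

theorem IsSymmetricPerturbation.even (hf : IsSymmetricPerturbation f) {r ε : ℝ} (hr : r ≠ 0)
    (hε : ε ∈ Ico (0 : ℝ) 1) (z : ℝ) : f !₂[r, 0, -z] ε = f !₂[r, 0, z] ε :=
  hf.reflection r 0 z ε (vec3_ne_zero hr) hε

theorem eq_zero_of_even_of_hasDerivAt {g : ℝ → ℝ} {d : ℝ} (hg : ∀ z, g (-z) = g z)
    (h : HasDerivAt g d 0) : d = 0 := by
  have h1 : HasDerivAt (fun z => g (-z)) (-d) 0 := by
    have h2 : HasDerivAt g d (-0) := by rwa [neg_zero]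
    exact (h2.comp (0 : ℝ) (hasDerivAt_neg (0 : ℝ))).congr_deriv (by ring)
  simp only [hg] at h1
  linarith [h1.unique h]

theorem IsSymmetricPerturbation.dirD_eR_even (hf : IsSymmetricPerturbation f) {r ε : ℝ}
    (hr : 0 < r) (hε : ε ∈ Ico (0 : ℝ) 1) (z : ℝ) :
    dirD eR f !₂[r, 0, -z] ε = dirD eR f !₂[r, 0, z] ε := by
  have h1 := hf.smoothPert.hasDerivAt_comp (hasDerivAt_vec3_r r (-z)) (vec3_ne_zero hr.ne') hε
  have h2 := hf.smoothPert.hasDerivAt_comp (hasDerivAt_vec3_r r z) (vec3_ne_zero hr.ne') hε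
  refine (h1.congr_of_eventuallyEq ?_).unique h2
  filter_upwards [lt_mem_nhds hr] with s hs
  exact (hf.even hs.ne' hε z).symm

theorem IsSymmetricPerturbation.dirD_eZ_eq_zero (hf : IsSymmetricPerturbation f) {r ε : ℝ}
    (hr : 0 < r) (hε : ε ∈ Ico (0 : ℝ) 1) : dirD eZ f !₂[r, 0, 0] ε = 0 :=
  eq_zero_of_even_of_hasDerivAt (fun z => hf.even hr.ne' hε z)
    (hf.smoothPert.hasDerivAt_comp (hasDerivAt_vec3_z r 0) (vec3_ne_zero hr.ne') hε)

/-- The second derivative in the latitude, in terms of derivatives along the axes. -/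
theorem latitudeDeriv2_eq (hf : IsSymmetricPerturbation f) {ρ : ℝ} (hρ : 0 < ρ) :
    latitudeDeriv2 f ρ = ρ ^ 2 * vertDD f ρ 0 - ρ * radD f ρ 0 := by
  have h01 : (0 : ℝ) ∈ Ico (0 : ℝ) 1 := ⟨le_rfl, one_pos⟩
  set c : ℝ → EuclideanSpace ℝ (Fin 3) := fun φ => !₂[ρ * Real.cos φ, 0, ρ * Real.sin φ] with hc
  have hcd : ∀ φ, HasDerivAt c ((-(ρ * Real.sin φ)) • eR + (ρ * Real.cos φ) • eZ) φ := by
    intro φ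
    simp only [hc, vec3_eq]
    have h1 := ((Real.hasDerivAt_cos φ).const_mul ρ).smul_const eR
    have h2 := ((Real.hasDerivAt_sin φ).const_mul ρ).smul_const eZ
    refine (h1.add h2).congr_deriv ?_
    rw [mul_neg]
  have hc0 : ∀ φ, c φ ≠ 0 := by
    intro φ h
    have h1 := congrArg (fun v : EuclideanSpace ℝ (Fin 3) => v 0) h
    have h2 := congrArg (fun v : EuclideanSpace ℝ (Fin 3) => v 2) h
    simp [hc, hρ.ne'] at h1 h2
    have := Real.sin_sq_add_cos_sq φ
    rw [h1, h2] at this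
    norm_num at this
  have hd1 : ∀ φ, HasDerivAt (fun φ => f (c φ) 0)
      (-(ρ * Real.sin φ) * dirD eR f (c φ) 0 + ρ * Real.cos φ * dirD eZ f (c φ) 0) φ := by
    intro φ
    refine (hf.smoothPert.hasDerivAt_comp (hcd φ) (hc0 φ) h01).congr_deriv ?_
    simp [dirD]
  have hderiv : deriv (fun φ => f (c φ) 0) = fun φ =>
      -(ρ * Real.sin φ) * dirD eR f (c φ) 0 + ρ * Real.cos φ * dirD eZ f (c φ) 0 :=
    funext fun φ => (hd1 φ).deriv
  have hc00 : c 0 = !₂[ρ, 0, 0] := by simp [hc]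
  have hR := (hf.smoothPert.dirD eR).hasDerivAt_comp (hcd 0) (hc0 0) h01
  have hZ := (hf.smoothPert.dirD eZ).hasDerivAt_comp (hcd 0) (hc0 0) h01
  have hs := ((Real.hasDerivAt_sin 0).const_mul ρ).neg
  have hco := (Real.hasDerivAt_cos 0).const_mul ρ
  have htot := ((hs.mul hR).add (hco.mul hZ)).deriv
  rw [latitudeDeriv2, iteratedDeriv_succ, iteratedDeriv_one]
  change deriv (deriv fun φ => f (c φ) 0) 0 = _
  rw [hderiv]
  refine Eq.trans ?_ (htot.trans ?_)
  · rfl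
  · simp only [hc00, Real.sin_zero, Real.cos_zero, mul_zero, neg_zero, zero_smul, zero_add,
      mul_one, hf.dirD_eZ_eq_zero hρ h01, vertDD, radD]
    simp [dirD]
    ring

end radial

section hamiltonian
variable (f : EuclideanSpace ℝ (Fin 3) → ℝ → ℝ) (ω : ℝ)

/-- The effective potential of the planar motion. -/
noncomputable def effV (ε r : ℝ) : ℝ := ω ^ 2 / (2 * r ^ 2) - 1 / r + ε * radVal f r ε
/-- The derivative of `effV`. -/
noncomputable def effV' (ε r : ℝ) : ℝ := -ω ^ 2 / r ^ 3 + 1 / r ^ 2 + ε * radD f r ε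
/-- The second derivative of `effV`, which is the planar block of the Hessian. -/
noncomputable def effV'' (ε r : ℝ) : ℝ := 3 * ω ^ 2 / r ^ 4 - 2 / r ^ 3 + ε * radDD f r ε
/-- The second derivative of the reduced Hamiltonian in `z`, on the plane `z = 0`. -/
noncomputable def vertQ (ε r : ℝ) : ℝ := 1 / r ^ 3 + ε * vertDD f r ε

variable {f ω}

theorem hasDerivAt_effV (hf : SmoothPert f) {r ε : ℝ} (hr : 0 < r) (hε : ε ∈ Ico (0 : ℝ) 1) :
    HasDerivAt (effV f ω ε) (effV' f ω ε r) r := by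
  have h1 : HasDerivAt (fun r : ℝ => ω ^ 2 / (2 * r ^ 2)) (-ω ^ 2 / r ^ 3) r := by
    refine ((hasDerivAt_const r (ω ^ 2)).div (((hasDerivAt_id r).pow 2).const_mul 2)
      (by simpa using hr.ne')).congr_deriv ?_
    simp
    field_simp
  have h2 : HasDerivAt (fun r : ℝ => 1 / r) (-1 / r ^ 2) r := by
    refine ((hasDerivAt_const r (1 : ℝ)).div (hasDerivAt_id r) hr.ne').congr_deriv ?_
    simp
  refine ((h1.sub h2).add ((hasDerivAt_radVal hf hr hε).const_mul ε)).congr_deriv ?_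
  rw [effV']
  ring

theorem hasDerivAt_effV' (hf : SmoothPert f) {r ε : ℝ} (hr : 0 < r) (hε : ε ∈ Ico (0 : ℝ) 1) :
    HasDerivAt (effV' f ω ε) (effV'' f ω ε r) r := by
  have h1 : HasDerivAt (fun r : ℝ => -ω ^ 2 / r ^ 3) (3 * ω ^ 2 / r ^ 4) r := by
    refine ((hasDerivAt_const r (-ω ^ 2)).div ((hasDerivAt_id r).pow 3)
      (by simpa using hr.ne')).congr_deriv ?_
    simp
    field_simp
  have h2 : HasDerivAt (fun r : ℝ => 1 / r ^ 2) (-2 / r ^ 3) r := by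
    refine ((hasDerivAt_const r (1 : ℝ)).div ((hasDerivAt_id r).pow 2)
      (by simpa using hr.ne')).congr_deriv ?_
    simp
    field_simp
  refine ((h1.add h2).add ((hasDerivAt_radD hf hr hε).const_mul ε)).congr_deriv ?_
  rw [effV'']
  ring

theorem partialD_eq {H : PhaseSpace → ℝ} {x : PhaseSpace} {i : Fin 2 ⊕ Fin 2} {d : ℝ}
    (hH : DifferentiableAt ℝ H x) (h : HasDerivAt (fun s => H (Function.update x i s)) d (x i)) :
    partialD H i x = d := by
  have h1 := hasDerivAt_update x i (x i)
  have h2 : HasFDerivAt H (fderiv ℝ H x) (Function.update x i (x i)) := by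
    rw [Function.update_eq_self]
    exact hH.hasFDerivAt
  exact (h2.comp_hasDerivAt (x i) h1).unique h

theorem differentiableAt_comp_vec3 {F : EuclideanSpace ℝ (Fin 3) → ℝ → ℝ} (hF : SmoothPert F)
    {x : PhaseSpace} {ε : ℝ} (hx : 0 < x (Sum.inr 0)) (hε : ε ∈ Ico (0 : ℝ) 1) :
    DifferentiableAt ℝ (fun x : PhaseSpace => F !₂[x (Sum.inr 0), 0, x (Sum.inr 1)] ε) x := by
  have h : DifferentiableAt ℝ (fun x : PhaseSpace =>
      (!₂[x (Sum.inr 0), 0, x (Sum.inr 1)] : EuclideanSpace ℝ (Fin 3))) x := by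
    simp only [vec3_eq]
    fun_prop
  exact DifferentiableAt.comp x (hF.differentiableAt (vec3_ne_zero hx.ne') hε) h

theorem DifferentiableAt.fun_div_of_ne_zero {E : Type*} [NormedAddCommGroup E] [NormedSpace ℝ E]
    {u v : E → ℝ} {x : E} (hu : DifferentiableAt ℝ u x) (hv : DifferentiableAt ℝ v x)
    (h : v x ≠ 0) : DifferentiableAt ℝ (fun y => u y / v y) x := by
  simp only [div_eq_mul_inv]
  exact hu.mul (hv.inv h)

theorem differentiableAt_reducedHam (hf : SmoothPert f) {x : PhaseSpace} {ε : ℝ}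
    (hx : 0 < x (Sum.inr 0)) (hε : ε ∈ Ico (0 : ℝ) 1) :
    DifferentiableAt ℝ (reducedHam f ω ε) x := by
  have h1 := differentiableAt_comp_vec3 hf hx hε
  have h2 : 2 * x (Sum.inr 0) ^ 2 ≠ 0 := by positivity
  have h3 : x (Sum.inr 0) ^ 2 + x (Sum.inr 1) ^ 2 ≠ 0 := by positivity
  have h4 : √(x (Sum.inr 0) ^ 2 + x (Sum.inr 1) ^ 2) ≠ 0 := by positivity
  have hc : ∀ i, DifferentiableAt ℝ (fun x : PhaseSpace => x i) x := fun i =>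
    differentiableAt_apply i x
  have hr := hc (Sum.inr 0)
  have k1 : DifferentiableAt ℝ
      (fun x : PhaseSpace => (x (Sum.inl 0) ^ 2 + x (Sum.inl 1) ^ 2) / 2) x :=
    (((hc (Sum.inl 0)).pow 2).add ((hc (Sum.inl 1)).pow 2)).fun_div_of_ne_zero
      (differentiableAt_const _) two_ne_zero
  have k2 : DifferentiableAt ℝ (fun x : PhaseSpace => ω ^ 2 / (2 * x (Sum.inr 0) ^ 2)) x :=
    (differentiableAt_const _).fun_div_of_ne_zero ((hr.pow 2).const_mul 2) h2
  have k3 : DifferentiableAt ℝ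
      (fun x : PhaseSpace => √(x (Sum.inr 0) ^ 2 + x (Sum.inr 1) ^ 2)) x :=
    DifferentiableAt.sqrt ((hr.pow 2).add ((hc (Sum.inr 1)).pow 2)) h3
  exact ((k1.add k2).sub ((differentiableAt_const _).fun_div_of_ne_zero k3 h4)).add
    (h1.const_mul ε)

/-- The gradient of the reduced Hamiltonian. -/
noncomputable def reducedGrad (f : EuclideanSpace ℝ (Fin 3) → ℝ → ℝ) (ω ε : ℝ) :
    Fin 2 ⊕ Fin 2 → PhaseSpace → ℝ
  | Sum.inl i, x => x (Sum.inl i)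
  | Sum.inr 0, x => -ω ^ 2 / x (Sum.inr 0) ^ 3 +
      x (Sum.inr 0) / √(x (Sum.inr 0) ^ 2 + x (Sum.inr 1) ^ 2) ^ 3 +
      ε * dirD eR f !₂[x (Sum.inr 0), 0, x (Sum.inr 1)] ε
  | Sum.inr 1, x => x (Sum.inr 1) / √(x (Sum.inr 0) ^ 2 + x (Sum.inr 1) ^ 2) ^ 3 +
      ε * dirD eZ f !₂[x (Sum.inr 0), 0, x (Sum.inr 1)] ε

theorem hasDerivAt_inv_sqrt {r c : ℝ} (hc : 0 < r ^ 2 + c) :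
    HasDerivAt (fun s => 1 / √(s ^ 2 + c)) (-(r / √(r ^ 2 + c) ^ 3)) r := by
  have h0 : 0 < √(r ^ 2 + c) := Real.sqrt_pos.2 hc
  have h1 := (((hasDerivAt_id r).pow 2).add_const c).sqrt hc.ne'
  refine ((hasDerivAt_const r (1 : ℝ)).div h1 h0.ne').congr_deriv ?_
  simp
  field_simp

theorem partialD_reducedHam (hf : SmoothPert f) {x : PhaseSpace} {ε : ℝ}
    (hx : 0 < x (Sum.inr 0)) (hε : ε ∈ Ico (0 : ℝ) 1) (i : Fin 2 ⊕ Fin 2) :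
    partialD (reducedHam f ω ε) i x = reducedGrad f ω ε i x := by
  refine partialD_eq (differentiableAt_reducedHam hf hx hε) ?_
  rcases i with i | i
  · have h : HasDerivAt (fun s : ℝ => s ^ 2 / 2) (x (Sum.inl i)) (x (Sum.inl i)) := by
      refine (((hasDerivAt_id (x (Sum.inl i))).pow 2).div_const 2).congr_deriv ?_
      simp
    fin_cases i
    · simp [reducedHam, reducedGrad, add_div] at h ⊢
      exact h
    · simp [reducedHam, reducedGrad, add_div] at h ⊢
      exact h
  · fin_cases i
    · have h1 : HasDerivAt (fun r : ℝ => ω ^ 2 / (2 * r ^ 2)) (-ω ^ 2 / x (Sum.inr 0) ^ 3)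
          (x (Sum.inr 0)) := by
        refine ((hasDerivAt_const _ (ω ^ 2)).div (((hasDerivAt_id _).pow 2).const_mul 2)
          (by simpa using hx.ne')).congr_deriv ?_
        simp
        field_simp
      have h2 := hasDerivAt_inv_sqrt (r := x (Sum.inr 0)) (c := x (Sum.inr 1) ^ 2) (by positivity)
      have h3 := hf.hasDerivAt_comp (hasDerivAt_vec3_r (x (Sum.inr 0)) (x (Sum.inr 1)))
        (vec3_ne_zero hx.ne') hε
      have h4 := ((h1.const_add ((x (Sum.inl 0) ^ 2 + x (Sum.inl 1) ^ 2) / 2)).sub h2).add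
        (h3.const_mul ε)
      simp [reducedHam, reducedGrad]
      refine (h4.congr_deriv (by ring)).congr_of_eventuallyEq (Eventually.of_forall fun s => ?_)
      simp
    · have h2 := hasDerivAt_inv_sqrt (r := x (Sum.inr 1)) (c := x (Sum.inr 0) ^ 2) (by positivity)
      have h3 := hf.hasDerivAt_comp (hasDerivAt_vec3_z (x (Sum.inr 0)) (x (Sum.inr 1)))
        (vec3_ne_zero hx.ne') hε
      have h4 := (h2.const_sub ((x (Sum.inl 0) ^ 2 + x (Sum.inl 1) ^ 2) / 2 +
        ω ^ 2 / (2 * x (Sum.inr 0) ^ 2))).add (h3.const_mul ε)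
      simp [reducedHam, reducedGrad]
      refine (h4.congr_deriv (by rw [neg_neg, add_comm (x (Sum.inr 0) ^ 2)])).congr_of_eventuallyEq
        (Eventually.of_forall fun s => ?_)
      simp [add_comm]

theorem reducedGrad_planar (hf : IsSymmetricPerturbation f) {x : PhaseSpace} {ε : ℝ}
    (hx : 0 < x (Sum.inr 0)) (hz : x (Sum.inr 1) = 0) (hε : ε ∈ Ico (0 : ℝ) 1) :
    reducedGrad f ω ε (Sum.inr 0) x = effV' f ω ε (x (Sum.inr 0)) ∧
      reducedGrad f ω ε (Sum.inr 1) x = 0 := by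
  simp only [reducedGrad, hz]
  constructor
  · rw [effV', radD, zero_pow two_ne_zero, add_zero, Real.sqrt_sq hx.le]
    field_simp
  · rw [hf.dirD_eZ_eq_zero hx hε]
    simp

theorem hamVectorField_planar (hf : IsSymmetricPerturbation f) {x : PhaseSpace} {ε : ℝ}
    (hx : 0 < x (Sum.inr 0)) (hp : x (Sum.inl 1) = 0) (hz : x (Sum.inr 1) = 0)
    (hε : ε ∈ Ico (0 : ℝ) 1) :
    hamVectorField (reducedHam f ω ε) x =
      Sum.elim ![-effV' f ω ε (x (Sum.inr 0)), 0] ![x (Sum.inl 0), 0] := by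
  obtain ⟨h0, h1⟩ := reducedGrad_planar (ω := ω) hf hx hz hε
  funext i
  simp only [hamVectorField, partialD_reducedHam hf.smoothPert hx hε]
  have hl : ∀ k, reducedGrad f ω ε (Sum.inl k) x = x (Sum.inl k) := fun _ => rfl
  rcases i with i | i <;> fin_cases i <;>
    simp [Matrix.J, Matrix.mulVec, dotProduct, Matrix.one_apply, h0, h1, hl, hp]

theorem reducedHam_planar {x : PhaseSpace} {ε : ℝ}
    (hx : 0 < x (Sum.inr 0)) (hp : x (Sum.inl 1) = 0) (hz : x (Sum.inr 1) = 0) :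
    reducedHam f ω ε x = x (Sum.inl 0) ^ 2 / 2 + effV f ω ε (x (Sum.inr 0)) := by
  rw [reducedHam, hp, hz, effV, radVal, zero_pow two_ne_zero, add_zero, add_zero,
    Real.sqrt_sq hx.le]
  ring

theorem differentiableAt_reducedGrad (hf : SmoothPert f) {x : PhaseSpace} {ε : ℝ}
    (hx : 0 < x (Sum.inr 0)) (hε : ε ∈ Ico (0 : ℝ) 1) (i : Fin 2 ⊕ Fin 2) :
    DifferentiableAt ℝ (reducedGrad f ω ε i) x := by
  have h2 : x (Sum.inr 0) ^ 3 ≠ 0 := by positivity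
  have h3 : x (Sum.inr 0) ^ 2 + x (Sum.inr 1) ^ 2 ≠ 0 := by positivity
  have h4 : √(x (Sum.inr 0) ^ 2 + x (Sum.inr 1) ^ 2) ^ 3 ≠ 0 := by positivity
  have h1 := differentiableAt_comp_vec3 (hf.dirD eR) hx hε
  have h1' := differentiableAt_comp_vec3 (hf.dirD eZ) hx hε
  have hc : ∀ i, DifferentiableAt ℝ (fun x : PhaseSpace => x i) x := fun i =>
    differentiableAt_apply i x
  have h5 : DifferentiableAt ℝ
      (fun x : PhaseSpace => √(x (Sum.inr 0) ^ 2 + x (Sum.inr 1) ^ 2)) x :=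
    DifferentiableAt.sqrt (((hc (Sum.inr 0)).pow 2).add ((hc (Sum.inr 1)).pow 2)) h3
  have k2 : ∀ i, DifferentiableAt ℝ
      (fun x : PhaseSpace => x i / √(x (Sum.inr 0) ^ 2 + x (Sum.inr 1) ^ 2) ^ 3) x := fun i =>
    (hc i).fun_div_of_ne_zero (h5.pow 3) h4
  rcases i with i | i
  · exact hc _
  · fin_cases i
    · have k1 : DifferentiableAt ℝ (fun x : PhaseSpace => -ω ^ 2 / x (Sum.inr 0) ^ 3) x :=
        (differentiableAt_const _).fun_div_of_ne_zero ((hc (Sum.inr 0)).pow 3) h2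
      exact (k1.add (k2 _)).add (h1.const_mul ε)
    · exact (k2 _).add (h1'.const_mul ε)

/-- At a planar point the Hessian decouples into a planar and a transversal block. -/
theorem hessianMatrix_planar (hf : IsSymmetricPerturbation f) {x : PhaseSpace} {ε : ℝ}
    (hx : 0 < x (Sum.inr 0)) (hz : x (Sum.inr 1) = 0) (hε : ε ∈ Ico (0 : ℝ) 1) :
    hessianMatrix (reducedHam f ω ε) x = Matrix.diagonal
      (Sum.elim ![1, 1] ![effV'' f ω ε (x (Sum.inr 0)), vertQ f ε (x (Sum.inr 0))]) := by
  have hs := hf.smoothPert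
  have hev : ∀ j, partialD (reducedHam f ω ε) j =ᶠ[𝓝 x] reducedGrad f ω ε j := by
    intro j
    have hc : ContinuousAt (fun x : PhaseSpace => x (Sum.inr 0)) x :=
      (continuous_apply _).continuousAt
    filter_upwards [hc.eventually (lt_mem_nhds hx)] with y hy
    exact partialD_reducedHam hs hy hε j
  have hpp : ∀ i j, hessianMatrix (reducedHam f ω ε) x i j = partialD (reducedGrad f ω ε j) i x := by
    intro i j
    rw [hessianMatrix, Matrix.of_apply, partialD, partialD, (hev j).fderiv_eq]
  set r := x (Sum.inr 0) with hr
  have hinl : ∀ i k, partialD (reducedGrad f ω ε (Sum.inl k)) i x =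
      if i = Sum.inl k then 1 else 0 := by
    intro i k
    refine partialD_eq (differentiableAt_reducedGrad hs hx hε _) ?_
    simp only [reducedGrad]
    split_ifs with h
    · subst h
      simp only [Function.update_self]
      exact hasDerivAt_id' _
    · simp only [Function.update_of_ne (Ne.symm h)]
      exact hasDerivAt_const _ _
  have hinl' : ∀ k j, partialD (reducedGrad f ω ε (Sum.inr j)) (Sum.inl k) x = 0 := by
    intro k j
    refine partialD_eq (differentiableAt_reducedGrad hs hx hε _) ?_
    fin_cases j
    · simp [reducedGrad]
      exact hasDerivAt_const _ _
    · simp [reducedGrad]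
      exact hasDerivAt_const _ _
  have hrr : partialD (reducedGrad f ω ε (Sum.inr 0)) (Sum.inr 0) x = effV'' f ω ε r := by
    refine partialD_eq (differentiableAt_reducedGrad hs hx hε _) ?_
    refine (hasDerivAt_effV' hs hx hε).congr_of_eventuallyEq ?_
    filter_upwards [lt_mem_nhds hx] with s hs'
    have := (reducedGrad_planar (ω := ω) hf (x := Function.update x (Sum.inr 0) s) (ε := ε)
      (by simpa using hs') (by simpa using hz) hε).1
    simpa using this
  have hrz : partialD (reducedGrad f ω ε (Sum.inr 1)) (Sum.inr 0) x = 0 := by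
    refine partialD_eq (differentiableAt_reducedGrad hs hx hε _) ?_
    refine (hasDerivAt_const _ (0 : ℝ)).congr_of_eventuallyEq ?_
    filter_upwards [lt_mem_nhds hx] with s hs'
    exact (reducedGrad_planar (ω := ω) hf (x := Function.update x (Sum.inr 0) s) (ε := ε)
      (by simpa using hs') (by simpa using hz) hε).2
  have hzr : partialD (reducedGrad f ω ε (Sum.inr 0)) (Sum.inr 1) x = 0 := by
    have hd := (differentiableAt_reducedGrad (ω := ω) hs hx hε (Sum.inr 0)).hasFDerivAt
    have h1 := hasDerivAt_update x (Sum.inr 1) (x (Sum.inr 1))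
    have h2 : HasFDerivAt (reducedGrad f ω ε (Sum.inr 0))
        (fderiv ℝ (reducedGrad f ω ε (Sum.inr 0)) x)
        (Function.update x (Sum.inr 1) (x (Sum.inr 1))) := by
      rwa [Function.update_eq_self]
    have h3 := h2.comp_hasDerivAt (x (Sum.inr 1)) h1
    rw [hz] at h3
    refine eq_zero_of_even_of_hasDerivAt (fun s => ?_) h3
    simp only [Function.comp_apply, reducedGrad]
    simp
    exact Or.inl (hf.dirD_eR_even hx hε s)
  have hzz : partialD (reducedGrad f ω ε (Sum.inr 1)) (Sum.inr 1) x = vertQ f ε r := by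
    refine partialD_eq (differentiableAt_reducedGrad hs hx hε _) ?_
    have h1 : HasDerivAt (fun s => s * (1 / √(s ^ 2 + r ^ 2)) ^ 3) (1 / r ^ 3) 0 := by
      have h2 := (hasDerivAt_inv_sqrt (r := 0) (c := r ^ 2) (by positivity)).pow 3
      refine ((hasDerivAt_id (0 : ℝ)).mul h2).congr_deriv ?_
      simp [Real.sqrt_sq hx.le]
    have h3 := (hs.dirD eZ).hasDerivAt_comp (hasDerivAt_vec3_z r 0) (vec3_ne_zero hx.ne') hε
    have h4 := h1.add (h3.const_mul ε)
    rw [hz]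
    refine (h4.congr_deriv (by rw [vertQ, vertDD])).congr_of_eventuallyEq
      (Eventually.of_forall fun s => ?_)
    simp [reducedGrad, ← hr, add_comm (s ^ 2)]
    ring
  ext i j
  rw [hpp]
  rcases j with j | j
  · rw [hinl]
    rcases i with i | i <;> fin_cases i <;> fin_cases j <;> simp
  · rcases i with i | i
    · rw [hinl']
      simp
    · fin_cases i <;> fin_cases j <;> simp [hrr, hrz, hzr, hzz]

/-- Along a planar curve the linearized equation is a pair of Hill equations. -/
theorem isFundamentalSolution_iff (hf : IsSymmetricPerturbation f) {ξ : ℝ → PhaseSpace} {ε : ℝ}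
    (hx : ∀ t, 0 < ξ t (Sum.inr 0)) (hz : ∀ t, ξ t (Sum.inr 1) = 0) (hε : ε ∈ Ico (0 : ℝ) 1)
    (γ : ℝ → Mat2 2) :
    IsFundamentalSolution (reducedHam f ω ε) ξ γ ↔ γ 0 = 1 ∧
      ∀ j, IsHill (fun t => effV'' f ω ε (ξ t (Sum.inr 0))) (fun t => γ t (Sum.inl 0) j)
          (fun t => γ t (Sum.inr 0) j) ∧
        IsHill (fun t => vertQ f ε (ξ t (Sum.inr 0))) (fun t => γ t (Sum.inl 1) j)
          (fun t => γ t (Sum.inr 1) j) := by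
  have key : ∀ t i j, (Matrix.J (Fin 2) ℝ * hessianMatrix (reducedHam f ω ε) (ξ t) * γ t) i j =
      Sum.elim ![-(effV'' f ω ε (ξ t (Sum.inr 0)) * γ t (Sum.inr 0) j),
        -(vertQ f ε (ξ t (Sum.inr 0)) * γ t (Sum.inr 1) j)]
        ![γ t (Sum.inl 0) j, γ t (Sum.inl 1) j] i := by
    intro t i j
    rw [hessianMatrix_planar hf (hx t) (hz t) hε]
    rcases i with i | i <;> fin_cases i <;>
      simp [Matrix.J, Matrix.mul_apply, Matrix.one_apply, Matrix.diagonal]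
  simp only [IsFundamentalSolution, key, IsHill]
  constructor
  · rintro ⟨h0, h⟩
    exact ⟨h0, fun j => ⟨fun t => ⟨h t (Sum.inl 0) j, h t (Sum.inr 0) j⟩,
      fun t => ⟨h t (Sum.inl 1) j, h t (Sum.inr 1) j⟩⟩⟩
  · rintro ⟨h0, h⟩
    refine ⟨h0, fun t i j => ?_⟩
    rcases i with i | i <;> fin_cases i
    · exact ((h j).1 t).1
    · exact ((h j).2 t).1
    · exact ((h j).1 t).2
    · exact ((h j).2 t).2

end hamiltonian

/-! ### The effective potential near the turning points -/

/-- The standing assumptions on the perturbed Kepler problem, together with a bound `C` for the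
derivatives of the perturbation that matter on the annulus `a ≤ r ≤ b` for `ε ≤ 1/2`. -/
structure KeplerPert (f : EuclideanSpace ℝ (Fin 3) → ℝ → ℝ) (ω h a b C : ℝ) : Prop where
  sym : IsSymmetricPerturbation f
  ω_ne : ω ≠ 0
  low : -1 < 2 * h * ω ^ 2
  high : 2 * h * ω ^ 2 < 0
  a_pos : 0 < a
  lt_peri : a < ω ^ 2 / (1 + ecc ω h)
  apo_lt : ω ^ 2 / (1 - ecc ω h) < b
  C_pos : 0 < C
  radVal_le : ∀ r ∈ Icc a b, ∀ ε ∈ Icc (0 : ℝ) (1 / 2), |radVal f r ε| ≤ C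
  radD_le : ∀ r ∈ Icc a b, ∀ ε ∈ Icc (0 : ℝ) (1 / 2), |radD f r ε| ≤ C
  radDD_le : ∀ r ∈ Icc a b, ∀ ε ∈ Icc (0 : ℝ) (1 / 2), |radDD f r ε| ≤ C
  vertDD_le : ∀ r ∈ Icc a b, ∀ ε ∈ Icc (0 : ℝ) (1 / 2), |vertDD f r ε| ≤ C

theorem exists_keplerPert {f : EuclideanSpace ℝ (Fin 3) → ℝ → ℝ} {ω h a b : ℝ}
    (hf : IsSymmetricPerturbation f) (hω : ω ≠ 0) (hlow : -1 < 2 * h * ω ^ 2)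
    (hhigh : 2 * h * ω ^ 2 < 0) (ha : 0 < a) (har : a < ω ^ 2 / (1 + ecc ω h))
    (hbr : ω ^ 2 / (1 - ecc ω h) < b) : ∃ C, KeplerPert f ω h a b C := by
  have hb : ∀ F : EuclideanSpace ℝ (Fin 3) → ℝ → ℝ, SmoothPert F →
      ∃ C, ∀ r ∈ Icc a b, ∀ ε ∈ Icc (0 : ℝ) (1 / 2), |F !₂[r, 0, 0] ε| ≤ C := by
    intro F hF
    have hK : IsCompact (Icc a b ×ˢ Icc (0 : ℝ) (1 / 2)) := isCompact_Icc.prod isCompact_Icc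
    obtain ⟨C, hC⟩ := hK.exists_bound_of_continuousOn (hF.continuousOn_plane.mono (by
      rintro ⟨r, ε⟩ ⟨h1, h2⟩
      exact ⟨ha.trans_le h1.1, h2.1, h2.2.trans_lt (by norm_num)⟩))
    exact ⟨C, fun r hr ε hε => hC (r, ε) ⟨hr, hε⟩⟩
  have hs := hf.smoothPert
  obtain ⟨C1, h1⟩ := hb _ hs
  obtain ⟨C2, h2⟩ := hb _ (hs.dirD eR)
  obtain ⟨C3, h3⟩ := hb _ ((hs.dirD eR).dirD eR)
  obtain ⟨C4, h4⟩ := hb _ ((hs.dirD eZ).dirD eZ)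
  refine ⟨|C1| + |C2| + |C3| + |C4| + 1, hf, hω, hlow, hhigh, ha, har, hbr, by positivity,
    fun r hr ε hε => (h1 r hr ε hε).trans ?_, fun r hr ε hε => (h2 r hr ε hε).trans ?_,
    fun r hr ε hε => (h3 r hr ε hε).trans ?_, fun r hr ε hε => (h4 r hr ε hε).trans ?_⟩ <;>
  linarith [abs_nonneg C1, abs_nonneg C2, abs_nonneg C3, abs_nonneg C4, le_abs_self C1,
    le_abs_self C2, le_abs_self C3, le_abs_self C4]

theorem eventually_mul_lt (c : ℝ) {d : ℝ} (hd : 0 < d) : ∀ᶠ ε in 𝓝[≥] (0 : ℝ), ε * c < d := by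
  have h1 : ContinuousAt (fun ε : ℝ => ε * c) 0 := by fun_prop
  have h2 : Iio d ∈ 𝓝 ((0 : ℝ) * c) := by
    rw [zero_mul]
    exact Iio_mem_nhds hd
  exact (h1.eventually h2).filter_mono nhdsWithin_le_nhds

/-- The parameter is small enough for the perturbed annulus `a ≤ r ≤ b` to look like the Kepler
one: `lt_left` and `lt_right` make the energy level avoid its boundary, `lt_sq` separates the
pericentre from the apocentre, and `le_ecc` keeps the eccentricity vector, over angles up to `3 π`,
close to its initial value; the factor `80` leaves room for these angles. -/
structure IsSmall (ω h a b C ε : ℝ) : Prop where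
  nonneg : 0 ≤ ε
  le_half : ε ≤ 1 / 2
  le_ecc : ε * (C * b ^ 2) ≤ ecc ω h / 80
  lt_sq : ε * (2 * ω ^ 2 * C) < 3 * ecc ω h ^ 2 / 4
  lt_left : ε * (2 * ω ^ 2 * C) < (ω ^ 2 / a - 1) ^ 2 - ecc ω h ^ 2
  lt_right : ε * (2 * ω ^ 2 * C) < (ω ^ 2 / b - 1) ^ 2 - ecc ω h ^ 2

namespace KeplerPert
variable {f : EuclideanSpace ℝ (Fin 3) → ℝ → ℝ} {ω h a b C ε : ℝ}

theorem ecc_pos (S : KeplerPert f ω h a b C) : 0 < ecc ω h :=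
  Real.sqrt_pos.2 (by linarith [S.low])

theorem ecc_sq (S : KeplerPert f ω h a b C) : ecc ω h ^ 2 = 1 + 2 * h * ω ^ 2 :=
  Real.sq_sqrt (by linarith [S.low])

theorem ecc_lt_one (S : KeplerPert f ω h a b C) : ecc ω h < 1 := by
  nlinarith [S.ecc_sq, S.high, S.ecc_pos]

theorem ω_sq_pos (S : KeplerPert f ω h a b C) : 0 < ω ^ 2 := by
  have := S.ω_ne
  positivity

theorem b_pos (S : KeplerPert f ω h a b C) : 0 < b :=
  (div_pos S.ω_sq_pos (by linarith [S.ecc_lt_one])).trans S.apo_lt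

theorem ecc_lt_left (S : KeplerPert f ω h a b C) : ecc ω h < ω ^ 2 / a - 1 := by
  have := S.lt_peri
  rw [lt_div_iff₀ (by linarith [S.ecc_pos])] at this
  rw [lt_sub_iff_add_lt, lt_div_iff₀ S.a_pos]
  linarith

theorem right_lt_ecc (S : KeplerPert f ω h a b C) : ω ^ 2 / b - 1 < -ecc ω h := by
  have := S.apo_lt
  rw [div_lt_iff₀ (by linarith [S.ecc_lt_one])] at this
  rw [sub_lt_iff_lt_add, div_lt_iff₀ S.b_pos]
  linarith

theorem a_lt_b (S : KeplerPert f ω h a b C) : a < b := by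
  have h1 := S.ecc_lt_left
  have h2 := S.right_lt_ecc
  have h3 : ω ^ 2 / b < ω ^ 2 / a := by linarith [S.ecc_pos]
  exact (div_lt_div_iff_of_pos_left S.ω_sq_pos S.b_pos S.a_pos).1 h3

theorem eventually_isSmall (S : KeplerPert f ω h a b C) :
    ∀ᶠ ε in 𝓝[≥] (0 : ℝ), IsSmall ω h a b C ε := by
  have he := S.ecc_pos
  have h1 := S.ecc_lt_left
  have h2 := S.right_lt_ecc
  filter_upwards [self_mem_nhdsWithin, eventually_mul_lt 1 (d := 1 / 2) (by norm_num),
    eventually_mul_lt (C * b ^ 2) (d := ecc ω h / 80) (by positivity),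
    eventually_mul_lt (2 * ω ^ 2 * C) (d := 3 * ecc ω h ^ 2 / 4) (by positivity),
    eventually_mul_lt (2 * ω ^ 2 * C) (d := (ω ^ 2 / a - 1) ^ 2 - ecc ω h ^ 2) (by nlinarith),
    eventually_mul_lt (2 * ω ^ 2 * C) (d := (ω ^ 2 / b - 1) ^ 2 - ecc ω h ^ 2) (by nlinarith)] with
    ε k0 k1 k2 k3 k4 k5
  exact ⟨k0, by linarith, k2.le, k3, k4, k5⟩

theorem pos_of_mem (S : KeplerPert f ω h a b C) {r : ℝ} (hr : r ∈ Icc a b) : 0 < r :=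
  S.a_pos.trans_le hr.1

theorem effV_eq (S : KeplerPert f ω h a b C) {r : ℝ} (hr : r ∈ Icc a b) :
    effV f ω ε r = h + ((ω ^ 2 / r - 1) ^ 2 - ecc ω h ^ 2) / (2 * ω ^ 2) + ε * radVal f r ε := by
  have := S.ω_ne
  have := S.pos_of_mem hr
  rw [effV, S.ecc_sq]
  field_simp
  ring

theorem effV'_eq (S : KeplerPert f ω h a b C) {r : ℝ} (hr : r ∈ Icc a b) :
    effV' f ω ε r = (1 - ω ^ 2 / r) / r ^ 2 + ε * radD f r ε := by
  have := S.pos_of_mem hr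
  rw [effV']
  field_simp
  ring

end KeplerPert

namespace IsSmall
variable {f : EuclideanSpace ℝ (Fin 3) → ℝ → ℝ} {ω h a b C ε : ℝ}

theorem mem_Icc (hε : IsSmall ω h a b C ε) : ε ∈ Icc (0 : ℝ) (1 / 2) := ⟨hε.nonneg, hε.le_half⟩

theorem mem_Ico (hε : IsSmall ω h a b C ε) : ε ∈ Ico (0 : ℝ) 1 :=
  ⟨hε.nonneg, hε.le_half.trans_lt (by norm_num)⟩

theorem abs_effV_sub_le (hε : IsSmall ω h a b C ε) (S : KeplerPert f ω h a b C) {r : ℝ}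
    (hr : r ∈ Icc a b) :
    |2 * ω ^ 2 * (effV f ω ε r - h) - ((ω ^ 2 / r - 1) ^ 2 - ecc ω h ^ 2)| ≤
      ε * (2 * ω ^ 2 * C) := by
  have hω := S.ω_ne
  have h1 : 2 * ω ^ 2 * (effV f ω ε r - h) - ((ω ^ 2 / r - 1) ^ 2 - ecc ω h ^ 2) =
      ε * (2 * ω ^ 2 * radVal f r ε) := by
    rw [S.effV_eq hr]
    field_simp
    ring
  rw [h1, abs_mul, abs_mul, abs_of_nonneg hε.nonneg, abs_of_pos (by positivity : 0 < 2 * ω ^ 2)]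
  have := S.radVal_le r hr ε hε.mem_Icc
  have := hε.nonneg
  gcongr

/-- The force has the sign of `ω² / r - 1`, up to a small error. -/
theorem abs_effV'_add_le (hε : IsSmall ω h a b C ε) (S : KeplerPert f ω h a b C) {r : ℝ}
    (hr : r ∈ Icc a b) : |r ^ 2 * effV' f ω ε r + (ω ^ 2 / r - 1)| ≤ ecc ω h / 80 := by
  have hr0 := S.pos_of_mem hr
  have h1 : r ^ 2 * effV' f ω ε r + (ω ^ 2 / r - 1) = ε * (radD f r ε * r ^ 2) := by
    rw [S.effV'_eq hr]
    field_simp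
    ring
  rw [h1, abs_mul, abs_mul, abs_of_nonneg hε.nonneg, abs_of_pos (by positivity : 0 < r ^ 2)]
  refine le_trans ?_ hε.le_ecc
  have := S.radD_le r hr ε hε.mem_Icc
  have := hε.nonneg
  have := S.C_pos
  have := hr.2
  gcongr

theorem lt_of_effV_eq (hε : IsSmall ω h a b C ε) (S : KeplerPert f ω h a b C) {r : ℝ}
    (hr : r ∈ Icc a b) (hV : effV f ω ε r = h) : (ecc ω h / 2) ^ 2 < (ω ^ 2 / r - 1) ^ 2 := by
  have h1 := abs_le.1 (hε.abs_effV_sub_le S hr)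
  rw [hV] at h1
  nlinarith [hε.lt_sq]

/-- A turning point where the force points outwards is close to the pericentre. -/
theorem ecc_lt_of_effV'_nonpos (hε : IsSmall ω h a b C ε) (S : KeplerPert f ω h a b C) {r : ℝ}
    (hr : r ∈ Icc a b) (hV : effV f ω ε r = h) (hV' : effV' f ω ε r ≤ 0) :
    ecc ω h / 2 < ω ^ 2 / r - 1 := by
  have h1 := hε.lt_of_effV_eq S hr hV
  have h2 := abs_le.1 (hε.abs_effV'_add_le S hr)
  have he := S.ecc_pos
  have h3 : r ^ 2 * effV' f ω ε r ≤ 0 := mul_nonpos_of_nonneg_of_nonpos (sq_nonneg r) hV'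
  nlinarith

theorem lt_neg_ecc_of_effV'_nonneg (hε : IsSmall ω h a b C ε) (S : KeplerPert f ω h a b C) {r : ℝ}
    (hr : r ∈ Icc a b) (hV : effV f ω ε r = h) (hV' : 0 ≤ effV' f ω ε r) :
    ω ^ 2 / r - 1 < -(ecc ω h / 2) := by
  have h1 := hε.lt_of_effV_eq S hr hV
  have h2 := abs_le.1 (hε.abs_effV'_add_le S hr)
  have he := S.ecc_pos
  have h3 : 0 ≤ r ^ 2 * effV' f ω ε r := mul_nonneg (sq_nonneg r) hV'
  nlinarith

theorem effV'_ne_zero (hε : IsSmall ω h a b C ε) (S : KeplerPert f ω h a b C) {r : ℝ}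
    (hr : r ∈ Icc a b) (hV : effV f ω ε r = h) : effV' f ω ε r ≠ 0 := by
  intro h0
  have h1 := hε.ecc_lt_of_effV'_nonpos S hr hV h0.le
  have h2 := hε.lt_neg_ecc_of_effV'_nonneg S hr hV h0.ge
  linarith [S.ecc_pos]

theorem abs_pericentre_sub_le (hε : IsSmall ω h a b C ε) (S : KeplerPert f ω h a b C) {r : ℝ}
    (hr : r ∈ Icc a b) (hV : effV f ω ε r = h) (hV' : effV' f ω ε r ≤ 0) :
    |ω ^ 2 / r - 1 - ecc ω h| ≤ ε * (2 * ω ^ 2 * C) / ecc ω h := by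
  have h1 := hε.abs_effV_sub_le S hr
  have h2 := hε.ecc_lt_of_effV'_nonpos S hr hV hV'
  have he := S.ecc_pos
  rw [hV, sub_self, mul_zero, zero_sub, abs_neg,
    show (ω ^ 2 / r - 1) ^ 2 - ecc ω h ^ 2 = (ω ^ 2 / r - 1 - ecc ω h) * (ω ^ 2 / r - 1 + ecc ω h) by
      ring, abs_mul, abs_of_pos (by linarith : 0 < ω ^ 2 / r - 1 + ecc ω h)] at h1
  rw [le_div_iff₀ he]
  refine le_trans ?_ h1
  gcongr
  linarith

theorem lipschitzOnWith_radVal (hε : IsSmall ω h a b C ε) (S : KeplerPert f ω h a b C) {r s : ℝ}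
    (hr : r ∈ Icc a b) (hs : s ∈ Icc a b) : |radVal f r ε - radVal f s ε| ≤ C * |r - s| :=
  Convex.norm_image_sub_le_of_norm_hasDerivWithin_le (f' := fun r => radD f r ε)
    (fun _ hx => (hasDerivAt_radVal S.sym.smoothPert (S.pos_of_mem hx)
      hε.mem_Ico).hasDerivWithinAt) (fun x hx => S.radD_le x hx ε hε.mem_Icc) (convex_Icc a b) hs hr

/-- The pericentre distance is determined by the energy. -/
theorem pericentre_unique (hε : IsSmall ω h a b C ε) (S : KeplerPert f ω h a b C) {r s : ℝ}
    (hr : r ∈ Icc a b) (hs : s ∈ Icc a b) (hVr : effV f ω ε r = h) (hVs : effV f ω ε s = h)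
    (hVr' : effV' f ω ε r ≤ 0) (hVs' : effV' f ω ε s ≤ 0) : r = s := by
  by_contra hne
  have h1 := hε.ecc_lt_of_effV'_nonpos S hr hVr hVr'
  have h2 := hε.ecc_lt_of_effV'_nonpos S hs hVs hVs'
  have h3 := hε.lipschitzOnWith_radVal S hr hs
  have hω := S.ω_ne
  have hr0 := S.pos_of_mem hr
  have hs0 := S.pos_of_mem hs
  have h4 : (r - s) * (ω ^ 2 / r + ω ^ 2 / s - 2) =
      2 * (r * s) * (ε * (radVal f r ε - radVal f s ε)) := by
    rw [S.effV_eq hr] at hVr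
    rw [S.effV_eq hs] at hVs
    have h5 : ((ω ^ 2 / r - 1) ^ 2 - (ω ^ 2 / s - 1) ^ 2) / (2 * ω ^ 2) =
        -(ε * (radVal f r ε - radVal f s ε)) := by
      have h6 : ((ω ^ 2 / r - 1) ^ 2 - (ω ^ 2 / s - 1) ^ 2) / (2 * ω ^ 2) =
          ((ω ^ 2 / r - 1) ^ 2 - ecc ω h ^ 2) / (2 * ω ^ 2) -
            ((ω ^ 2 / s - 1) ^ 2 - ecc ω h ^ 2) / (2 * ω ^ 2) := by ring
      rw [h6]
      linarith
    rw [← neg_neg (ε * _), ← h5]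
    field_simp
    ring
  have h6 : |r - s| * (ω ^ 2 / r + ω ^ 2 / s - 2) ≤ |r - s| * (2 * (ε * (C * b ^ 2))) := by
    rw [← abs_of_pos (by linarith [S.ecc_pos] : 0 < ω ^ 2 / r + ω ^ 2 / s - 2), ← abs_mul, h4,
      abs_mul, abs_of_pos (by positivity : 0 < 2 * (r * s)), abs_mul, abs_of_nonneg hε.nonneg]
    calc 2 * (r * s) * (ε * |radVal f r ε - radVal f s ε|)
        ≤ 2 * (b * b) * (ε * (C * |r - s|)) := by
          have := hε.nonneg
          have := hr.2
          have := hs.2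
          have := S.b_pos
          gcongr
      _ = _ := by ring
  have h7 := le_of_mul_le_mul_left h6 (abs_pos.2 (sub_ne_zero.2 hne))
  linarith [hε.le_ecc, S.ecc_pos]

theorem continuousOn_effV (hε : IsSmall ω h a b C ε) (S : KeplerPert f ω h a b C) :
    ContinuousOn (effV f ω ε) (Icc a b) := fun _ hr =>
  (hasDerivAt_effV S.sym.smoothPert (S.pos_of_mem hr) hε.mem_Ico).continuousAt.continuousWithinAt

theorem lt_effV_left (hε : IsSmall ω h a b C ε) (S : KeplerPert f ω h a b C) :
    h < effV f ω ε a := by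
  have h1 := abs_le.1 (hε.abs_effV_sub_le S ⟨le_rfl, S.a_lt_b.le⟩)
  have h2 : 0 < 2 * ω ^ 2 * (effV f ω ε a - h) := by linarith [hε.lt_left]
  have := pos_of_mul_pos_right h2 (by positivity)
  linarith

theorem lt_effV_right (hε : IsSmall ω h a b C ε) (S : KeplerPert f ω h a b C) :
    h < effV f ω ε b := by
  have h1 := abs_le.1 (hε.abs_effV_sub_le S ⟨S.a_lt_b.le, le_rfl⟩)
  have h2 : 0 < 2 * ω ^ 2 * (effV f ω ε b - h) := by linarith [hε.lt_right]
  have := pos_of_mul_pos_right h2 (by positivity)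
  linarith

theorem effV'_left_nonpos (hε : IsSmall ω h a b C ε) (S : KeplerPert f ω h a b C) :
    effV' f ω ε a ≤ 0 := by
  have h1 := abs_le.1 (hε.abs_effV'_add_le S ⟨le_rfl, S.a_lt_b.le⟩)
  have h2 : a ^ 2 * effV' f ω ε a < 0 := by linarith [S.ecc_lt_left, S.ecc_pos]
  exact (neg_of_mul_neg_right h2 (sq_nonneg a)).le

theorem effV'_right_nonneg (hε : IsSmall ω h a b C ε) (S : KeplerPert f ω h a b C) :
    0 ≤ effV' f ω ε b := by
  have h1 := abs_le.1 (hε.abs_effV'_add_le S ⟨S.a_lt_b.le, le_rfl⟩)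
  have h2 : 0 < b ^ 2 * effV' f ω ε b := by linarith [S.right_lt_ecc, S.ecc_pos]
  exact (pos_of_mul_pos_right h2 (sq_nonneg b)).le

theorem exists_pericentre (hε : IsSmall ω h a b C ε) (S : KeplerPert f ω h a b C) :
    ∃ r ∈ Icc a b, effV f ω ε r = h ∧ effV' f ω ε r ≤ 0 := by
  have he := S.ecc_pos
  have hω := S.ω_sq_pos
  set m := ω ^ 2 / (1 + ecc ω h / 2) with hm
  have hm0 : 0 < m := by positivity
  have hmu : ω ^ 2 / m - 1 = ecc ω h / 2 := by
    rw [hm, div_div_cancel₀ hω.ne']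
    ring
  have ham : a ≤ m := by
    have h1 : ω ^ 2 / m < ω ^ 2 / a := by linarith [S.ecc_lt_left]
    exact ((div_lt_div_iff_of_pos_left hω hm0 S.a_pos).1 h1).le
  have hmb : m ≤ b := by
    have h1 : ω ^ 2 / b < ω ^ 2 / m := by linarith [S.right_lt_ecc]
    exact ((div_lt_div_iff_of_pos_left hω S.b_pos hm0).1 h1).le
  have h1 : effV f ω ε m < h := by
    have h1 := abs_le.1 (hε.abs_effV_sub_le S ⟨ham, hmb⟩)
    rw [hmu] at h1
    have h2 : 2 * ω ^ 2 * (effV f ω ε m - h) < 0 := by nlinarith [hε.lt_sq]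
    have := neg_of_mul_neg_right h2 (by positivity)
    linarith
  obtain ⟨r, hr, hV⟩ := intermediate_value_Icc' ham
    ((hε.continuousOn_effV S).mono (Icc_subset_Icc_right hmb)) ⟨h1.le, (hε.lt_effV_left S).le⟩
  have hr' : r ∈ Icc a b := ⟨hr.1, hr.2.trans hmb⟩
  have h2 := abs_le.1 (hε.abs_effV'_add_le S hr')
  have h3 : ecc ω h / 2 ≤ ω ^ 2 / r - 1 := by
    rw [← hmu]
    have := S.pos_of_mem hr'
    have := hr.2
    gcongr
  have h4 : r ^ 2 * effV' f ω ε r < 0 := by linarith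
  exact ⟨r, hr', hV, (neg_of_mul_neg_right h4 (sq_nonneg r)).le⟩

/-- A bound for the second derivative of the effective potential on the annulus. -/
theorem abs_effV''_le (hε : IsSmall ω h a b C ε) (S : KeplerPert f ω h a b C) {r : ℝ}
    (hr : r ∈ Icc a b) : |effV'' f ω ε r| ≤ 3 * ω ^ 2 / a ^ 4 + 2 / a ^ 3 + C := by
  have hr0 := S.pos_of_mem hr
  have ha := S.a_pos
  have h1 : 3 * ω ^ 2 / r ^ 4 ≤ 3 * ω ^ 2 / a ^ 4 := by
    have := hr.1
    gcongr
  have h2 : 2 / r ^ 3 ≤ 2 / a ^ 3 := by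
    have := hr.1
    gcongr
  have h3 : |ε * radDD f r ε| ≤ 1 * C := by
    rw [abs_mul, abs_of_nonneg hε.nonneg]
    exact mul_le_mul (by linarith [hε.le_half]) (S.radDD_le r hr ε hε.mem_Icc) (abs_nonneg _)
      zero_le_one
  have h4 := abs_le.1 h3
  have h5 : 0 ≤ 3 * ω ^ 2 / r ^ 4 := by positivity
  have h6 : 0 ≤ 2 / r ^ 3 := by positivity
  rw [effV'', abs_le]
  constructor <;> linarith

theorem lipschitzOnWith_effV' (hε : IsSmall ω h a b C ε) (S : KeplerPert f ω h a b C) :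
    LipschitzOnWith (Real.toNNReal (3 * ω ^ 2 / a ^ 4 + 2 / a ^ 3 + C)) (effV' f ω ε) (Icc a b) :=
  Convex.lipschitzOnWith_of_nnnorm_hasDerivWithin_le (convex_Icc a b)
    (fun x hx => (hasDerivAt_effV' S.sym.smoothPert (S.pos_of_mem hx)
      hε.mem_Ico).hasDerivWithinAt) fun x hx => by
    rw [← NNReal.coe_le_coe, Real.coe_toNNReal _ ((abs_nonneg _).trans (hε.abs_effV''_le S hx))]
    exact hε.abs_effV''_le S hx

end IsSmall

/-! ### Planar solutions: existence, uniqueness, reversibility -/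

/-- A solution in the potential well of an energy level that avoids the ends of `[a, b]`. The
force is frozen outside `[a, b]` and the velocity is truncated, and the energy of the resulting
complete flow keeps the solution where nothing was changed. -/
theorem exists_newton_solution {V V' : ℝ → ℝ} {a b h r₀ : ℝ} {K : NNReal}
    (hV : ∀ r ∈ Icc a b, HasDerivAt V (V' r) r) (hK : LipschitzOnWith K V' (Icc a b))
    (hab : a ≤ b) (hVa : h < V a) (hVb : h < V b) (hVa' : V' a ≤ 0) (hVb' : 0 ≤ V' b)
    (hr₀ : r₀ ∈ Icc a b) (hVr₀ : V r₀ = h) :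
    ∃ p r : ℝ → ℝ, p 0 = 0 ∧ r 0 = r₀ ∧ ∀ t, HasDerivAt p (-V' (r t)) t ∧ HasDerivAt r (p t) t ∧
      r t ∈ Icc a b ∧ p t ^ 2 / 2 + V (r t) = h := by
  have hcV : ContinuousOn V (Icc a b) := fun r hr => (hV r hr).continuousAt.continuousWithinAt
  obtain ⟨m, hm⟩ : ∃ m, ∀ r ∈ Icc a b, m ≤ V r := by
    obtain ⟨x, hx, hmin⟩ := isCompact_Icc.exists_isMinOn ⟨r₀, hr₀⟩ hcV
    exact ⟨V x, fun r hr => hmin hr⟩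
  set B : ℝ := 2 * |h - m| + 1 with hB
  have hB0 : 0 < B := by positivity
  have hBm : h - m < B ^ 2 / 2 := by nlinarith [le_abs_self (h - m), abs_nonneg (h - m)]
  -- the frozen force and the truncated velocity, and their primitives
  set F : ℝ → ℝ := fun r => V' (projIcc a b hab r) with hF
  set c : ℝ → ℝ := fun p => projIcc (-B) B (by linarith) p with hc
  have hcl : LipschitzWith 1 c := LipschitzWith.subtype_val _ |>.comp (LipschitzWith.projIcc _)
    |>.weaken (by simp)
  have hFl : LipschitzWith K F := by
    have h1 := hK.to_restrict.comp (LipschitzWith.projIcc hab)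
    rw [mul_one] at h1
    exact h1
  have hcc : Continuous c := hcl.continuous
  have hFc : Continuous F := hFl.continuous
  obtain ⟨M, hM⟩ := isCompact_Icc.exists_bound_of_continuousOn (s := Icc a b) hK.continuousOn
  have hM0 : 0 ≤ M := (norm_nonneg _).trans (hM r₀ hr₀)
  have hlip : LipschitzWith (max K 1) fun x : ℝ × ℝ => (-F x.2, c x.1) := by
    have h1 := (hFl.comp LipschitzWith.prod_snd).neg.prodMk (hcl.comp LipschitzWith.prod_fst)
    simpa using h1
  obtain ⟨α, hα0, hα⟩ := exists_global_solution (v := fun _ x => (-F x.2, c x.1)) (K := max K 1)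
    (B := max M B) (fun _ => hlip) (fun _ => continuous_const) (fun _ x => by
      rw [Prod.norm_def]
      refine max_le_max ?_ ?_
      · rw [norm_neg]
        exact hM _ (projIcc a b hab x.2).2
      · rw [Real.norm_eq_abs, abs_le]
        exact (projIcc (-B) B (by linarith) x.1).2) (0, r₀)
  have hp : ∀ t, HasDerivAt (fun t => (α t).1) (-F (α t).2) t := fun t =>
    (hasFDerivAt_fst (𝕜 := ℝ) (p := α t)).comp_hasDerivAt t (hα t)
  have hr : ∀ t, HasDerivAt (fun t => (α t).2) (c (α t).1) t := fun t =>
    (hasFDerivAt_snd (𝕜 := ℝ) (p := α t)).comp_hasDerivAt t (hα t)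
  set W : ℝ → ℝ := fun r => V r₀ + ∫ s in r₀..r, F s with hW
  set L : ℝ → ℝ := fun p => ∫ s in (0 : ℝ)..p, c s with hL
  have hWd : ∀ r, HasDerivAt W (F r) r := fun r =>
    ((hFc.integral_hasStrictDerivAt r₀ r).hasDerivAt).const_add _
  have hLd : ∀ p, HasDerivAt L (c p) p := fun p => (hcc.integral_hasStrictDerivAt 0 p).hasDerivAt
  have hen : ∀ t, L (α t).1 + W (α t).2 = h := by
    have hd : ∀ t, HasDerivAt (fun t => L (α t).1 + W (α t).2) 0 t := fun t =>
      (((hLd _).comp t (hp t)).add ((hWd _).comp t (hr t))).congr_deriv (by ring)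
    intro t
    have h1 := is_const_of_deriv_eq_zero (fun t => (hd t).differentiableAt)
      (fun t => (hd t).deriv) t 0
    rw [h1, hα0]
    simp [hW, hL, hVr₀]
  have hFin : ∀ r ∈ Icc a b, F r = V' r := fun r hr => by rw [hF]; simp [projIcc_of_mem hab hr]
  have hWV : ∀ r ∈ Icc a b, W r = V r := by
    intro r hr
    have hsub : uIcc r₀ r ⊆ Icc a b := uIcc_subset_Icc hr₀ hr
    have h1 : ∫ s in r₀..r, F s = V r - V r₀ :=
      intervalIntegral.integral_eq_sub_of_hasDerivAt
        (fun s hs => (hFin s (hsub hs)).symm ▸ hV s (hsub hs)) (hFc.intervalIntegrable _ _)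
    rw [hW]
    simp [h1]
  have hcin : ∀ p ∈ Icc (-B) B, c p = p := fun p hp => by rw [hc]; simp [projIcc_of_mem _ hp]
  have hLp : ∀ p ∈ Icc (-B) B, L p = p ^ 2 / 2 := by
    intro p hp
    have hsub : uIcc 0 p ⊆ Icc (-B) B := uIcc_subset_Icc ⟨by linarith, hB0.le⟩ hp
    have h1 : L p = ∫ s in (0 : ℝ)..p, s :=
      intervalIntegral.integral_congr fun s hs => hcin s (hsub hs)
    rw [h1, integral_id]
    ring
  -- monotonicity of the primitives outside the region where they are unchanged
  have hLB : ∀ p, p ∉ Icc (-B) B → B ^ 2 / 2 ≤ L p := by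
    intro p hp
    have hdiff : Differentiable ℝ L := fun p => (hLd p).differentiableAt
    rw [mem_Icc, not_and_or, not_le, not_le] at hp
    rcases hp with hp | hp
    · have h1 : AntitoneOn L (Iic (-B)) := by
        refine antitoneOn_of_deriv_nonpos (convex_Iic _) hdiff.continuous.continuousOn
          hdiff.differentiableOn fun x hx => ?_
        rw [interior_Iic] at hx
        rw [(hLd x).deriv, hc]
        simp only [projIcc_of_le_left _ (mem_Iio.1 hx).le]
        linarith
      have h2 := h1 (mem_Iic.2 hp.le) (mem_Iic.2 le_rfl) hp.le
      rw [hLp (-B) ⟨le_rfl, by linarith⟩] at h2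
      linarith [neg_sq B]
    · have h1 : MonotoneOn L (Ici B) := by
        refine monotoneOn_of_deriv_nonneg (convex_Ici _) hdiff.continuous.continuousOn
          hdiff.differentiableOn fun x hx => ?_
        rw [interior_Ici] at hx
        rw [(hLd x).deriv, hc]
        simp only [projIcc_of_right_le _ (mem_Ioi.1 hx).le]
        linarith
      have h2 := h1 (mem_Ici.2 le_rfl) (mem_Ici.2 hp.le) hp.le
      rwa [hLp B ⟨by linarith, le_rfl⟩] at h2
  have hL0 : ∀ p, 0 ≤ L p := by
    intro p
    by_cases hp : p ∈ Icc (-B) B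
    · rw [hLp p hp]
      positivity
    · exact le_trans (by positivity) (hLB p hp)
  have hWdiff : Differentiable ℝ W := fun r => (hWd r).differentiableAt
  have hWa : ∀ r < a, V a ≤ W r := by
    intro r hra
    have h1 : AntitoneOn W (Iic a) := by
      refine antitoneOn_of_deriv_nonpos (convex_Iic _) hWdiff.continuous.continuousOn
        hWdiff.differentiableOn fun x hx => ?_
      rw [interior_Iic] at hx
      rw [(hWd x).deriv, hF]
      simpa only [projIcc_of_le_left _ (mem_Iio.1 hx).le] using hVa'
    have h2 := h1 (mem_Iic.2 hra.le) (mem_Iic.2 le_rfl) hra.le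
    rwa [hWV a ⟨le_rfl, hab⟩] at h2
  have hWb : ∀ r, b < r → V b ≤ W r := by
    intro r hrb
    have h1 : MonotoneOn W (Ici b) := by
      refine monotoneOn_of_deriv_nonneg (convex_Ici _) hWdiff.continuous.continuousOn
        hWdiff.differentiableOn fun x hx => ?_
      rw [interior_Ici] at hx
      rw [(hWd x).deriv, hF]
      simpa only [projIcc_of_right_le _ (mem_Ioi.1 hx).le] using hVb'
    have h2 := h1 (mem_Ici.2 le_rfl) (mem_Ici.2 hrb.le) hrb.le
    rwa [hWV b ⟨hab, le_rfl⟩] at h2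
  have hrmem : ∀ t, (α t).2 ∈ Icc a b := by
    intro t
    by_contra hcon
    rw [mem_Icc, not_and_or, not_le, not_le] at hcon
    rcases hcon with hcon | hcon
    · linarith [hen t, hL0 (α t).1, hWa _ hcon]
    · linarith [hen t, hL0 (α t).1, hWb _ hcon]
  have hpmem : ∀ t, (α t).1 ∈ Icc (-B) B := by
    intro t
    by_contra hcon
    have h1 := hen t
    rw [hWV _ (hrmem t)] at h1
    linarith [hLB _ hcon, hm _ (hrmem t)]
  refine ⟨fun t => (α t).1, fun t => (α t).2, by simp [hα0], by simp [hα0], fun t =>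
    ⟨?_, ?_, hrmem t, ?_⟩⟩
  · rw [← hFin _ (hrmem t)]
    exact hp t
  · exact (hr t).congr_deriv (hcin _ (hpmem t))
  · rw [← hLp _ (hpmem t), ← hWV _ (hrmem t)]
    exact hen t

/-- `(p, r)` solves the planar equations of motion, with energy `h` and `a ≤ r ≤ b`. -/
structure IsPlanarSol (f : EuclideanSpace ℝ (Fin 3) → ℝ → ℝ) (ω h a b ε : ℝ) (p r : ℝ → ℝ) :
    Prop where
  hasDerivAt_p : ∀ t, HasDerivAt p (-effV' f ω ε (r t)) t
  hasDerivAt_r : ∀ t, HasDerivAt r (p t) t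
  mem : ∀ t, r t ∈ Icc a b
  energy : ∀ t, p t ^ 2 / 2 + effV f ω ε (r t) = h

/-- A planar solution that starts at the pericentre. -/
structure IsPericentric (f : EuclideanSpace ℝ (Fin 3) → ℝ → ℝ) (ω h a b ε : ℝ) (p r : ℝ → ℝ) :
    Prop extends IsPlanarSol f ω h a b ε p r where
  p_zero : p 0 = 0
  effV'_nonpos : effV' f ω ε (r 0) ≤ 0

namespace IsPlanarSol
variable {f : EuclideanSpace ℝ (Fin 3) → ℝ → ℝ} {ω h a b C ε : ℝ} {p r p₁ r₁ : ℝ → ℝ}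

theorem continuous_p (hs : IsPlanarSol f ω h a b ε p r) : Continuous p :=
  continuous_iff_continuousAt.2 fun t => (hs.hasDerivAt_p t).continuousAt

theorem continuous_r (hs : IsPlanarSol f ω h a b ε p r) : Continuous r :=
  continuous_iff_continuousAt.2 fun t => (hs.hasDerivAt_r t).continuousAt

theorem effV_eq (hs : IsPlanarSol f ω h a b ε p r) {t : ℝ} (ht : p t = 0) :
    effV f ω ε (r t) = h := by
  have := hs.energy t
  rw [ht] at this
  linarith

theorem unique (hε : IsSmall ω h a b C ε) (S : KeplerPert f ω h a b C)
    (hs : IsPlanarSol f ω h a b ε p r) (hs₁ : IsPlanarSol f ω h a b ε p₁ r₁) {t₀ : ℝ}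
    (hp : p t₀ = p₁ t₀) (hr : r t₀ = r₁ t₀) : p = p₁ ∧ r = r₁ := by
  have hK := hε.lipschitzOnWith_effV' S
  set K := Real.toNNReal (3 * ω ^ 2 / a ^ 4 + 2 / a ^ 3 + C)
  have hlip : LipschitzOnWith (max K 1) (fun x : ℝ × ℝ => (-effV' f ω ε x.2, x.1))
      {x | x.2 ∈ Icc a b} := by
    have h1 : LipschitzOnWith (K * 1) (fun x : ℝ × ℝ => effV' f ω ε x.2) {x | x.2 ∈ Icc a b} :=
      hK.comp LipschitzWith.prod_snd.lipschitzOnWith fun x hx => hx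
    rw [mul_one] at h1
    exact h1.neg.prodMk LipschitzWith.prod_fst.lipschitzOnWith
  have h := ODE_solution_unique_univ (v := fun _ x => (-effV' f ω ε x.2, x.1))
    (s := fun _ => {x : ℝ × ℝ | x.2 ∈ Icc a b}) (f := fun t => (p t, r t))
    (g := fun t => (p₁ t, r₁ t)) (t₀ := t₀) (fun _ => hlip)
    (fun t => ⟨(hs.hasDerivAt_p t).prodMk (hs.hasDerivAt_r t), hs.mem t⟩)
    (fun t => ⟨(hs₁.hasDerivAt_p t).prodMk (hs₁.hasDerivAt_r t), hs₁.mem t⟩) (by rw [hp, hr])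
  exact ⟨funext fun t => congrArg Prod.fst (congrFun h t),
    funext fun t => congrArg Prod.snd (congrFun h t)⟩

theorem comp_add (hs : IsPlanarSol f ω h a b ε p r) (s : ℝ) :
    IsPlanarSol f ω h a b ε (fun t => p (t + s)) (fun t => r (t + s)) where
  hasDerivAt_p t := (hs.hasDerivAt_p (t + s)).comp_add_const t s
  hasDerivAt_r t := (hs.hasDerivAt_r (t + s)).comp_add_const t s
  mem _ := hs.mem _
  energy _ := hs.energy _

theorem comp_sub_left (hs : IsPlanarSol f ω h a b ε p r) (s : ℝ) :
    IsPlanarSol f ω h a b ε (fun t => -p (s - t)) (fun t => r (s - t)) where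
  hasDerivAt_p t := ((hs.hasDerivAt_p (s - t)).comp_const_sub s t).neg.congr_deriv (by ring)
  hasDerivAt_r t := (hs.hasDerivAt_r (s - t)).comp_const_sub s t
  mem _ := hs.mem _
  energy t := by
    have := hs.energy (s - t)
    rwa [neg_sq]

/-- A planar solution is symmetric about each of its turning points. -/
theorem reflect (hε : IsSmall ω h a b C ε) (S : KeplerPert f ω h a b C)
    (hs : IsPlanarSol f ω h a b ε p r) {t₀ : ℝ} (hp : p t₀ = 0) (t : ℝ) :
    p (2 * t₀ - t) = -p t ∧ r (2 * t₀ - t) = r t := by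
  have h2 : 2 * t₀ - t₀ = t₀ := by ring
  obtain ⟨h3, h4⟩ := (hs.comp_sub_left (2 * t₀)).unique hε S hs (t₀ := t₀)
    (by simp only [h2]; rw [hp, neg_zero]) (by simp only [h2])
  exact ⟨by rw [← congrFun h3 t, neg_neg], congrFun h4 t⟩

theorem add_period (hε : IsSmall ω h a b C ε) (S : KeplerPert f ω h a b C)
    (hs : IsPlanarSol f ω h a b ε p r) {t₀ t₁ : ℝ} (h0 : p t₀ = 0) (h1 : p t₁ = 0) (t : ℝ) :
    p (t + 2 * (t₁ - t₀)) = p t ∧ r (t + 2 * (t₁ - t₀)) = r t := by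
  obtain ⟨h2, h3⟩ := hs.reflect hε S h0 t
  obtain ⟨h4, h5⟩ := hs.reflect hε S h1 (2 * t₀ - t)
  have : 2 * t₁ - (2 * t₀ - t) = t + 2 * (t₁ - t₀) := by ring
  rw [this] at h4 h5
  exact ⟨by rw [h4, h2, neg_neg], by rw [h5, h3]⟩

/-- A periodic planar solution passes through the pericentre. -/
theorem exists_isPericentric (hs : IsPlanarSol f ω h a b ε p r) {T : ℝ} (hT : 0 < T)
    (hper : ∀ t, r (t + T) = r t) :
    ∃ s, IsPericentric f ω h a b ε (fun t => p (t + s)) (fun t => r (t + s)) := by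
  obtain ⟨s, -, hmin⟩ := isCompact_Icc.exists_isMinOn (s := Icc 0 T) ⟨0, le_rfl, hT.le⟩
    hs.continuous_r.continuousOn
  have hglob : ∀ t, r s ≤ r t := by
    intro t
    obtain ⟨y, hy, hyt⟩ := (show Function.Periodic r T from hper).exists_mem_Ico₀ hT t
    rw [hyt]
    exact hmin ⟨hy.1, hy.2.le⟩
  have hp : p s = 0 := by
    have h1 : IsLocalMin r s := Eventually.of_forall hglob
    exact h1.hasDerivAt_eq_zero (hs.hasDerivAt_r s)
  refine ⟨s, ⟨hs.comp_add s, by simpa using hp, ?_⟩⟩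
  rw [zero_add]
  by_contra! hcon
  -- otherwise `p < 0` right after `s`, and `r` decreases below its minimum
  have h1 : ∀ᶠ t in 𝓝[>] s, p t < 0 := by
    have h2 := (hasDerivAt_iff_tendsto_slope.1 (hs.hasDerivAt_p s)).eventually
      (gt_mem_nhds (by linarith : -effV' f ω ε (r s) < 0))
    have h3 : 𝓝[>] s ≤ 𝓝[≠] s := nhdsWithin_mono _ fun x hx => ne_of_gt hx
    filter_upwards [h2.filter_mono h3, self_mem_nhdsWithin] with t ht hts
    rw [slope_def_field, hp, sub_zero] at ht
    have h4 : 0 < t - s := sub_pos.2 hts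
    by_contra! h5
    exact absurd ht (not_lt.2 (div_nonneg h5 h4.le))
  obtain ⟨u, hu, hsub⟩ := mem_nhdsGT_iff_exists_Ioc_subset.1 h1
  have h2 : StrictAntiOn r (Icc s u) := by
    refine strictAntiOn_of_deriv_neg (convex_Icc s u) hs.continuous_r.continuousOn fun x hx => ?_
    rw [interior_Icc] at hx
    rw [(hs.hasDerivAt_r x).deriv]
    exact hsub ⟨hx.1, hx.2.le⟩
  have hsu : s < u := hu
  linarith [h2 ⟨le_rfl, hsu.le⟩ ⟨hsu.le, le_rfl⟩ hsu, hglob u]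

end IsPlanarSol

namespace IsSmall
variable {f : EuclideanSpace ℝ (Fin 3) → ℝ → ℝ} {ω h a b C ε : ℝ}

theorem exists_isPericentric (hε : IsSmall ω h a b C ε) (S : KeplerPert f ω h a b C) :
    ∃ p r, IsPericentric f ω h a b ε p r := by
  obtain ⟨r₀, hr₀, hV, hV'⟩ := hε.exists_pericentre S
  obtain ⟨p, r, hp, hr, hsol⟩ := exists_newton_solution
    (fun r hr => hasDerivAt_effV S.sym.smoothPert (S.pos_of_mem hr) hε.mem_Ico)
    (hε.lipschitzOnWith_effV' S) S.a_lt_b.le (hε.lt_effV_left S) (hε.lt_effV_right S)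
    (hε.effV'_left_nonpos S) (hε.effV'_right_nonneg S) hr₀ hV
  exact ⟨p, r, ⟨fun t => (hsol t).1, fun t => (hsol t).2.1, fun t => (hsol t).2.2.1,
    fun t => (hsol t).2.2.2⟩, hp, by rwa [hr]⟩

end IsSmall

theorem IsPericentric.unique {f : EuclideanSpace ℝ (Fin 3) → ℝ → ℝ} {ω h a b C ε : ℝ}
    {p r p₁ r₁ : ℝ → ℝ} (hε : IsSmall ω h a b C ε) (S : KeplerPert f ω h a b C)
    (hs : IsPericentric f ω h a b ε p r) (hs₁ : IsPericentric f ω h a b ε p₁ r₁) :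
    p = p₁ ∧ r = r₁ :=
  hs.toIsPlanarSol.unique hε S hs₁.toIsPlanarSol (t₀ := 0) (by rw [hs.p_zero, hs₁.p_zero])
    (hε.pericentre_unique S (hs.mem 0) (hs₁.mem 0) (hs.effV_eq hs.p_zero)
      (hs₁.effV_eq hs₁.p_zero) hs.effV'_nonpos hs₁.effV'_nonpos)

/-! ### The angle along a planar solution and its eccentricity vector -/

/-- The mean value inequality with `θ` in the role of time. -/
theorem abs_sub_le_mul_sub_of_deriv {X X' θ θ' : ℝ → ℝ} {K : ℝ}
    (hX : ∀ t, HasDerivAt X (X' t) t) (hθ : ∀ t, HasDerivAt θ (θ' t) t)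
    (h : ∀ t, |X' t| ≤ K * θ' t) {s t : ℝ} (hst : s ≤ t) : |X t - X s| ≤ K * (θ t - θ s) := by
  have h1 : Monotone fun t => K * θ t - X t :=
    monotone_of_deriv_nonneg (fun t => (((hθ t).const_mul K).fun_sub (hX t)).differentiableAt)
      fun t => by
        rw [(((hθ t).const_mul K).fun_sub (hX t)).deriv]
        linarith [(abs_le.1 (h t)).2]
  have h2 : Monotone fun t => K * θ t + X t :=
    monotone_of_deriv_nonneg (fun t => (((hθ t).const_mul K).fun_add (hX t)).differentiableAt)
      fun t => by
        rw [(((hθ t).const_mul K).fun_add (hX t)).deriv]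
        linarith [(abs_le.1 (h t)).1]
  have h3 := h1 hst
  have h4 := h2 hst
  simp only at h3 h4
  rw [abs_le]
  constructor <;> linarith

/-- The angle `θ` with `θ' = |ω| / r²` along a planar motion. -/
noncomputable def clock (ω : ℝ) (r : ℝ → ℝ) (t : ℝ) : ℝ := ∫ s in (0 : ℝ)..t, |ω| / r s ^ 2

/-- The component of the eccentricity vector of a planar motion with momentum `p` orthogonal to the
direction of the initial position, divided by `ω²`. It is constant for the Kepler problem. -/
noncomputable def eccX (ω : ℝ) (p r : ℝ → ℝ) (t : ℝ) : ℝ :=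
  -p t / |ω| * Real.cos (clock ω r t) + (1 / r t - 1 / ω ^ 2) * Real.sin (clock ω r t)

/-- The component of the eccentricity vector of a planar motion with momentum `p` in the direction
of the initial position, divided by `ω²`. It is constant for the Kepler problem. -/
noncomputable def eccY (ω : ℝ) (p r : ℝ → ℝ) (t : ℝ) : ℝ :=
  p t / |ω| * Real.sin (clock ω r t) + (1 / r t - 1 / ω ^ 2) * Real.cos (clock ω r t)

@[simp] theorem clock_zero (ω : ℝ) (r : ℝ → ℝ) : clock ω r 0 = 0 := intervalIntegral.integral_same

theorem p_div_eq_eccX_eccY (ω : ℝ) (p r : ℝ → ℝ) (t : ℝ) : p t / |ω| =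
    eccY ω p r t * Real.sin (clock ω r t) - eccX ω p r t * Real.cos (clock ω r t) := by
  rw [eccX, eccY]
  linear_combination (-p t / |ω|) * Real.sin_sq_add_cos_sq (clock ω r t)

theorem inv_sub_eq_eccX_eccY (ω : ℝ) (p r : ℝ → ℝ) (t : ℝ) : 1 / r t - 1 / ω ^ 2 =
    eccX ω p r t * Real.sin (clock ω r t) + eccY ω p r t * Real.cos (clock ω r t) := by
  rw [eccX, eccY]
  linear_combination -(1 / r t - 1 / ω ^ 2) * Real.sin_sq_add_cos_sq (clock ω r t)

namespace IsPlanarSol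
variable {f : EuclideanSpace ℝ (Fin 3) → ℝ → ℝ} {ω h a b C ε : ℝ} {p r : ℝ → ℝ}

theorem r_pos (S : KeplerPert f ω h a b C) (hs : IsPlanarSol f ω h a b ε p r) (t : ℝ) :
    0 < r t := S.pos_of_mem (hs.mem t)

theorem continuous_rate (S : KeplerPert f ω h a b C) (hs : IsPlanarSol f ω h a b ε p r) :
    Continuous fun s => |ω| / r s ^ 2 :=
  continuous_const.div (hs.continuous_r.pow 2) fun t => (pow_pos (hs.r_pos S t) 2).ne'

theorem hasDerivAt_clock (S : KeplerPert f ω h a b C) (hs : IsPlanarSol f ω h a b ε p r) (t : ℝ) :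
    HasDerivAt (clock ω r) (|ω| / r t ^ 2) t :=
  ((hs.continuous_rate S).integral_hasStrictDerivAt 0 t).hasDerivAt

theorem rate_pos (S : KeplerPert f ω h a b C) (hs : IsPlanarSol f ω h a b ε p r) (t : ℝ) :
    0 < |ω| / r t ^ 2 :=
  div_pos (abs_pos.2 S.ω_ne) (pow_pos (hs.r_pos S t) 2)

theorem rate_le (S : KeplerPert f ω h a b C) (hs : IsPlanarSol f ω h a b ε p r) (t : ℝ) :
    |ω| / r t ^ 2 ≤ |ω| / a ^ 2 := by
  have := S.a_pos
  have := (hs.mem t).1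
  gcongr

theorem strictMono_clock (S : KeplerPert f ω h a b C) (hs : IsPlanarSol f ω h a b ε p r) :
    StrictMono (clock ω r) :=
  strictMono_of_deriv_pos fun t => by
    rw [(hs.hasDerivAt_clock S t).deriv]
    exact hs.rate_pos S t

theorem continuous_clock (S : KeplerPert f ω h a b C) (hs : IsPlanarSol f ω h a b ε p r) :
    Continuous (clock ω r) :=
  continuous_iff_continuousAt.2 fun t => (hs.hasDerivAt_clock S t).continuousAt

theorem exists_clock_eq (S : KeplerPert f ω h a b C) (hs : IsPlanarSol f ω h a b ε p r) {x : ℝ}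
    (hx : 0 ≤ x) : ∃ t, 0 ≤ t ∧ clock ω r t = x := by
  have hb := S.b_pos
  have hc : 0 < |ω| / b ^ 2 := div_pos (abs_pos.2 S.ω_ne) (by positivity)
  set t := x / (|ω| / b ^ 2) with ht
  have ht0 : 0 ≤ t := by positivity
  have h1 : Monotone fun t => clock ω r t - |ω| / b ^ 2 * t := by
    have hd : ∀ t, HasDerivAt (fun t => clock ω r t - |ω| / b ^ 2 * t)
        (|ω| / r t ^ 2 - |ω| / b ^ 2) t := fun t =>
      ((hs.hasDerivAt_clock S t).sub ((hasDerivAt_id' t).const_mul _)).congr_deriv (by ring)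
    refine monotone_of_deriv_nonneg (fun t => (hd t).differentiableAt) fun t => ?_
    rw [(hd t).deriv, sub_nonneg]
    have := (hs.mem t).2
    have := hs.r_pos S t
    gcongr
  have h2 := h1 ht0
  have h3 : |ω| / b ^ 2 * t = x := mul_div_cancel₀ _ hc.ne'
  simp only [clock_zero, mul_zero, sub_zero, h3] at h2
  obtain ⟨s, hs', hsx⟩ := intermediate_value_Icc ht0 (hs.continuous_clock S).continuousOn
    (show x ∈ Icc (clock ω r 0) (clock ω r t) from ⟨by simpa using hx, by linarith⟩)
  exact ⟨s, hs'.1, hsx⟩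

theorem clock_add (S : KeplerPert f ω h a b C) (hs : IsPlanarSol f ω h a b ε p r) (s t : ℝ) :
    clock ω r (t + s) = clock ω r s + clock ω (fun t => r (t + s)) t := by
  have hint := fun x y => (hs.continuous_rate S).intervalIntegrable (μ := volume) x y
  have h1 : clock ω (fun t => r (t + s)) t = ∫ x in (0 + s)..(t + s), |ω| / r x ^ 2 :=
    intervalIntegral.integral_comp_add_right (fun x => |ω| / r x ^ 2) s
  rw [h1, zero_add, clock, clock, intervalIntegral.integral_add_adjacent_intervals (hint _ _)
    (hint _ _)]

/-- The derivative of the eccentricity vector is of the size of the perturbation. -/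
theorem hasDerivAt_ecc (S : KeplerPert f ω h a b C) (hs : IsPlanarSol f ω h a b ε p r) (t : ℝ) :
    HasDerivAt (eccX ω p r)
        (ε * (radD f (r t) ε * r t ^ 2 / ω ^ 2 * Real.cos (clock ω r t) * (|ω| / r t ^ 2))) t ∧
      HasDerivAt (eccY ω p r)
        (-(ε * (radD f (r t) ε * r t ^ 2 / ω ^ 2 * Real.sin (clock ω r t) * (|ω| / r t ^ 2)))) t := by
  have hr := hs.r_pos S t
  have hω : 0 < |ω| := abs_pos.2 S.ω_ne
  have hω2 : ω ^ 2 = |ω| ^ 2 := (sq_abs ω).symm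
  have hu : HasDerivAt (fun t => 1 / r t - 1 / ω ^ 2) (-p t / r t ^ 2) t := by
    have h1 := (((hasDerivAt_const t (1 : ℝ)).div (hs.hasDerivAt_r t) hr.ne').sub_const (1 / ω ^ 2))
    exact h1.congr_deriv (by ring)
  have hc := (hs.hasDerivAt_clock S t).cos
  have hsn := (hs.hasDerivAt_clock S t).sin
  have hp1 := (hs.hasDerivAt_p t).div_const |ω|
  have hp2 := (hs.hasDerivAt_p t).fun_neg.div_const |ω|
  constructor
  · refine ((hp2.mul hc).add (hu.mul hsn)).congr_deriv ?_
    rw [S.effV'_eq (hs.mem t), hω2]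
    field_simp
    ring
  · refine ((hp1.mul hsn).add (hu.mul hc)).congr_deriv ?_
    rw [S.effV'_eq (hs.mem t), hω2]
    field_simp
    ring

theorem abs_radD_mul_le (hε : IsSmall ω h a b C ε) (S : KeplerPert f ω h a b C)
    (hs : IsPlanarSol f ω h a b ε p r) {t c : ℝ} (hc : |c| ≤ 1) :
    |ε * (radD f (r t) ε * r t ^ 2 / ω ^ 2 * c * (|ω| / r t ^ 2))| ≤
      ε * (C * b ^ 2 / ω ^ 2) * (|ω| / r t ^ 2) := by
  have h0 := hε.nonneg
  have h1 := S.radD_le _ (hs.mem t) ε hε.mem_Icc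
  have h2 := (hs.mem t).2
  have h3 := hs.r_pos S t
  have h4 := S.C_pos
  have h5 : |radD f (r t) ε * r t ^ 2 / ω ^ 2 * c| ≤ C * b ^ 2 / ω ^ 2 := by
    rw [abs_mul, abs_div, abs_mul, abs_of_nonneg (sq_nonneg ω), abs_of_nonneg (sq_nonneg (r t))]
    calc |radD f (r t) ε| * r t ^ 2 / ω ^ 2 * |c| ≤ C * b ^ 2 / ω ^ 2 * 1 := by gcongr
      _ = _ := mul_one _
  rw [abs_mul, abs_mul, abs_of_nonneg h0, abs_of_pos (hs.rate_pos S t), mul_assoc]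
  gcongr

theorem abs_eccX_sub_le (hε : IsSmall ω h a b C ε) (S : KeplerPert f ω h a b C)
    (hs : IsPlanarSol f ω h a b ε p r) {t : ℝ} (ht : 0 ≤ t) :
    |eccX ω p r t - eccX ω p r 0| ≤ ε * (C * b ^ 2 / ω ^ 2) * clock ω r t := by
  have := abs_sub_le_mul_sub_of_deriv (fun t => (hs.hasDerivAt_ecc S t).1) (hs.hasDerivAt_clock S)
    (fun t => hs.abs_radD_mul_le hε S (Real.abs_cos_le_one _)) ht
  simpa using this

theorem abs_eccY_sub_le (hε : IsSmall ω h a b C ε) (S : KeplerPert f ω h a b C)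
    (hs : IsPlanarSol f ω h a b ε p r) {t : ℝ} (ht : 0 ≤ t) :
    |eccY ω p r t - eccY ω p r 0| ≤ ε * (C * b ^ 2 / ω ^ 2) * clock ω r t := by
  have := abs_sub_le_mul_sub_of_deriv (fun t => (hs.hasDerivAt_ecc S t).2) (hs.hasDerivAt_clock S)
    (fun t => by
      rw [abs_neg]
      exact hs.abs_radD_mul_le hε S (Real.abs_sin_le_one _)) ht
  simpa using this

end IsPlanarSol

/-- `t₁` is the time from the pericentre to the apocentre. -/
structure IsHalfPeriod (ω : ℝ) (p r : ℝ → ℝ) (t₁ : ℝ) : Prop where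
  pos : 0 < t₁
  p_eq : p t₁ = 0
  p_pos : ∀ t ∈ Ioo 0 t₁, 0 < p t
  clock_mem : clock ω r t₁ ∈ Ioo (Real.pi / 2) (3 * Real.pi / 2)

namespace IsPericentric
variable {f : EuclideanSpace ℝ (Fin 3) → ℝ → ℝ} {ω h a b C ε t₁ : ℝ} {p r : ℝ → ℝ}

theorem eccX_zero (hs : IsPericentric f ω h a b ε p r) : eccX ω p r 0 = 0 := by
  simp [eccX, hs.p_zero]

theorem eccY_zero (p : ℝ → ℝ) : eccY ω p r 0 = 1 / r 0 - 1 / ω ^ 2 := by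
  simp [eccY]

theorem lt_eccY_zero (hε : IsSmall ω h a b C ε) (S : KeplerPert f ω h a b C)
    (hs : IsPericentric f ω h a b ε p r) :
    40 * (ecc ω h / 80 / ω ^ 2) < eccY ω p r 0 := by
  have h1 := hε.ecc_lt_of_effV'_nonpos S (hs.mem 0) (hs.effV_eq hs.p_zero) hs.effV'_nonpos
  have hω := S.ω_sq_pos
  have h2 : eccY ω p r 0 = (ω ^ 2 / r 0 - 1) / ω ^ 2 := by
    have := hs.toIsPlanarSol.r_pos S 0
    have := S.ω_ne
    rw [eccY_zero]
    field_simp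
  rw [h2, show 40 * (ecc ω h / 80 / ω ^ 2) = ecc ω h / 2 / ω ^ 2 by ring]
  gcongr

theorem mul_C_le (hε : IsSmall ω h a b C ε) (S : KeplerPert f ω h a b C) :
    ε * (C * b ^ 2 / ω ^ 2) ≤ ecc ω h / 80 / ω ^ 2 := by
  have hω := S.ω_sq_pos
  rw [mul_div_assoc']
  gcongr
  exact hε.le_ecc

theorem abs_eccX_le (hε : IsSmall ω h a b C ε) (S : KeplerPert f ω h a b C)
    (hs : IsPericentric f ω h a b ε p r) {t : ℝ} (ht : 0 ≤ t) :
    |eccX ω p r t| ≤ ecc ω h / 80 / ω ^ 2 * clock ω r t := by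
  have h1 := hs.abs_eccX_sub_le hε S ht
  rw [hs.eccX_zero, sub_zero] at h1
  have h2 : 0 ≤ clock ω r t := by
    simpa using (hs.toIsPlanarSol.strictMono_clock S).monotone ht
  exact h1.trans (mul_le_mul_of_nonneg_right (mul_C_le hε S) h2)

theorem lt_eccY (hε : IsSmall ω h a b C ε) (S : KeplerPert f ω h a b C)
    (hs : IsPericentric f ω h a b ε p r) {t : ℝ} (ht : 0 ≤ t) :
    ecc ω h / 80 / ω ^ 2 * (40 - clock ω r t) < eccY ω p r t := by
  have h1 := abs_le.1 (hs.abs_eccY_sub_le hε S ht)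
  have h2 : 0 ≤ clock ω r t := by
    simpa using (hs.toIsPlanarSol.strictMono_clock S).monotone ht
  have h3 := mul_le_mul_of_nonneg_right (mul_C_le hε S) h2
  linarith [hs.lt_eccY_zero hε S]

/-- The momentum is `|ω| (eccY sin θ - eccX cos θ)`, where `eccX` is small with respect to `eccY`.
It is positive for angles up to `π / 2` and negative at `3 π / 2`, and the half period is its first
zero in between. -/
theorem exists_isHalfPeriod (hε : IsSmall ω h a b C ε) (S : KeplerPert f ω h a b C)
    (hs : IsPericentric f ω h a b ε p r) : ∃ t₁, IsHalfPeriod ω p r t₁ := by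
  have hω : 0 < |ω| := abs_pos.2 S.ω_ne
  have hκ : 0 < ecc ω h / 80 / ω ^ 2 := div_pos (div_pos S.ecc_pos (by norm_num)) S.ω_sq_pos
  have hmono := hs.toIsPlanarSol.strictMono_clock S
  have hπ := Real.pi_gt_three
  have hπ' := Real.pi_lt_four
  set κ := ecc ω h / 80 / ω ^ 2 with hκdef
  have hpos : ∀ t, 0 < t → clock ω r t ≤ Real.pi / 2 → 0 < p t := by
    intro t ht hct
    have h0 : 0 < clock ω r t := by simpa using hmono ht
    have h1 := hs.abs_eccX_le hε S ht.le
    have h2 := hs.lt_eccY hε S ht.le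
    have h3 := Real.mul_le_sin h0.le hct
    have h4 : clock ω r t / 2 ≤ Real.sin (clock ω r t) := by
      refine le_trans ?_ h3
      rw [div_mul_eq_mul_div, div_le_div_iff₀ two_pos Real.pi_pos]
      nlinarith
    have h5 : eccX ω p r t * Real.cos (clock ω r t) ≤ κ * clock ω r t := by
      refine (le_abs_self _).trans ?_
      rw [abs_mul]
      calc |eccX ω p r t| * |Real.cos (clock ω r t)| ≤ κ * clock ω r t * 1 :=
            mul_le_mul h1 (Real.abs_cos_le_one _) (abs_nonneg _) (by positivity)
        _ = _ := mul_one _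
    have h6 : κ * 38 * (clock ω r t / 2) ≤ eccY ω p r t * Real.sin (clock ω r t) := by
      refine mul_le_mul ?_ h4 (by positivity) ?_
      · nlinarith
      · nlinarith
    have h7 : 0 < p t / |ω| := by
      rw [p_div_eq_eccX_eccY ω p r t]
      nlinarith [mul_pos hκ h0]
    exact (div_pos_iff_of_pos_right hω).1 h7
  obtain ⟨t₂, ht₂, hc₂⟩ := hs.toIsPlanarSol.exists_clock_eq S (x := Real.pi / 2) (by positivity)
  obtain ⟨t₃, ht₃, hc₃⟩ := hs.toIsPlanarSol.exists_clock_eq S (x := 3 * Real.pi / 2) (by positivity)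
  have h23 : t₂ < t₃ := hmono.lt_iff_lt.1 (by rw [hc₂, hc₃]; linarith)
  have ht₂' : 0 < t₂ := hmono.lt_iff_lt.1 (by rw [hc₂, clock_zero]; positivity)
  have hp₂ := hpos t₂ ht₂' hc₂.le
  have hp₃ : p t₃ < 0 := by
    have h2 := hs.lt_eccY hε S ht₃
    have h7 : p t₃ / |ω| < 0 := by
      rw [p_div_eq_eccX_eccY ω p r t₃, hc₃, show 3 * Real.pi / 2 = Real.pi / 2 + Real.pi by ring,
        Real.sin_add_pi, Real.cos_add_pi, Real.sin_pi_div_two, Real.cos_pi_div_two]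
      rw [hc₃] at h2
      nlinarith
    exact (div_lt_iff₀ hω).1 h7 |>.trans_eq (zero_mul _)
  have hne : ({t ∈ Icc t₂ t₃ | p t = 0}).Nonempty := by
    obtain ⟨t, ht, hpt⟩ := intermediate_value_Icc' h23.le hs.continuous_p.continuousOn
      (show (0 : ℝ) ∈ Icc (p t₃) (p t₂) from ⟨hp₃.le, hp₂.le⟩)
    exact ⟨t, ht, hpt⟩
  have hcomp : IsCompact {t ∈ Icc t₂ t₃ | p t = 0} :=
    isCompact_Icc.inter_right (isClosed_singleton.preimage hs.continuous_p)
  obtain ⟨t₁, ⟨ht₁, hp₁⟩, hleast⟩ := hcomp.exists_isLeast hne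
  have h21 : t₂ < t₁ := lt_of_le_of_ne ht₁.1 fun heq => by
    rw [heq, hp₁] at hp₂
    exact lt_irrefl _ hp₂
  have h13 : t₁ < t₃ := lt_of_le_of_ne ht₁.2 fun heq => by
    rw [← heq, hp₁] at hp₃
    exact lt_irrefl _ hp₃
  refine ⟨t₁, ht₂'.trans h21, hp₁, fun t ht => ?_, ?_, ?_⟩
  · rcases le_or_gt t t₂ with htt | htt
    · exact hpos t ht.1 (hc₂ ▸ hmono.monotone htt)
    · by_contra! hcon
      obtain ⟨x, hx, hpx⟩ := intermediate_value_Icc' htt.le hs.continuous_p.continuousOn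
        (show (0 : ℝ) ∈ Icc (p t) (p t₂) from ⟨hcon, hp₂.le⟩)
      have := hleast ⟨⟨hx.1, hx.2.trans (ht.2.le.trans ht₁.2)⟩, hpx⟩
      linarith [hx.2, ht.2]
  · rw [← hc₂]
    exact hmono h21
  · rw [← hc₃]
    exact hmono h13

theorem periodic (hε : IsSmall ω h a b C ε) (S : KeplerPert f ω h a b C)
    (hs : IsPericentric f ω h a b ε p r) (ht₁ : IsHalfPeriod ω p r t₁) (t : ℝ) :
    p (t + 2 * t₁) = p t ∧ r (t + 2 * t₁) = r t := by
  simpa using hs.toIsPlanarSol.add_period hε S hs.p_zero ht₁.p_eq t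

theorem reflect_half (hε : IsSmall ω h a b C ε) (S : KeplerPert f ω h a b C)
    (hs : IsPericentric f ω h a b ε p r) (ht₁ : IsHalfPeriod ω p r t₁) (t : ℝ) :
    p (2 * t₁ - t) = -p t ∧ r (2 * t₁ - t) = r t :=
  hs.toIsPlanarSol.reflect hε S ht₁.p_eq t

theorem p_neg (hε : IsSmall ω h a b C ε) (S : KeplerPert f ω h a b C)
    (hs : IsPericentric f ω h a b ε p r) (ht₁ : IsHalfPeriod ω p r t₁) {t : ℝ}
    (ht : t ∈ Ioo t₁ (2 * t₁)) : p t < 0 := by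
  have h1 := (hs.reflect_half hε S ht₁ t).1
  have h2 := ht₁.p_pos (2 * t₁ - t) ⟨by linarith [ht.2], by linarith [ht.1]⟩
  linarith

theorem clock_period (hε : IsSmall ω h a b C ε) (S : KeplerPert f ω h a b C)
    (hs : IsPericentric f ω h a b ε p r) (ht₁ : IsHalfPeriod ω p r t₁) :
    clock ω r (2 * t₁) = 2 * clock ω r t₁ := by
  have hint := fun x y => (hs.toIsPlanarSol.continuous_rate S).intervalIntegrable (μ := volume) x y
  have h1 : ∫ s in t₁..(2 * t₁), |ω| / r s ^ 2 = clock ω r t₁ := by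
    have h2 := intervalIntegral.integral_comp_sub_left (a := 0) (b := t₁)
      (fun s => |ω| / r s ^ 2) (2 * t₁)
    simp only [fun t => (hs.reflect_half hε S ht₁ t).2, sub_zero,
      show 2 * t₁ - t₁ = t₁ by ring] at h2
    exact h2.symm
  rw [two_mul (clock ω r t₁)]
  conv_rhs => arg 2; rw [← h1]
  exact (intervalIntegral.integral_add_adjacent_intervals (hint _ _) (hint _ _)).symm

theorem clock_add_period (hε : IsSmall ω h a b C ε) (S : KeplerPert f ω h a b C)
    (hs : IsPericentric f ω h a b ε p r) (ht₁ : IsHalfPeriod ω p r t₁) (t : ℝ) :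
    clock ω r (t + 2 * t₁) = clock ω r t + clock ω r (2 * t₁) := by
  rw [hs.toIsPlanarSol.clock_add S]
  simp only [fun t => (hs.periodic hε S ht₁ t).2]
  ring

theorem clock_add_nat_mul_period (hε : IsSmall ω h a b C ε) (S : KeplerPert f ω h a b C)
    (hs : IsPericentric f ω h a b ε p r) (ht₁ : IsHalfPeriod ω p r t₁) (t : ℝ) (m : ℕ) :
    clock ω r (t + m * (2 * t₁)) = clock ω r t + m * clock ω r (2 * t₁) := by
  induction m with
  | zero => simp
  | succ m ih =>
    rw [show t + ((m + 1 : ℕ) : ℝ) * (2 * t₁) = t + m * (2 * t₁) + 2 * t₁ by push_cast; ring,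
      hs.clock_add_period hε S ht₁, ih]
    push_cast
    ring

theorem period_le (hε : IsSmall ω h a b C ε) (S : KeplerPert f ω h a b C)
    (hs : IsPericentric f ω h a b ε p r) (ht₁ : IsHalfPeriod ω p r t₁) {T : ℝ} (hT : 0 < T)
    (hper : ∀ t, p (t + T) = p t) : 2 * t₁ ≤ T := by
  by_contra! hcon
  have hpT : p T = 0 := by simpa [hs.p_zero] using hper 0
  rcases lt_trichotomy T t₁ with h1 | h1 | h1
  · exact (ht₁.p_pos T ⟨hT, h1⟩).ne' hpT
  · have h2 := ht₁.p_pos (t₁ / 2) ⟨by linarith [ht₁.pos], by linarith [ht₁.pos]⟩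
    have h3 := hs.p_neg hε S ht₁ (t := t₁ / 2 + T)
      ⟨by linarith [ht₁.pos], by linarith [ht₁.pos]⟩
    rw [hper] at h3
    linarith
  · exact (hs.p_neg hε S ht₁ ⟨h1, hcon⟩).ne hpT

/-- After one period the position is the initial one and only the clock has moved on, so that the
eccentricity vector has turned by the angular period. -/
theorem eccX_period (hε : IsSmall ω h a b C ε) (S : KeplerPert f ω h a b C)
    (hs : IsPericentric f ω h a b ε p r) (ht₁ : IsHalfPeriod ω p r t₁) :
    eccX ω p r (2 * t₁) = eccY ω p r 0 * Real.sin (clock ω r (2 * t₁)) ∧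
      eccY ω p r (2 * t₁) = eccY ω p r 0 * Real.cos (clock ω r (2 * t₁)) := by
  obtain ⟨h1, h2⟩ := hs.periodic hε S ht₁ 0
  rw [zero_add] at h1 h2
  rw [eccY_zero, eccX, eccY, h1, h2, hs.p_zero]
  constructor <;> ring

theorem abs_clock_period_sub_lt (hε : IsSmall ω h a b C ε) (S : KeplerPert f ω h a b C)
    (hs : IsPericentric f ω h a b ε p r) (ht₁ : IsHalfPeriod ω p r t₁) :
    |clock ω r (2 * t₁) - 2 * Real.pi| < Real.pi / 2 := by
  have hκ : 0 < ecc ω h / 80 / ω ^ 2 := div_pos (div_pos S.ecc_pos (by norm_num)) S.ω_sq_pos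
  have h1 := hs.lt_eccY hε S (by linarith [ht₁.pos] : (0 : ℝ) ≤ 2 * t₁)
  have h0 := hs.lt_eccY_zero hε S
  rw [(hs.eccX_period hε S ht₁).2] at h1
  have h2 := ht₁.clock_mem
  rw [hs.clock_period hε S ht₁] at h1 ⊢
  have hπ := Real.pi_lt_four
  have h3 : 0 < Real.cos (2 * clock ω r t₁) := by
    refine pos_of_mul_pos_right (lt_trans ?_ h1) (by linarith)
    exact mul_pos hκ (by linarith [h2.2])
  by_contra! hcon
  have h4 : Real.cos (2 * clock ω r t₁) ≤ 0 := by
    rcases le_abs.1 hcon with h5 | h5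
    · rw [← Real.cos_sub_two_pi]
      exact Real.cos_nonpos_of_pi_div_two_le_of_le h5 (by linarith [h2.2])
    · rw [← Real.cos_sub_two_pi, ← Real.cos_neg]
      exact Real.cos_nonpos_of_pi_div_two_le_of_le h5 (by linarith [h2.1])
  linarith

end IsPericentric

/-! ### The planar periodic orbit and its tangent vector -/

/-- The curve in phase space of a planar motion. -/
def planarCurve (p r : ℝ → ℝ) (t : ℝ) : PhaseSpace := Sum.elim ![p t, 0] ![r t, 0]

section orbit
variable {f : EuclideanSpace ℝ (Fin 3) → ℝ → ℝ} {ω h a b C ε t₁ T : ℝ} {p r : ℝ → ℝ}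
  {ξ : ℝ → PhaseSpace}

theorem IsPericentric.isPlanarOrbit (hε : IsSmall ω h a b C ε) (S : KeplerPert f ω h a b C)
    (hs : IsPericentric f ω h a b ε p r) (ht₁ : IsHalfPeriod ω p r t₁) :
    IsPlanarOrbit (reducedHam f ω ε) h a b (planarCurve p r) (2 * t₁) where
  solution t := by
    rw [hamVectorField_planar S.sym (by simpa [planarCurve] using hs.toIsPlanarSol.r_pos S t)
      (by simp [planarCurve]) (by simp [planarCurve]) hε.mem_Ico, hasDerivAt_pi]
    rintro (i | i) <;> fin_cases i
    · simpa [planarCurve] using hs.hasDerivAt_p t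
    · simpa [planarCurve] using hasDerivAt_const t (0 : ℝ)
    · simpa [planarCurve] using hs.hasDerivAt_r t
    · simpa [planarCurve] using hasDerivAt_const t (0 : ℝ)
  planar t := by simp [planarCurve]
  confined t := by simpa [planarCurve] using hs.mem t
  energy t := by
    rw [reducedHam_planar (by simpa [planarCurve] using hs.toIsPlanarSol.r_pos S t)
      (by simp [planarCurve]) (by simp [planarCurve])]
    simpa [planarCurve] using hs.energy t
  period_pos := by linarith [ht₁.pos]
  periodic t := by
    obtain ⟨h1, h2⟩ := hs.periodic hε S ht₁ t
    rw [planarCurve, h1, h2, planarCurve]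
  minimal T hT hper := hs.period_le hε S ht₁ hT fun t => by
    simpa [planarCurve] using congrFun (hper t) (Sum.inl 0)

theorem IsPlanarOrbit.isPlanarSol (hε : IsSmall ω h a b C ε) (S : KeplerPert f ω h a b C)
    (hξ : IsPlanarOrbit (reducedHam f ω ε) h a b ξ T) :
    IsPlanarSol f ω h a b ε (fun t => ξ t (Sum.inl 0)) (fun t => ξ t (Sum.inr 0)) := by
  have hd := fun t => hasDerivAt_pi.1 (hξ.solution t)
  simp only [fun t => hamVectorField_planar (ω := ω) S.sym (S.pos_of_mem (hξ.confined t))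
    (hξ.planar t).1 (hξ.planar t).2 hε.mem_Ico] at hd
  refine ⟨fun t => by simpa using hd t (Sum.inl 0), fun t => by simpa using hd t (Sum.inr 0),
    hξ.confined, fun t => ?_⟩
  rw [← reducedHam_planar (S.pos_of_mem (hξ.confined t)) (hξ.planar t).1 (hξ.planar t).2]
  exact hξ.energy t

/-- Every planar periodic orbit is a time translate of the pericentric one. -/
theorem IsPlanarOrbit.eq_translate (hε : IsSmall ω h a b C ε) (S : KeplerPert f ω h a b C)
    (hξ : IsPlanarOrbit (reducedHam f ω ε) h a b ξ T) (hs : IsPericentric f ω h a b ε p r)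
    (ht₁ : IsHalfPeriod ω p r t₁) :
    T = 2 * t₁ ∧ ∃ s, ∀ t, ξ t = planarCurve p r (t + s) := by
  have hsol := hξ.isPlanarSol hε S
  obtain ⟨s, hper⟩ := hsol.exists_isPericentric hξ.period_pos fun t => by rw [hξ.periodic]
  obtain ⟨hp, hr⟩ := hs.unique hε S hper
  have hp' : ∀ t, ξ t (Sum.inl 0) = p (t + -s) := fun t => by simp [hp]
  have hr' : ∀ t, ξ t (Sum.inr 0) = r (t + -s) := fun t => by simp [hr]
  have htr : ∀ t, ξ t = planarCurve p r (t + -s) := by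
    intro t
    funext i
    rcases i with i | i <;> fin_cases i
    · simpa [planarCurve] using hp' t
    · simpa [planarCurve] using (hξ.planar t).1
    · simpa [planarCurve] using hr' t
    · simpa [planarCurve] using (hξ.planar t).2
  refine ⟨le_antisymm ?_ ?_, -s, htr⟩
  · refine hξ.minimal _ (by linarith [ht₁.pos]) fun t => ?_
    obtain ⟨h1, h2⟩ := hs.periodic hε S ht₁ (t + -s)
    rw [htr, htr, planarCurve, planarCurve, ← h1, ← h2,
      show t + 2 * t₁ + -s = t + -s + 2 * t₁ by ring]
  · refine hs.period_le hε S ht₁ hξ.period_pos fun t => ?_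
    have h1 := congrFun (hξ.periodic (t + s)) (Sum.inl 0)
    rw [hp', hp'] at h1
    rwa [show t + s + T + -s = t + T by ring, show t + s + -s = t by ring] at h1

theorem angularPeriod_eq (hε : IsSmall ω h a b C ε) (S : KeplerPert f ω h a b C)
    (hs : IsPericentric f ω h a b ε p r) (ht₁ : IsHalfPeriod ω p r t₁) {s : ℝ}
    (hξ : ∀ t, ξ t = planarCurve p r (t + s)) :
    angularPeriod ω ξ (2 * t₁) = clock ω r (2 * t₁) := by
  have h1 : angularPeriod ω ξ (2 * t₁) = clock ω (fun t => r (t + s)) (2 * t₁) := by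
    simp only [angularPeriod, clock, hξ]
    simp [planarCurve]
  have h2 := hs.toIsPlanarSol.clock_add S s (2 * t₁)
  rw [add_comm (2 * t₁) s, hs.clock_add_period hε S ht₁] at h2
  linarith

end orbit

theorem Complex.div_mem_slitPlane {z w : ℂ}
    (h : 0 < z.im * w.im ∨ z.im = 0 ∧ w.im = 0 ∧ 0 < z.re * w.re) : z / w ∈ Complex.slitPlane := by
  have hw : w ≠ 0 := by
    rintro rfl
    simp at h
  rw [Complex.mem_slitPlane_iff]
  by_contra! hcon
  have hz : z = (((z / w).re : ℝ) : ℂ) * w := by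
    rw [show (((z / w).re : ℝ) : ℂ) = z / w from Complex.ext (by simp) (by simp [hcon.2]),
      div_mul_cancel₀ _ hw]
  have hre : z.re = (z / w).re * w.re := by
    conv_lhs => rw [hz]
    simp
  have him : z.im = (z / w).re * w.im := by
    conv_lhs => rw [hz]
    simp
  rcases h with h | ⟨-, -, h⟩
  · rw [him] at h
    nlinarith [mul_nonneg (neg_nonneg.2 hcon.1) (sq_nonneg w.im)]
  · rw [hre] at h
    nlinarith [mul_nonneg (neg_nonneg.2 hcon.1) (sq_nonneg w.re)]

theorem isAngleOn_exp (φ : ℝ → ℝ) {s : Set ℝ} (hφ : ContinuousOn φ s) :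
    IsAngleOn (fun t => Complex.exp (φ t * Complex.I)) φ s :=
  ⟨hφ, fun t _ => by rw [Complex.norm_exp_ofReal_mul_I, Complex.ofReal_one, one_mul]⟩

/-- The rotation of a solution of the Hill equation with potential `q`: in time `T` it turns by the
angle `2 π ρ` on average, from any initial time on. -/
def HasMeanRotation (q : ℝ → ℝ) (T ρ : ℝ) : Prop :=
  ∃ p z A : ℝ → ℝ, IsHill q p z ∧ (∀ t, (⟨p t, z t⟩ : ℂ) ≠ 0) ∧
    IsAngleOn (fun t => (⟨p t, z t⟩ : ℂ)) A univ ∧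
    ∀ s, Tendsto (fun m : ℕ => A (m * T + s) / m) atTop (𝓝 (ρ * (2 * Real.pi)))

theorem HasMeanRotation.comp_add {q : ℝ → ℝ} {T ρ : ℝ} (hq : HasMeanRotation q T ρ) (s : ℝ) :
    HasMeanRotation (fun t => q (t + s)) T ρ := by
  obtain ⟨p, z, A, h1, h2, h3, h4⟩ := hq
  refine ⟨fun t => p (t + s), fun t => z (t + s), fun t => A (t + s), fun t => ?_,
    fun t => h2 _, ⟨h3.1.comp (by fun_prop) fun _ _ => mem_univ _, fun t _ => h3.2 _ (mem_univ _)⟩,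
    fun s' => ?_⟩
  · exact ⟨(h1 (t + s)).1.comp_add_const t s, (h1 (t + s)).2.comp_add_const t s⟩
  · simpa only [add_assoc] using h4 (s' + s)

namespace IsPericentric
variable {f : EuclideanSpace ℝ (Fin 3) → ℝ → ℝ} {ω h a b C ε t₁ : ℝ} {p r : ℝ → ℝ}

theorem clock_period_pos (S : KeplerPert f ω h a b C) (hs : IsPericentric f ω h a b ε p r)
    (ht₁ : IsHalfPeriod ω p r t₁) : 0 < clock ω r (2 * t₁) := by
  have h1 : (0 : ℝ) < 2 * t₁ := by linarith [ht₁.pos]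
  simpa using hs.toIsPlanarSol.strictMono_clock S h1

/-- The vector tangent to the orbit has the same vertical direction as a vector that turns at
constant speed with respect to the clock. -/
theorem tangent_same_side (hε : IsSmall ω h a b C ε) (S : KeplerPert f ω h a b C)
    (hs : IsPericentric f ω h a b ε p r) (ht₁ : IsHalfPeriod ω p r t₁) (t : ℝ) :
    0 < p t * Real.sin (2 * Real.pi * (clock ω r t / clock ω r (2 * t₁))) ∨
      p t = 0 ∧ Real.sin (2 * Real.pi * (clock ω r t / clock ω r (2 * t₁))) = 0 ∧
      0 < -effV' f ω ε (r t) * Real.cos (2 * Real.pi * (clock ω r t / clock ω r (2 * t₁))) := by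
  have hP := hs.clock_period_pos S ht₁
  have hmono := hs.toIsPlanarSol.strictMono_clock S
  have hhalf := hs.clock_period hε S ht₁
  have hper := fun t => hs.periodic hε S ht₁ t
  have hclock := fun t => hs.clock_add_period hε S ht₁ t
  have hT : 0 < 2 * t₁ := by linarith [ht₁.pos]
  have hπ := Real.pi_pos
  set P := clock ω r (2 * t₁)
  -- reduction to one period
  let Good : ℝ → Prop := fun t => 0 < p t * Real.sin (2 * Real.pi * (clock ω r t / P)) ∨
      p t = 0 ∧ Real.sin (2 * Real.pi * (clock ω r t / P)) = 0 ∧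
      0 < -effV' f ω ε (r t) * Real.cos (2 * Real.pi * (clock ω r t / P))
  have hgood : Function.Periodic Good (2 * t₁) := by
    intro t
    simp only [Good]
    rw [(hper t).1, (hper t).2, hclock, show 2 * Real.pi * ((clock ω r t + P) / P) =
      2 * Real.pi * (clock ω r t / P) + 2 * Real.pi by field_simp, Real.sin_add_two_pi,
      Real.cos_add_two_pi]
  obtain ⟨y, hy, hyt⟩ := hgood.exists_mem_Ico₀ hT t
  change Good t
  rw [hyt]
  simp only [Good]
  have hV : ∀ t, p t = 0 → effV' f ω ε (r t) ≠ 0 := fun t ht =>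
    hε.effV'_ne_zero S (hs.mem t) (hs.effV_eq ht)
  rcases hy.1.eq_or_lt with h0 | h0
  · right
    rw [← h0, clock_zero]
    simp only [zero_div, mul_zero, Real.sin_zero, Real.cos_zero, mul_one]
    exact ⟨hs.p_zero, trivial, neg_pos.2 (hs.effV'_nonpos.lt_of_ne (hV 0 hs.p_zero))⟩
  have hpos : 0 < clock ω r y := by simpa using hmono h0
  have hφpos : 0 < 2 * Real.pi * (clock ω r y / P) := by positivity
  rcases lt_trichotomy y t₁ with h1 | h1 | h1
  · left
    refine mul_pos (ht₁.p_pos y ⟨h0, h1⟩) (Real.sin_pos_of_pos_of_lt_pi hφpos ?_)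
    have h2 := hmono h1
    rw [mul_div_assoc', div_lt_iff₀ hP]
    nlinarith
  · right
    have h2 : 2 * Real.pi * (clock ω r y / P) = Real.pi := by
      have h3 : 0 < clock ω r t₁ := h1 ▸ hpos
      rw [h1, hhalf]
      field_simp
    rw [h2, Real.sin_pi, Real.cos_pi, h1]
    refine ⟨ht₁.p_eq, rfl, ?_⟩
    -- at the apocentre the force points inwards, as `p` changes from positive to negative
    have h3 : 0 ≤ effV' f ω ε (r t₁) := by
      by_contra! hcon
      have h4 : ∀ᶠ t in 𝓝[>] t₁, 0 < p t := by
        have h5 := (hasDerivAt_iff_tendsto_slope.1 (hs.hasDerivAt_p t₁)).eventually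
          (lt_mem_nhds (by linarith : 0 < -effV' f ω ε (r t₁)))
        have h6 : 𝓝[>] t₁ ≤ 𝓝[≠] t₁ := nhdsWithin_mono _ fun x hx => ne_of_gt hx
        filter_upwards [h5.filter_mono h6, self_mem_nhdsWithin] with t ht hts
        rw [slope_def_field, ht₁.p_eq, sub_zero] at ht
        exact (div_pos_iff_of_pos_right (sub_pos.2 hts)).1 ht
      have h7 : ∀ᶠ t in 𝓝[>] t₁, t ∈ Ioo t₁ (2 * t₁) :=
        Ioo_mem_nhdsGT (by linarith [ht₁.pos])
      obtain ⟨t, ht, htm⟩ := (h4.and h7).exists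
      linarith [hs.p_neg hε S ht₁ htm]
    have := h3.lt_of_ne (hV t₁ ht₁.p_eq).symm
    linarith
  · left
    refine mul_pos_of_neg_of_neg (hs.p_neg hε S ht₁ ⟨h1, hy.2⟩) ?_
    rw [← Real.sin_sub_two_pi]
    refine Real.sin_neg_of_neg_of_neg_pi_lt ?_ ?_
    · have h2 := hmono hy.2
      have h3 : clock ω r y / P < 1 := (div_lt_one hP).2 h2
      nlinarith
    · have h2 := hmono h1
      have h3 : 1 / 2 < clock ω r y / P := by
        rw [div_lt_div_iff₀ two_pos hP]
        linarith
      nlinarith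

/-- The planar part of the linearized equation turns exactly once per period, as it has the tangent
vector of the orbit as a solution. -/
theorem hasMeanRotation_planar (hε : IsSmall ω h a b C ε) (S : KeplerPert f ω h a b C)
    (hs : IsPericentric f ω h a b ε p r) (ht₁ : IsHalfPeriod ω p r t₁) :
    HasMeanRotation (fun t => effV'' f ω ε (r t)) (2 * t₁) 1 := by
  set φ : ℝ → ℝ := fun t => 2 * Real.pi * (clock ω r t / clock ω r (2 * t₁)) with hφ
  have hφc : Continuous φ :=
    continuous_const.mul ((hs.toIsPlanarSol.continuous_clock S).div_const _)
  have hd : ∀ t, HasDerivAt (fun t => -effV' f ω ε (r t)) (-(effV'' f ω ε (r t) * p t)) t :=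
    fun t => ((hasDerivAt_effV' S.sym.smoothPert (hs.toIsPlanarSol.r_pos S t) hε.mem_Ico).comp t
      (hs.hasDerivAt_r t)).neg
  have hzc : Continuous fun t => (⟨-effV' f ω ε (r t), p t⟩ : ℂ) := by
    have h1 : Continuous fun t => -effV' f ω ε (r t) :=
      continuous_iff_continuousAt.2 fun t => (hd t).continuousAt
    exact Complex.equivRealProdCLM.symm.continuous.comp (h1.prodMk hs.continuous_p)
  have hwc : Continuous fun t => Complex.exp (φ t * Complex.I) := by fun_prop
  have hangle := (isAngleOn_exp φ (s := univ) hφc.continuousOn).of_slitPlane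
    hwc.continuousOn hzc.continuousOn fun t _ => Complex.div_mem_slitPlane (by
      rw [Complex.exp_ofReal_mul_I_im, Complex.exp_ofReal_mul_I_re]
      exact hs.tangent_same_side hε S ht₁ t)
  refine ⟨_, p, _, fun t => ⟨hd t, hs.hasDerivAt_p t⟩, fun t h0 => ?_, hangle, fun s => ?_⟩
  · have h1 := congrArg Complex.re h0
    have h2 := congrArg Complex.im h0
    simp only [Complex.zero_re, Complex.zero_im, neg_eq_zero] at h1 h2
    exact hε.effV'_ne_zero S (hs.mem t) (hs.effV_eq h2) h1
  · refine tendsto_div_of_abs_sub_le (C := Real.pi + |φ s|) (v := fun m => m * (1 * (2 * Real.pi)))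
      (fun m => ?_) ?_
    · have h1 : φ (m * (2 * t₁) + s) = m * (1 * (2 * Real.pi)) + φ s := by
        have hP := hs.clock_period_pos S ht₁
        simp only [hφ]
        rw [add_comm _ s, hs.clock_add_nat_mul_period hε S ht₁]
        field_simp
        ring
      rw [h1, show ∀ x y z : ℝ, x + y + z - x = z + y by intros; ring]
      exact (abs_add_le _ _).trans (by gcongr; exact Complex.abs_arg_le_pi _)
    · refine tendsto_const_nhds.congr' ?_
      filter_upwards [eventually_gt_atTop 0] with m hm
      field_simp

end IsPericentric

/-! ### The transversal part of the linearized equation -/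

/-- The normalized second derivative of the perturbation in the latitude: if `z` is a transversal
variation along a planar motion, then `u = z / r` solves `u'' + (1 + ε transK) u = 0` with respect
to the clock. -/
noncomputable def transK (f : EuclideanSpace ℝ (Fin 3) → ℝ → ℝ) (ω ε r : ℝ) : ℝ :=
  r ^ 2 * (r ^ 2 * vertDD f r ε - r * radD f r ε) / ω ^ 2

/-- The bound for `transK` on the annulus. -/
noncomputable def transBound (ω b C : ℝ) : ℝ := b ^ 2 * (b ^ 2 * C + b * C) / ω ^ 2

/-- `A` is the angle of the vector `(u', u)` for a transversal variation `z`, where `u = z / r` and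
the derivative is taken with respect to the clock. -/
def IsTransAngle (f : EuclideanSpace ℝ (Fin 3) → ℝ → ℝ) (ω ε : ℝ) (r A : ℝ → ℝ) : Prop :=
  ∀ t, HasDerivAt A (|ω| / r t ^ 2 * (1 + ε * (transK f ω ε (r t) * Real.sin (A t) ^ 2))) t

section transversal
variable {f : EuclideanSpace ℝ (Fin 3) → ℝ → ℝ} {ω h a b C ε t₁ T : ℝ} {p r A A₁ : ℝ → ℝ}

theorem KeplerPert.transBound_nonneg (S : KeplerPert f ω h a b C) : 0 ≤ transBound ω b C := by
  have := S.b_pos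
  have := S.C_pos
  rw [transBound]
  positivity

theorem IsSmall.abs_transK_le (hε : IsSmall ω h a b C ε) (S : KeplerPert f ω h a b C) {r : ℝ}
    (hr : r ∈ Icc a b) : |transK f ω ε r| ≤ transBound ω b C := by
  have hr0 := S.pos_of_mem hr
  have hrb := hr.2
  have h1 := S.vertDD_le r hr ε hε.mem_Icc
  have h2 := S.radD_le r hr ε hε.mem_Icc
  have := S.C_pos
  have := S.b_pos
  rw [transK, transBound, abs_div, abs_mul, abs_of_nonneg (sq_nonneg ω),
    abs_of_nonneg (sq_nonneg r)]
  gcongr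
  refine (abs_sub _ _).trans ?_
  rw [abs_mul, abs_mul, abs_of_pos hr0, abs_of_nonneg (sq_nonneg r)]
  gcongr

theorem KeplerPert.continuousOn_transK (S : KeplerPert f ω h a b C) :
    ContinuousOn (fun x : ℝ × ℝ => transK f ω x.2 x.1) (Icc a b ×ˢ Icc (0 : ℝ) (1 / 2)) := by
  have hsub : Icc a b ×ˢ Icc (0 : ℝ) (1 / 2) ⊆ Ioi 0 ×ˢ Ico (0 : ℝ) 1 := fun x hx =>
    ⟨S.pos_of_mem hx.1, hx.2.1, hx.2.2.trans_lt (by norm_num)⟩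
  have hs := S.sym.smoothPert
  have h1 : ContinuousOn (fun x : ℝ × ℝ => vertDD f x.1 x.2) _ :=
    ((hs.dirD eZ).dirD eZ).continuousOn_plane.mono hsub
  have h2 : ContinuousOn (fun x : ℝ × ℝ => radD f x.1 x.2) _ :=
    (hs.dirD eR).continuousOn_plane.mono hsub
  unfold transK
  fun_prop

theorem IsPlanarSol.continuous_transK (hε : IsSmall ω h a b C ε) (S : KeplerPert f ω h a b C)
    (hs : IsPlanarSol f ω h a b ε p r) : Continuous fun t => transK f ω ε (r t) :=
  S.continuousOn_transK.comp_continuous (hs.continuous_r.prodMk continuous_const)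
    fun t => ⟨hs.mem t, hε.mem_Icc⟩

theorem abs_sin_sq_sub_le (x y : ℝ) : |Real.sin x ^ 2 - Real.sin y ^ 2| ≤ 2 * |x - y| := by
  have h1 : |Real.sin x - Real.sin y| ≤ |x - y| := by
    have := Real.lipschitzWith_sin.dist_le_mul x y
    simpa [Real.dist_eq] using this
  have h2 : |Real.sin x + Real.sin y| ≤ 2 := (abs_add_le _ _).trans (by
    linarith [Real.abs_sin_le_one x, Real.abs_sin_le_one y])
  rw [sq_sub_sq, abs_mul]
  exact mul_le_mul h2 h1 (abs_nonneg _) zero_le_two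

/-- The equation for the angle is Lipschitz. -/
theorem IsPlanarSol.lipschitz_transAngle (hε : IsSmall ω h a b C ε) (S : KeplerPert f ω h a b C)
    (hs : IsPlanarSol f ω h a b ε p r) (t : ℝ) :
    LipschitzWith (Real.toNNReal (2 * (|ω| / a ^ 2 * transBound ω b C)))
      fun A => |ω| / r t ^ 2 * (1 + ε * (transK f ω ε (r t) * Real.sin A ^ 2)) := by
  have hB := S.transBound_nonneg
  have ha := S.a_pos
  refine LipschitzWith.of_dist_le_mul fun x y => ?_
  rw [Real.coe_toNNReal _ (by positivity), Real.dist_eq, Real.dist_eq,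
    show |ω| / r t ^ 2 * (1 + ε * (transK f ω ε (r t) * Real.sin x ^ 2)) -
      |ω| / r t ^ 2 * (1 + ε * (transK f ω ε (r t) * Real.sin y ^ 2)) =
      |ω| / r t ^ 2 * (ε * (transK f ω ε (r t) * (Real.sin x ^ 2 - Real.sin y ^ 2))) by ring,
    abs_mul, abs_mul, abs_mul, abs_of_pos (hs.rate_pos S t), abs_of_nonneg hε.nonneg]
  calc |ω| / r t ^ 2 * (ε * (|transK f ω ε (r t)| * |Real.sin x ^ 2 - Real.sin y ^ 2|))
      ≤ |ω| / a ^ 2 * (1 * (transBound ω b C * (2 * |x - y|))) := by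
        have h1 := hs.rate_le S t
        have h2 := hε.abs_transK_le S (hs.mem t)
        have h3 := abs_sin_sq_sub_le x y
        have h4 : ε ≤ 1 := hε.le_half.trans (by norm_num)
        have h5 := hε.nonneg
        gcongr
    _ = _ := by ring

theorem IsPlanarSol.abs_transAngle_sub_le (hε : IsSmall ω h a b C ε) (S : KeplerPert f ω h a b C)
    (hs : IsPlanarSol f ω h a b ε p r) (t x : ℝ) :
    |ε * (transK f ω ε (r t) * Real.sin x ^ 2)| ≤ ε * transBound ω b C := by
  rw [abs_mul, abs_mul, abs_of_nonneg hε.nonneg]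
  have h2 := hε.abs_transK_le S (hs.mem t)
  have h3 : |Real.sin x ^ 2| ≤ 1 := by
    rw [abs_of_nonneg (sq_nonneg _)]
    exact Real.sin_sq_le_one x
  have h5 := hε.nonneg
  calc ε * (|transK f ω ε (r t)| * |Real.sin x ^ 2|) ≤ ε * (transBound ω b C * 1) := by
        have := S.transBound_nonneg
        gcongr
    _ = _ := by ring

theorem IsPlanarSol.exists_isTransAngle (hε : IsSmall ω h a b C ε) (S : KeplerPert f ω h a b C)
    (hs : IsPlanarSol f ω h a b ε p r) (x : ℝ) : ∃ A, A 0 = x ∧ IsTransAngle f ω ε r A := by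
  refine exists_global_solution (B := |ω| / a ^ 2 * (1 + ε * transBound ω b C))
    (hs.lipschitz_transAngle hε S) (fun x => ?_) (fun t x => ?_) x
  · exact (hs.continuous_rate S).mul (continuous_const.add (continuous_const.mul
      ((hs.continuous_transK hε S).mul continuous_const)))
  · rw [Real.norm_eq_abs, abs_mul, abs_of_pos (hs.rate_pos S t)]
    have h1 := hs.rate_le S t
    have ha := S.a_pos
    gcongr
    refine (abs_add_le _ _).trans ?_
    rw [abs_one]
    linarith [hs.abs_transAngle_sub_le hε S t x]

namespace IsTransAngle

theorem continuous (hA : IsTransAngle f ω ε r A) : Continuous A :=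
  continuous_iff_continuousAt.2 fun t => (hA t).continuousAt

theorem unique (hε : IsSmall ω h a b C ε) (S : KeplerPert f ω h a b C)
    (hs : IsPlanarSol f ω h a b ε p r) (hA : IsTransAngle f ω ε r A)
    (hA₁ : IsTransAngle f ω ε r A₁) {t₀ : ℝ} (h0 : A t₀ = A₁ t₀) : A = A₁ :=
  ODE_solution_unique_univ (s := fun _ => univ)
    (fun t => (hs.lipschitz_transAngle hε S t).lipschitzOnWith) (fun t => ⟨hA t, mem_univ _⟩)
    (fun t => ⟨hA₁ t, mem_univ _⟩) h0

theorem monotone (hε : IsSmall ω h a b C ε) (S : KeplerPert f ω h a b C)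
    (hs : IsPlanarSol f ω h a b ε p r) (hA : IsTransAngle f ω ε r A)
    (hA₁ : IsTransAngle f ω ε r A₁) (h0 : A 0 ≤ A₁ 0) {t : ℝ} (ht : 0 ≤ t) : A t ≤ A₁ t := by
  by_contra! hcon
  obtain ⟨s, -, hs0⟩ := intermediate_value_Icc ht (hA.continuous.sub hA₁.continuous).continuousOn
    (show (0 : ℝ) ∈ Icc (A 0 - A₁ 0) (A t - A₁ t) from ⟨by linarith, by linarith⟩)
  have := congrFun (hA.unique hε S hs hA₁ (sub_eq_zero.1 hs0)) t
  linarith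

theorem add_two_pi (hA : IsTransAngle f ω ε r A) :
    IsTransAngle f ω ε r fun t => A t + 2 * Real.pi := fun t => by
  rw [Real.sin_add_two_pi]
  exact (hA t).add_const _

theorem comp_add_period (hA : IsTransAngle f ω ε r A) (hT : ∀ t, r (t + T) = r t) :
    IsTransAngle f ω ε r fun t => A (t + T) := fun t => by
  have h1 := (hA (t + T)).comp_add_const t T
  rwa [hT] at h1

/-- The angle follows the clock up to an error of the size of the perturbation. -/
theorem abs_sub_clock_le (hε : IsSmall ω h a b C ε) (S : KeplerPert f ω h a b C)
    (hs : IsPlanarSol f ω h a b ε p r) (hA : IsTransAngle f ω ε r A) {t : ℝ} (ht : 0 ≤ t) :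
    |A t - A 0 - clock ω r t| ≤ ε * transBound ω b C * clock ω r t := by
  have h1 := abs_sub_le_mul_sub_of_deriv (K := ε * transBound ω b C)
    (fun t => (hA t).sub (hs.hasDerivAt_clock S t)) (hs.hasDerivAt_clock S) (fun t => by
      rw [show |ω| / r t ^ 2 * (1 + ε * (transK f ω ε (r t) * Real.sin (A t) ^ 2)) -
        |ω| / r t ^ 2 = ε * (transK f ω ε (r t) * Real.sin (A t) ^ 2) * (|ω| / r t ^ 2) by ring,
        abs_mul, abs_of_pos (hs.rate_pos S t)]
      exact mul_le_mul_of_nonneg_right (hs.abs_transAngle_sub_le hε S t _) (hs.rate_pos S t).le) ht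
  simpa [sub_right_comm] using h1

/-- From an angle one recovers a solution of the transversal linearized equation, whose momentum
and position point to the same side as the vector with that angle. -/
theorem exists_isHill (hε : IsSmall ω h a b C ε) (S : KeplerPert f ω h a b C)
    (hs : IsPlanarSol f ω h a b ε p r) (hA : IsTransAngle f ω ε r A) :
    ∃ pz z : ℝ → ℝ, IsHill (fun t => vertQ f ε (r t)) pz z ∧ ∀ t,
      0 < z t * Real.sin (A t) ∨ z t = 0 ∧ Real.sin (A t) = 0 ∧ 0 < pz t * Real.cos (A t) := by
  set L' : ℝ → ℝ := fun t =>
    -(|ω| / r t ^ 2 * (ε * (transK f ω ε (r t) * (Real.sin (A t) * Real.cos (A t))))) with hL'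
  have hL'c : Continuous L' := by
    have h1 := hs.continuous_rate S
    have h2 := hs.continuous_transK hε S
    have h3 := hA.continuous
    simp only [hL']
    fun_prop
  set R : ℝ → ℝ := fun t => Real.exp (∫ s in (0 : ℝ)..t, L' s) with hR
  have hRpos : ∀ t, 0 < R t := fun t => Real.exp_pos _
  have hRd : ∀ t, HasDerivAt R (R t * L' t) t := fun t =>
    ((hL'c.integral_hasStrictDerivAt 0 t).hasDerivAt).exp
  have hω : 0 < |ω| := abs_pos.2 S.ω_ne
  have hω2 : ω ^ 2 = |ω| ^ 2 := (sq_abs ω).symm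
  refine ⟨fun t => |ω| * R t * Real.cos (A t) / r t + p t * (R t * Real.sin (A t)),
    fun t => r t * (R t * Real.sin (A t)), fun t => ⟨?_, ?_⟩, fun t => ?_⟩
  · have hr := hs.r_pos S t
    have h1 := (((hRd t).const_mul |ω|).mul (hA t).cos).div (hs.hasDerivAt_r t) hr.ne'
    have h2 := (hs.hasDerivAt_p t).mul ((hRd t).mul (hA t).sin)
    refine (h1.add h2).congr_deriv ?_
    have hsc := Real.sin_sq_add_cos_sq (A t)
    simp only [hL', Pi.mul_apply, transK, vertQ, effV', hω2]
    generalize Real.sin (A t) = s at *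
    generalize Real.cos (A t) = c at *
    have hω0 := hω.ne'
    linear_combination (norm := skip) (-(|ω| / r t * R t * (|ω| / r t ^ 2) * s * (ε *
      (r t ^ 2 * (r t ^ 2 * vertDD f (r t) ε - r t * radD f (r t) ε) / |ω| ^ 2)))) * hsc
    field_simp
    ring
  · have hr := hs.r_pos S t
    have h2 := (hs.hasDerivAt_r t).mul ((hRd t).mul (hA t).sin)
    refine h2.congr_deriv ?_
    have hsc := Real.sin_sq_add_cos_sq (A t)
    simp only [hL', Pi.mul_apply]
    generalize Real.sin (A t) = s at *
    generalize Real.cos (A t) = c at *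
    field_simp
    ring
  · have hr := hs.r_pos S t
    rcases eq_or_ne (Real.sin (A t)) 0 with h0 | h0
    · right
      refine ⟨by simp [h0], h0, ?_⟩
      have hc : Real.cos (A t) ≠ 0 := fun hc => by
        have := Real.sin_sq_add_cos_sq (A t)
        simp [h0, hc] at this
      have hR := hRpos t
      beta_reduce
      rw [h0, mul_zero, mul_zero, add_zero, show |ω| * R t * Real.cos (A t) / r t * Real.cos (A t) =
        |ω| * R t * Real.cos (A t) ^ 2 / r t by ring]
      positivity
    · left
      have hR := hRpos t
      beta_reduce
      rw [show r t * (R t * Real.sin (A t)) * Real.sin (A t) = r t * R t * Real.sin (A t) ^ 2 by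
        ring]
      positivity

end IsTransAngle

end transversal

section translation
variable {f : EuclideanSpace ℝ (Fin 3) → ℝ → ℝ} {ω h a b C ε t₁ T : ℝ} {p r A : ℝ → ℝ}

/-- The time `T` map of the equation for the transversal angle, in full turns. -/
theorem IsPlanarSol.exists_circleDeg1Lift (hε : IsSmall ω h a b C ε) (S : KeplerPert f ω h a b C)
    (hs : IsPlanarSol f ω h a b ε p r) (hT : 0 ≤ T) :
    ∃ F : CircleDeg1Lift, ∀ A, IsTransAngle f ω ε r A →
      F (A 0 / (2 * Real.pi)) = A T / (2 * Real.pi) := by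
  have hπ := Real.pi_pos
  choose Φ hΦ0 hΦ using hs.exists_isTransAngle hε S
  refine ⟨⟨⟨fun x => Φ (2 * Real.pi * x) T / (2 * Real.pi), fun x y hxy => ?_⟩, fun x => ?_⟩,
    fun A hA => ?_⟩
  · have h1 := (hΦ (2 * Real.pi * x)).monotone hε S hs (hΦ (2 * Real.pi * y))
      (by rw [hΦ0, hΦ0]; gcongr) hT
    exact div_le_div_of_nonneg_right h1 (by positivity)
  · have h1 := congrFun ((hΦ (2 * Real.pi * (x + 1))).unique hε S hs
      (hΦ (2 * Real.pi * x)).add_two_pi (t₀ := 0) (by rw [hΦ0, hΦ0]; ring)) T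
    simp only [h1]
    field_simp
  · have h1 := congrFun ((hΦ (2 * Real.pi * (A 0 / (2 * Real.pi)))).unique hε S hs hA (t₀ := 0)
      (by rw [hΦ0]; field_simp)) T
    exact congrArg (· / (2 * Real.pi)) h1

theorem IsTransAngle.pow_apply (hA : IsTransAngle f ω ε r A) {F : CircleDeg1Lift}
    (hF : ∀ A, IsTransAngle f ω ε r A → F (A 0 / (2 * Real.pi)) = A T / (2 * Real.pi))
    (hT : ∀ t, r (t + T) = r t) (m : ℕ) :
    (F ^ m) (A 0 / (2 * Real.pi)) = A (m * T) / (2 * Real.pi) := by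
  induction m generalizing A with
  | zero => simp
  | succ m ih =>
    have h1 := ih (hA.comp_add_period hT)
    simp only [zero_add] at h1
    rw [pow_succ, CircleDeg1Lift.mul_apply, hF A hA, h1,
      show (m : ℝ) * T + T = (m + 1 : ℕ) * T by push_cast; ring]

/-- The transversal part of the linearized equation turns on average by the translation number
of its circle map. -/
theorem IsPericentric.hasMeanRotation_transversal (hε : IsSmall ω h a b C ε)
    (S : KeplerPert f ω h a b C) (hs : IsPericentric f ω h a b ε p r)
    (ht₁ : IsHalfPeriod ω p r t₁) {F : CircleDeg1Lift}
    (hF : ∀ A, IsTransAngle f ω ε r A →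
      F (A 0 / (2 * Real.pi)) = A (2 * t₁) / (2 * Real.pi)) :
    HasMeanRotation (fun t => vertQ f ε (r t)) (2 * t₁) F.translationNumber := by
  have hπ := Real.pi_pos
  obtain ⟨A, hA0, hA⟩ := hs.toIsPlanarSol.exists_isTransAngle hε S 0
  obtain ⟨pz, z, hz, hside⟩ := hA.exists_isHill hε S hs.toIsPlanarSol
  have hpow := hA.pow_apply hF fun t => (hs.periodic hε S ht₁ t).2
  have hzc : Continuous fun t => (⟨pz t, z t⟩ : ℂ) := by
    have h1 : Continuous pz := continuous_iff_continuousAt.2 fun t => (hz t).1.continuousAt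
    have h2 : Continuous z := continuous_iff_continuousAt.2 fun t => (hz t).2.continuousAt
    exact Complex.equivRealProdCLM.symm.continuous.comp (h1.prodMk h2)
  have hAc := hA.continuous
  have hwc : Continuous fun t => Complex.exp (A t * Complex.I) := by fun_prop
  have hangle := (isAngleOn_exp A (s := univ) hAc.continuousOn).of_slitPlane
    hwc.continuousOn hzc.continuousOn fun t _ => Complex.div_mem_slitPlane (by
      rw [Complex.exp_ofReal_mul_I_im, Complex.exp_ofReal_mul_I_re]
      exact hside t)
  refine ⟨pz, z, _, hz, fun t h0 => ?_, hangle, fun s => ?_⟩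
  · have h1 := congrArg Complex.re h0
    have h2 := congrArg Complex.im h0
    simp only [Complex.zero_re, Complex.zero_im] at h1 h2
    have h3 := hside t
    rw [h1, h2] at h3
    simp at h3
  -- the speed of the angle is bounded, so that the initial time does not matter
  set B : ℝ := |ω| / a ^ 2 * (1 + ε * transBound ω b C) with hB
  have hlip : ∀ x y, |A x - A y| ≤ B * |x - y| := by
    intro x y
    have := Convex.norm_image_sub_le_of_norm_hasDerivWithin_le (C := B) (s := univ)
      (fun t _ => (hA t).hasDerivWithinAt) (fun t _ => ?_) convex_univ (mem_univ y) (mem_univ x)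
    · exact this
    · rw [Real.norm_eq_abs, abs_mul, abs_of_pos (hs.toIsPlanarSol.rate_pos S t)]
      have h1 := hs.toIsPlanarSol.rate_le S t
      have ha := S.a_pos
      rw [hB]
      gcongr
      refine (abs_add_le _ _).trans ?_
      rw [abs_one]
      linarith [hs.toIsPlanarSol.abs_transAngle_sub_le hε S t (A t)]
  refine tendsto_div_of_abs_sub_le (C := B * |s| + Real.pi) (v := fun m => A (m * (2 * t₁)))
    (fun m => ?_) ?_
  · rw [add_sub_right_comm]
    refine (abs_add_le _ _).trans (add_le_add ?_ (Complex.abs_arg_le_pi _))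
    simpa using hlip (m * (2 * t₁) + s) (m * (2 * t₁))
  · have h1 := (F.tendsto_translationNumber (A 0 / (2 * Real.pi))).mul_const (2 * Real.pi)
    refine h1.congr fun m => ?_
    rw [hpow, hA0]
    field_simp
    simp

end translation

/-! ### Translation numbers of circle maps close to a rotation by a full turn -/

/-- A change of coordinate at bounded distance from the identity in which the map is close to a
translation computes the translation number. -/
theorem CircleDeg1Lift.abs_translationNumber_sub_le (F : CircleDeg1Lift) {H : ℝ → ℝ} {B z δ : ℝ}
    (hB : ∀ x, |H x - x| ≤ B)
    (hF : ∀ x, |H (2 * Real.pi * F (x / (2 * Real.pi))) - H x - z| ≤ δ) :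
    |F.translationNumber - z / (2 * Real.pi)| ≤ δ / (2 * Real.pi) := by
  have hπ : 0 < 2 * Real.pi := by positivity
  have hn : ∀ n : ℕ, |H (2 * Real.pi * (F ^ n) 0) - H 0 - n * z| ≤ n * δ := by
    intro n
    induction n with
    | zero => simp
    | succ n ih =>
      have h1 := hF (2 * Real.pi * (F ^ n) 0)
      rw [mul_div_cancel_left₀ _ hπ.ne', ← CircleDeg1Lift.mul_apply, ← pow_succ'] at h1
      have h2 := (abs_add_le _ _).trans (add_le_add h1 ih)
      push_cast
      refine le_trans (le_of_eq ?_) (h2.trans (le_of_eq (by ring)))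
      congr 1
      ring
  have hlim := ((F.tendsto_translationNumber 0).sub_const (z / (2 * Real.pi))).abs
  have hlim' : Tendsto (fun n : ℕ => δ / (2 * Real.pi) + B / Real.pi / n) atTop
      (𝓝 (δ / (2 * Real.pi) + 0)) :=
    tendsto_const_nhds.add (tendsto_const_div_atTop_nhds_zero_nat _)
  rw [add_zero] at hlim'
  refine le_of_tendsto_of_tendsto hlim hlim' ?_
  filter_upwards [eventually_gt_atTop 0] with n hn0
  have hn0' : (0 : ℝ) < n := by exact_mod_cast hn0
  have h3 : |2 * Real.pi * (F ^ n) 0 - n * z| ≤ n * δ + 2 * B := by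
    have h4 := abs_le.1 (hn n)
    have h5 := abs_le.1 (hB (2 * Real.pi * (F ^ n) 0))
    have h6 := abs_le.1 (hB 0)
    rw [abs_le]
    constructor <;> linarith
  have h7 : ((F ^ n) 0 - 0) / n - z / (2 * Real.pi) =
      (2 * Real.pi * (F ^ n) 0 - n * z) / (n * (2 * Real.pi)) := by
    field_simp
    ring
  rw [h7, abs_div, abs_of_pos (by positivity : 0 < n * (2 * Real.pi)), div_le_iff₀ (by positivity)]
  refine h3.trans (le_of_eq ?_)
  field_simp

/-- The lift of the projective action of `diag(1, s)` to angles. -/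
noncomputable def stretch (s α : ℝ) : ℝ :=
  α + Real.arctan ((s - 1) * (Real.sin α * Real.cos α) / (Real.cos α ^ 2 + s * Real.sin α ^ 2))

section stretch
variable {s : ℝ}

theorem cos_sq_add_mul_sin_sq_pos (hs : 0 < s) (α : ℝ) :
    0 < Real.cos α ^ 2 + s * Real.sin α ^ 2 := by
  have h1 := Real.sin_sq_add_cos_sq α
  rcases (sq_nonneg (Real.sin α)).eq_or_lt with h2 | h2
  · rw [← h2] at h1 ⊢
    linarith
  · have := mul_pos hs h2
    have := sq_nonneg (Real.cos α)
    linarith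

theorem hasDerivAt_stretch (hs : 0 < s) (α : ℝ) :
    HasDerivAt (stretch s) (s / (Real.cos α ^ 2 + s ^ 2 * Real.sin α ^ 2)) α := by
  have hd := cos_sq_add_mul_sin_sq_pos hs α
  have hd2 := cos_sq_add_mul_sin_sq_pos (sq_pos_of_pos hs) α
  have h1 := (((Real.hasDerivAt_sin α).mul (Real.hasDerivAt_cos α)).const_mul (s - 1)).fun_div
    (((Real.hasDerivAt_cos α).pow 2).add (((Real.hasDerivAt_sin α).pow 2).const_mul s)) hd.ne'
  refine ((hasDerivAt_id' α).add h1.arctan).congr_deriv ?_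
  have hsc := Real.sin_sq_add_cos_sq α
  simp only [Pi.add_apply, Pi.pow_apply, Pi.mul_apply]
  generalize Real.sin α = S at *
  generalize Real.cos α = c at *
  have h2 : (c ^ 2 + s * S ^ 2) ^ 2 + ((s - 1) * (S * c)) ^ 2 = c ^ 2 + s ^ 2 * S ^ 2 := by
    linear_combination (c ^ 2 + s ^ 2 * S ^ 2) * hsc
  have h3 : 1 + ((s - 1) * (S * c) / (c ^ 2 + s * S ^ 2)) ^ 2 =
      (c ^ 2 + s ^ 2 * S ^ 2) / (c ^ 2 + s * S ^ 2) ^ 2 := by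
    rw [← h2]
    field_simp
  rw [h3]
  have hdn := hd.ne'
  have hd2n := hd2.ne'
  field_simp
  push_cast
  linear_combination (s * S ^ 2 + s + s * c ^ 2 - c ^ 2 - s ^ 2 * S ^ 2) * hsc

theorem stretch_add_two_pi (s α : ℝ) :
    stretch s (α + 2 * Real.pi) = stretch s α + 2 * Real.pi := by
  rw [stretch, stretch, Real.sin_add_two_pi, Real.cos_add_two_pi]
  ring

theorem abs_stretch_sub_le (s α : ℝ) : |stretch s α - α| ≤ Real.pi / 2 := by
  rw [stretch, add_sub_cancel_left, abs_le]
  exact ⟨(Real.neg_pi_div_two_lt_arctan _).le, (Real.arctan_lt_pi_div_two _).le⟩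

theorem deriv_stretch_le (hs : 0 < s) (α : ℝ) :
    |s / (Real.cos α ^ 2 + s ^ 2 * Real.sin α ^ 2)| ≤ s + 1 / s := by
  have hd2 := cos_sq_add_mul_sin_sq_pos (sq_pos_of_pos hs) α
  have hsc := Real.sin_sq_add_cos_sq α
  rw [abs_of_pos (by positivity), div_le_iff₀ hd2]
  have h1 : (s + 1 / s) * (Real.cos α ^ 2 + s ^ 2 * Real.sin α ^ 2) =
      s * (Real.sin α ^ 2 + Real.cos α ^ 2) + Real.cos α ^ 2 / s + s ^ 3 * Real.sin α ^ 2 := by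
    field_simp
    ring
  rw [h1, hsc]
  have h2 : 0 ≤ Real.cos α ^ 2 / s := by positivity
  have h3 : 0 ≤ s ^ 3 * Real.sin α ^ 2 := by positivity
  linarith

/-- When `E ^ 2 ≥ K ^ 2`, a projective change of coordinate makes the vector field
`E - K cos 2α` as close as desired to a constant one. -/
theorem exists_stretch {E K : ℝ} (hD : 0 ≤ E ^ 2 - K ^ 2) {η : ℝ} (hη : 0 < η) :
    ∃ s, 0 < s ∧ ∀ α, |s / (Real.cos α ^ 2 + s ^ 2 * Real.sin α ^ 2) *
      (E - K * Real.cos (2 * α)) - Real.sign E * √(E ^ 2 - K ^ 2)| ≤ η := by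
  have hg : ∀ α, E - K * Real.cos (2 * α) =
      (E - K) * Real.cos α ^ 2 + (E + K) * Real.sin α ^ 2 := by
    intro α
    rw [Real.cos_two_mul, Real.sin_sq]
    ring
  simp only [hg]
  rcases hD.eq_or_lt with h0 | h0
  · -- the field has double zeros; away from them a strong stretch makes it small
    rw [← h0, Real.sqrt_zero, mul_zero]
    have h1 : E = K ∨ E = -K := sq_eq_sq_iff_eq_or_eq_neg.1 (by linarith)
    rcases h1 with h1 | h1
    · refine ⟨2 * |E| / η + 1, by positivity, fun α => ?_⟩
      set s := 2 * |E| / η + 1 with hs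
      have hs0 : 0 < s := by positivity
      have hd2 := cos_sq_add_mul_sin_sq_pos (sq_pos_of_pos hs0) α
      have h2 : 2 * |E| ≤ η * s := by
        rw [hs, mul_add, mul_div_cancel₀ _ hη.ne']
        linarith
      rw [← h1, sub_self, zero_mul, zero_add, sub_zero, div_mul_eq_mul_div, abs_div,
        abs_of_pos hd2, div_le_iff₀ hd2, ← two_mul, abs_mul, abs_mul, abs_mul, abs_of_pos hs0,
        abs_of_pos (two_pos : (0 : ℝ) < 2), abs_of_nonneg (sq_nonneg (Real.sin α))]
      have h3 : s * Real.sin α ^ 2 * (2 * |E|) ≤ s * Real.sin α ^ 2 * (η * s) := by gcongr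
      have h4 : 0 ≤ η * Real.cos α ^ 2 := by positivity
      linarith
    · refine ⟨η / (2 * |E| + 1), by positivity, fun α => ?_⟩
      set s := η / (2 * |E| + 1) with hs
      have hs0 : 0 < s := by positivity
      have hd2 := cos_sq_add_mul_sin_sq_pos (sq_pos_of_pos hs0) α
      have h2 : s * (2 * |E|) ≤ η := by
        rw [hs, div_mul_eq_mul_div, div_le_iff₀ (by positivity)]
        linarith
      have hK : K = -E := by linarith
      rw [hK, add_neg_cancel, zero_mul, add_zero, sub_zero, sub_neg_eq_add, div_mul_eq_mul_div,
        abs_div, abs_of_pos hd2, div_le_iff₀ hd2, ← two_mul, abs_mul, abs_mul, abs_mul,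
        abs_of_pos hs0, abs_of_pos (two_pos : (0 : ℝ) < 2), abs_of_nonneg (sq_nonneg (Real.cos α))]
      have h3 : s * (2 * |E|) * Real.cos α ^ 2 ≤ η * Real.cos α ^ 2 := by gcongr
      have h4 : 0 ≤ η * (s ^ 2 * Real.sin α ^ 2) := by positivity
      linarith
  · -- the field has no zeros, and it becomes constant for `s² = (E + K) / (E - K)`
    have hne : E - K ≠ 0 := fun h => by
      rw [sq_sub_sq, h, mul_zero] at h0
      exact lt_irrefl _ h0
    have hq : 0 < (E + K) / (E - K) := by
      rw [show (E + K) / (E - K) = (E ^ 2 - K ^ 2) / (E - K) ^ 2 by field_simp; ring]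
      positivity
    refine ⟨√((E + K) / (E - K)), Real.sqrt_pos.2 hq, fun α => ?_⟩
    set s := √((E + K) / (E - K)) with hs
    have hs0 : 0 < s := Real.sqrt_pos.2 hq
    have hs2 : s ^ 2 = (E + K) / (E - K) := Real.sq_sqrt hq.le
    have hd2 := cos_sq_add_mul_sin_sq_pos (sq_pos_of_pos hs0) α
    have h1 : s / (Real.cos α ^ 2 + s ^ 2 * Real.sin α ^ 2) *
        ((E - K) * Real.cos α ^ 2 + (E + K) * Real.sin α ^ 2) = s * (E - K) := by
      have h2 : (E - K) * Real.cos α ^ 2 + (E + K) * Real.sin α ^ 2 =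
          (E - K) * (Real.cos α ^ 2 + s ^ 2 * Real.sin α ^ 2) := by
        rw [hs2]
        field_simp
      rw [h2]
      field_simp
    have h3 : √(E ^ 2 - K ^ 2) = s * |E - K| := by
      rw [show E ^ 2 - K ^ 2 = (s * (E - K)) ^ 2 by rw [mul_pow, hs2]; field_simp; ring,
        Real.sqrt_sq_eq_abs, abs_mul, abs_of_pos hs0]
    have habs : |K| < |E| := sq_lt_sq.1 (by linarith)
    have h4 : Real.sign E * |E - K| = E - K := by
      have hK := abs_lt.1 habs
      rcases lt_trichotomy E 0 with hE | hE | hE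
      · rw [abs_of_neg hE] at hK
        rw [Real.sign_of_neg hE, abs_of_neg (by linarith)]
        ring
      · rw [hE] at habs
        simp at habs
        linarith [abs_nonneg K]
      · rw [abs_of_pos hE] at hK
        rw [Real.sign_of_pos hE, abs_of_pos (by linarith)]
        ring
    rw [h1, h3, mul_left_comm, h4, sub_self, abs_zero]
    exact hη.le

end stretch

/-- Averaging for circle maps close to the time `ε` map of the vector field `E - K cos 2α`: the
first order of the translation number is the rotation speed of that vector field, which is `0`
when the field has zeros. -/
theorem translationNumber_asymptotics {E K : ℝ} {𝓕 : ℝ → Set CircleDeg1Lift}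
    (h𝓕 : ∀ η > 0, ∀ᶠ ε in 𝓝[≥] (0 : ℝ), ∀ F ∈ 𝓕 ε, ∀ α,
      |2 * Real.pi * F (α / (2 * Real.pi)) - α - 2 * Real.pi - ε * (E - K * Real.cos (2 * α))| ≤
        η * ε) :
    ∀ η > 0, ∀ᶠ ε in 𝓝[≥] (0 : ℝ), ∀ F ∈ 𝓕 ε,
      |F.translationNumber - 1 - ε * ((if E ^ 2 - K ^ 2 < 0 then 0 else
        Real.sign E * √(E ^ 2 - K ^ 2)) / (2 * Real.pi))| ≤ η * ε := by
  have hπ : 0 < Real.pi := Real.pi_pos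
  intro η hη
  split_ifs with hD
  · -- the vector field has zeros, and the map has points that turn by at least, and by at most, `1`
    have habs : |E| < |K| := sq_lt_sq.1 (by linarith)
    have hup : ∃ α, 0 < E - K * Real.cos (2 * α) := by
      rcases le_or_gt 0 K with hK | hK
      · refine ⟨Real.pi / 2, ?_⟩
        rw [show 2 * (Real.pi / 2) = Real.pi by ring, Real.cos_pi]
        rw [abs_of_nonneg hK] at habs
        linarith [(abs_lt.1 habs).1]
      · refine ⟨0, ?_⟩
        rw [mul_zero, Real.cos_zero]
        rw [abs_of_neg hK] at habs
        linarith [(abs_lt.1 habs).1]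
    have hdown : ∃ α, E - K * Real.cos (2 * α) < 0 := by
      rcases le_or_gt 0 K with hK | hK
      · refine ⟨0, ?_⟩
        rw [mul_zero, Real.cos_zero]
        rw [abs_of_nonneg hK] at habs
        linarith [(abs_lt.1 habs).2]
      · refine ⟨Real.pi / 2, ?_⟩
        rw [show 2 * (Real.pi / 2) = Real.pi by ring, Real.cos_pi]
        rw [abs_of_neg hK] at habs
        linarith [(abs_lt.1 habs).2]
    obtain ⟨α, hα⟩ := hup
    obtain ⟨β, hβ⟩ := hdown
    filter_upwards [h𝓕 _ hα, h𝓕 _ (neg_pos.2 hβ), self_mem_nhdsWithin] with ε h1 h2 hε F hF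
    have h3 := (abs_le.1 (h1 F hF α)).1
    have h4 := (abs_le.1 (h2 F hF β)).2
    have h5 : ((1 : ℤ) : ℝ) ≤ F.translationNumber := by
      refine F.le_translationNumber_of_add_int_le (x := α / (2 * Real.pi)) ?_
      have h6 : α + 2 * Real.pi ≤ 2 * Real.pi * F (α / (2 * Real.pi)) := by linarith
      rw [Int.cast_one, div_add_one (by positivity), div_le_iff₀ (by positivity)]
      linarith
    have h7 : F.translationNumber ≤ ((1 : ℤ) : ℝ) := by
      refine F.translationNumber_le_of_le_add_int (x := β / (2 * Real.pi)) ?_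
      have h6 : 2 * Real.pi * F (β / (2 * Real.pi)) ≤ β + 2 * Real.pi := by linarith
      rw [Int.cast_one, div_add_one (by positivity), le_div_iff₀ (by positivity)]
      linarith
    rw [Int.cast_one] at h5 h7
    rw [le_antisymm h7 h5]
    simpa using mul_nonneg hη.le hε
  · -- in the coordinate `stretch s` the map is the translation by `2 π + ε c` up to `3 η ε`
    obtain ⟨s, hs, hsη⟩ := exists_stretch (not_lt.1 hD) hη
    set c := Real.sign E * √(E ^ 2 - K ^ 2)
    set M := s + 1 / s with hM
    have hM0 : 0 < M := by positivity
    set G := |E| + |K| + η / M with hG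
    have hev := eventually_mul_lt (M * (2 * |K| * G)) hη
    filter_upwards [h𝓕 _ (div_pos hη hM0), hev, self_mem_nhdsWithin] with ε h1 h2 hε0 F hF
    have hε : 0 ≤ ε := hε0
    have key : ∀ x, |stretch s (2 * Real.pi * F (x / (2 * Real.pi))) - stretch s x -
        (2 * Real.pi + ε * c)| ≤ 3 * η * ε := by
      intro x
      set d := 2 * Real.pi * F (x / (2 * Real.pi)) - x - 2 * Real.pi with hd
      have h3 : |d - ε * (E - K * Real.cos (2 * x))| ≤ η / M * ε := h1 F hF x
      have h4 : |E - K * Real.cos (2 * x)| ≤ |E| + |K| := by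
        refine (abs_sub _ _).trans ?_
        rw [abs_mul]
        have := mul_le_mul_of_nonneg_left (Real.abs_cos_le_one (2 * x)) (abs_nonneg K)
        linarith
      have h5 : |d| ≤ ε * G := by
        have h6 : |d| ≤ |d - ε * (E - K * Real.cos (2 * x))| +
            |ε * (E - K * Real.cos (2 * x))| := by
          simpa using abs_add_le (d - ε * (E - K * Real.cos (2 * x)))
            (ε * (E - K * Real.cos (2 * x)))
        rw [abs_mul, abs_of_nonneg hε] at h6
        have h7 := mul_le_mul_of_nonneg_left h4 hε
        rw [hG]
        linarith
      obtain ⟨ξ, hξ, hmvt⟩ : ∃ ξ, |ξ - x| ≤ |d| ∧ stretch s (x + d) - stretch s x =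
          s / (Real.cos ξ ^ 2 + s ^ 2 * Real.sin ξ ^ 2) * d := by
        have hcont : Continuous (stretch s) :=
          continuous_iff_continuousAt.2 fun x => (hasDerivAt_stretch hs x).continuousAt
        rcases lt_trichotomy d 0 with hd0 | hd0 | hd0
        · obtain ⟨ξ, hξ, h6⟩ := exists_hasDerivAt_eq_slope (stretch s) _
            (show x + d < x by linarith) hcont.continuousOn fun y _ => hasDerivAt_stretch hs y
          refine ⟨ξ, ?_, ?_⟩
          · rw [abs_of_neg hd0, abs_le]
            constructor <;> linarith [hξ.1, hξ.2]
          · have h8 : x - (x + d) ≠ 0 := by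
              rw [sub_add_cancel_left]
              exact neg_ne_zero.2 hd0.ne
            rw [h6, div_mul_eq_mul_div, eq_div_iff h8]
            ring
        · exact ⟨x, by simp, by simp [hd0]⟩
        · obtain ⟨ξ, hξ, h6⟩ := exists_hasDerivAt_eq_slope (stretch s) _
            (show x < x + d by linarith) hcont.continuousOn fun y _ => hasDerivAt_stretch hs y
          refine ⟨ξ, ?_, ?_⟩
          · rw [abs_of_pos hd0, abs_le]
            constructor <;> linarith [hξ.1, hξ.2]
          · rw [h6, add_sub_cancel_left, div_mul_cancel₀ _ hd0.ne']
      have h6 : 2 * Real.pi * F (x / (2 * Real.pi)) = x + d + 2 * Real.pi := by rw [hd]; ring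
      have hder := deriv_stretch_le hs ξ
      have hηξ := hsη ξ
      set D' := s / (Real.cos ξ ^ 2 + s ^ 2 * Real.sin ξ ^ 2)
      have h7 : |Real.cos (2 * ξ) - Real.cos (2 * x)| ≤ 2 * |d| := by
        have := Real.lipschitzWith_cos.dist_le_mul (2 * ξ) (2 * x)
        rw [Real.dist_eq, Real.dist_eq, ← mul_sub, abs_mul, NNReal.coe_one, one_mul, abs_two] at this
        linarith
      have h8 : |d - ε * (E - K * Real.cos (2 * ξ))| ≤ η / M * ε + ε * (|K| * (2 * (ε * G))) := by
        have h9 : |ε * (K * (Real.cos (2 * ξ) - Real.cos (2 * x)))| ≤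
            ε * (|K| * (2 * (ε * G))) := by
          rw [abs_mul, abs_mul, abs_of_nonneg hε]
          gcongr
          linarith
        calc |d - ε * (E - K * Real.cos (2 * ξ))| = |(d - ε * (E - K * Real.cos (2 * x))) +
              ε * (K * (Real.cos (2 * ξ) - Real.cos (2 * x)))| := by congr 1; ring
          _ ≤ _ := (abs_add_le _ _).trans (add_le_add h3 h9)
      rw [h6, stretch_add_two_pi, show stretch s (x + d) + 2 * Real.pi - stretch s x -
        (2 * Real.pi + ε * c) = stretch s (x + d) - stretch s x - ε * c by ring, hmvt,
        show D' * d - ε * c = D' * (d - ε * (E - K * Real.cos (2 * ξ))) +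
          ε * (D' * (E - K * Real.cos (2 * ξ)) - c) by ring]
      refine (abs_add_le _ _).trans ?_
      rw [abs_mul, abs_mul, abs_of_nonneg hε]
      have h9 : |D'| * |d - ε * (E - K * Real.cos (2 * ξ))| ≤
          M * (η / M * ε + ε * (|K| * (2 * (ε * G)))) := by gcongr
      have h10 : M * (η / M * ε + ε * (|K| * (2 * (ε * G)))) =
          η * ε + ε * (ε * (M * (2 * |K| * G))) := by
        field_simp
      have h11 := mul_le_mul_of_nonneg_left h2.le hε
      have h12 := mul_le_mul_of_nonneg_left hηξ hε
      linarith
    have h3 := F.abs_translationNumber_sub_le (abs_stretch_sub_le s) key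
    have h4 : (2 * Real.pi + ε * c) / (2 * Real.pi) = 1 + ε * (c / (2 * Real.pi)) := by
      field_simp
    rw [h4, ← sub_sub] at h3
    refine h3.trans ?_
    rw [div_le_iff₀ (by positivity)]
    have := mul_nonneg hη.le hε
    nlinarith [Real.pi_gt_three]

/-! ### Comparison with the Kepler ellipse -/

namespace KeplerPert
variable {f : EuclideanSpace ℝ (Fin 3) → ℝ → ℝ} {ω h a b C : ℝ}

theorem one_add_ecc_mul_cos_pos (S : KeplerPert f ω h a b C) (θ : ℝ) :
    0 < 1 + ecc ω h * Real.cos θ := by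
  have := S.ecc_pos
  have := S.ecc_lt_one
  nlinarith [Real.neg_one_le_cos θ]

theorem keplerRadius_mem (S : KeplerPert f ω h a b C) (θ : ℝ) :
    keplerRadius ω h θ ∈ Icc a b := by
  have he := S.ecc_pos
  have he1 := S.ecc_lt_one
  have hω := S.ω_sq_pos
  have h1 := S.one_add_ecc_mul_cos_pos θ
  constructor
  · refine S.lt_peri.le.trans ?_
    rw [keplerRadius]
    gcongr
    nlinarith [Real.cos_le_one θ]
  · refine le_trans ?_ S.apo_lt.le
    rw [keplerRadius]
    have : 0 < 1 - ecc ω h := by linarith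
    gcongr
    nlinarith [Real.neg_one_le_cos θ]

theorem continuous_keplerRadius (S : KeplerPert f ω h a b C) : Continuous (keplerRadius ω h) :=
  continuous_const.div (by fun_prop) fun θ => (S.one_add_ecc_mul_cos_pos θ).ne'

theorem inv_keplerRadius (S : KeplerPert f ω h a b C) (θ : ℝ) :
    1 / keplerRadius ω h θ = 1 / ω ^ 2 + ecc ω h / ω ^ 2 * Real.cos θ := by
  have := S.ω_ne
  have := (S.one_add_ecc_mul_cos_pos θ).ne'
  rw [keplerRadius]
  field_simp

end KeplerPert

namespace IsPericentric
variable {f : EuclideanSpace ℝ (Fin 3) → ℝ → ℝ} {ω h a b C ε t₁ : ℝ} {p r : ℝ → ℝ}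

theorem clock_period_lt (hε : IsSmall ω h a b C ε) (S : KeplerPert f ω h a b C)
    (hs : IsPericentric f ω h a b ε p r) (ht₁ : IsHalfPeriod ω p r t₁) :
    clock ω r (2 * t₁) < 10 := by
  have h1 := (abs_lt.1 (hs.abs_clock_period_sub_lt hε S ht₁)).2
  linarith [Real.pi_lt_d2]

theorem clock_mem (hε : IsSmall ω h a b C ε) (S : KeplerPert f ω h a b C)
    (hs : IsPericentric f ω h a b ε p r) (ht₁ : IsHalfPeriod ω p r t₁) {t : ℝ}
    (ht : t ∈ Icc 0 (2 * t₁)) : clock ω r t ∈ Icc 0 10 := by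
  have hmono := (hs.toIsPlanarSol.strictMono_clock S).monotone
  exact ⟨by simpa using hmono ht.1, (hmono ht.2).trans (hs.clock_period_lt hε S ht₁).le⟩

theorem abs_eccY_zero_sub_le (hε : IsSmall ω h a b C ε) (S : KeplerPert f ω h a b C)
    (hs : IsPericentric f ω h a b ε p r) :
    |eccY ω p r 0 - ecc ω h / ω ^ 2| ≤ ε * (2 * C / ecc ω h) := by
  have h1 := hε.abs_pericentre_sub_le S (hs.mem 0) (hs.effV_eq hs.p_zero) hs.effV'_nonpos
  have hω := S.ω_sq_pos
  have hr := hs.toIsPlanarSol.r_pos S 0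
  have hω0 := S.ω_ne
  have h2 : eccY ω p r 0 - ecc ω h / ω ^ 2 = (ω ^ 2 / r 0 - 1 - ecc ω h) / ω ^ 2 := by
    rw [eccY_zero]
    field_simp
  rw [h2, abs_div, abs_of_pos hω, div_le_iff₀ hω]
  refine h1.trans (le_of_eq ?_)
  ring

/-- Along a period the motion stays close to the Kepler ellipse. -/
theorem abs_sub_keplerRadius_le (hε : IsSmall ω h a b C ε) (S : KeplerPert f ω h a b C)
    (hs : IsPericentric f ω h a b ε p r) (ht₁ : IsHalfPeriod ω p r t₁) {t : ℝ}
    (ht : t ∈ Icc 0 (2 * t₁)) : |r t - keplerRadius ω h (clock ω r t)| ≤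
      ε * (b ^ 2 * (20 * (C * b ^ 2 / ω ^ 2) + 2 * C / ecc ω h)) := by
  have hc := hs.clock_mem hε S ht₁ ht
  have hε0 := hε.nonneg
  have hM : 0 ≤ C * b ^ 2 / ω ^ 2 := by
    have := S.C_pos
    positivity
  have hX := hs.abs_eccX_sub_le hε S ht.1
  have hY := hs.abs_eccY_sub_le hε S ht.1
  rw [hs.eccX_zero, sub_zero] at hX
  have h10 := mul_le_mul_of_nonneg_left hc.2 (mul_nonneg hε0 hM)
  have hY0 := hs.abs_eccY_zero_sub_le hε S
  set k := keplerRadius ω h (clock ω r t) with hk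
  have hkm : k ∈ Icc a b := S.keplerRadius_mem _
  have hk0 := S.pos_of_mem hkm
  have hr0 := hs.toIsPlanarSol.r_pos S t
  have hrm := hs.mem t
  have h1 : 1 / k - 1 / r t = -(eccX ω p r t * Real.sin (clock ω r t) +
      ((eccY ω p r t - eccY ω p r 0) + (eccY ω p r 0 - ecc ω h / ω ^ 2)) *
        Real.cos (clock ω r t)) := by
    rw [hk, S.inv_keplerRadius]
    linear_combination -(inv_sub_eq_eccX_eccY ω p r t)
  have h2 : |1 / k - 1 / r t| ≤ ε * (20 * (C * b ^ 2 / ω ^ 2) + 2 * C / ecc ω h) := by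
    rw [h1, abs_neg]
    refine (abs_add_le _ _).trans ?_
    rw [abs_mul, abs_mul]
    have h3 := mul_le_of_le_one_right (abs_nonneg (eccX ω p r t))
      (Real.abs_sin_le_one (clock ω r t))
    have h4 := mul_le_of_le_one_right
      (abs_nonneg (eccY ω p r t - eccY ω p r 0 + (eccY ω p r 0 - ecc ω h / ω ^ 2)))
      (Real.abs_cos_le_one (clock ω r t))
    have h5 := abs_add_le (eccY ω p r t - eccY ω p r 0) (eccY ω p r 0 - ecc ω h / ω ^ 2)
    linarith
  have h3 : r t - k = r t * k * (1 / k - 1 / r t) := by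
    field_simp
  rw [h3, abs_mul, abs_of_pos (by positivity)]
  have h4 : r t * k ≤ b ^ 2 := by
    rw [sq]
    exact mul_le_mul hrm.2 hkm.2 hk0.le S.b_pos.le
  calc r t * k * |1 / k - 1 / r t|
      ≤ b ^ 2 * (ε * (20 * (C * b ^ 2 / ω ^ 2) + 2 * C / ecc ω h)) := by gcongr
    _ = _ := by ring

theorem abs_clock_period_sub_le_sin (hε : IsSmall ω h a b C ε) (S : KeplerPert f ω h a b C)
    (hs : IsPericentric f ω h a b ε p r) (ht₁ : IsHalfPeriod ω p r t₁) :
    |clock ω r (2 * t₁) - 2 * Real.pi| ≤ 2 * |Real.sin (clock ω r (2 * t₁) - 2 * Real.pi)| := by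
  have h1 := hs.abs_clock_period_sub_lt hε S ht₁
  set x := clock ω r (2 * t₁) - 2 * Real.pi
  have h2 := Real.mul_abs_le_abs_sin h1.le
  have h3 : 1 / 2 * |x| ≤ 2 / Real.pi * |x| := by
    refine mul_le_mul_of_nonneg_right ?_ (abs_nonneg x)
    rw [div_le_div_iff₀ two_pos Real.pi_pos]
    linarith [Real.pi_lt_four]
  linarith

theorem abs_clock_period_sub_le (hε : IsSmall ω h a b C ε) (S : KeplerPert f ω h a b C)
    (hs : IsPericentric f ω h a b ε p r) (ht₁ : IsHalfPeriod ω p r t₁) :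
    |clock ω r (2 * t₁) - 2 * Real.pi| ≤
      ε * (20 * (C * b ^ 2 / ω ^ 2) / (40 * (ecc ω h / 80 / ω ^ 2))) := by
  have hκ : 0 < 40 * (ecc ω h / 80 / ω ^ 2) :=
    mul_pos (by norm_num) (div_pos (div_pos S.ecc_pos (by norm_num)) S.ω_sq_pos)
  have hM : 0 ≤ C * b ^ 2 / ω ^ 2 := by
    have := S.C_pos
    positivity
  have ht : (0 : ℝ) ≤ 2 * t₁ := by linarith [ht₁.pos]
  have h1 := hs.abs_eccX_sub_le hε S ht
  have h2 := mul_le_mul_of_nonneg_left (hs.clock_period_lt hε S ht₁).le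
    (mul_nonneg hε.nonneg hM)
  have h3 := hs.lt_eccY_zero hε S
  rw [hs.eccX_zero, sub_zero, (hs.eccX_period hε S ht₁).1, abs_mul,
    abs_of_pos (hκ.trans h3)] at h1
  have h4 := hs.abs_clock_period_sub_le_sin hε S ht₁
  rw [Real.sin_sub_two_pi] at h4
  rw [mul_div_assoc', le_div_iff₀ hκ]
  have h5 := mul_le_mul_of_nonneg_right h3.le (abs_nonneg (Real.sin (clock ω r (2 * t₁))))
  have h6 := mul_le_mul_of_nonneg_right h4 hκ.le
  linarith

end IsPericentric

/-! ### First order asymptotics by averaging over the Kepler ellipse -/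

section averaging
variable {f : EuclideanSpace ℝ (Fin 3) → ℝ → ℝ} {ω h a b C ε t₁ : ℝ} {p r : ℝ → ℝ}

theorem eventually_abs_sub_le_of_continuousOn {Ψ : ℝ × ℝ → ℝ}
    (hΨ : ContinuousOn Ψ (Icc a b ×ˢ Icc (0 : ℝ) (1 / 2))) (c : ℝ) {η : ℝ} (hη : 0 < η) :
    ∀ᶠ ε in 𝓝[≥] (0 : ℝ), ∀ r ∈ Icc a b, ∀ k ∈ Icc a b, |r - k| ≤ ε * c →
      |Ψ (r, ε) - Ψ (k, 0)| ≤ η := by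
  have hK : IsCompact (Icc a b ×ˢ Icc (0 : ℝ) (1 / 2)) := isCompact_Icc.prod isCompact_Icc
  obtain ⟨δ, hδ, hu⟩ := Metric.uniformContinuousOn_iff.1
    (hK.uniformContinuousOn_of_continuous hΨ) η hη
  filter_upwards [self_mem_nhdsWithin, eventually_mul_lt 1 hδ,
    eventually_mul_lt 1 (d := 1 / 2) (by norm_num), eventually_mul_lt c hδ] with
    ε h0 h1 h2 h3 r hr k hk hrk
  have hε : (0 : ℝ) ≤ ε := h0
  rw [mul_one] at h1 h2
  refine (hu (r, ε) ⟨hr, hε, h2.le⟩ (k, 0) ⟨hk, le_rfl, by norm_num⟩ ?_).le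
  rw [Prod.dist_eq, max_lt_iff, Real.dist_eq, Real.dist_eq, sub_zero, abs_of_nonneg hε]
  exact ⟨hrk.trans_lt h3, h1⟩

/-- Integrals along one period of the perturbed motion converge to integrals along the Kepler
ellipse, uniformly in a continuous weight `χ` bounded by `1`. -/
theorem KeplerPert.eventually_abs_integral_sub_le (S : KeplerPert f ω h a b C) {Ψ : ℝ × ℝ → ℝ}
    (hΨ : ContinuousOn Ψ (Icc a b ×ˢ Icc (0 : ℝ) (1 / 2))) (B : ℝ) {η : ℝ} (hη : 0 < η) :
    ∀ᶠ ε in 𝓝[≥] (0 : ℝ), ∀ p r t₁, IsPericentric f ω h a b ε p r → IsHalfPeriod ω p r t₁ →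
      ∀ c χ : ℝ → ℝ, Continuous c → Continuous χ → (∀ x, |χ x| ≤ 1) →
      (∀ t ∈ Icc 0 (2 * t₁), |c t - χ (clock ω r t)| ≤ ε * B) →
      |(∫ t in (0 : ℝ)..(2 * t₁), Ψ (r t, ε) * c t * (|ω| / r t ^ 2)) -
        ∫ θ in (0 : ℝ)..(2 * Real.pi), Ψ (keplerRadius ω h θ, 0) * χ θ| ≤ η := by
  have hK : IsCompact (Icc a b ×ˢ Icc (0 : ℝ) (1 / 2)) := isCompact_Icc.prod isCompact_Icc
  obtain ⟨M, hM⟩ := hK.exists_bound_of_continuousOn hΨ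
  have hM0 : 0 ≤ M := (norm_nonneg _).trans
    (hM (a, 0) ⟨⟨le_rfl, S.a_lt_b.le⟩, le_rfl, by norm_num⟩)
  filter_upwards [S.eventually_isSmall, eventually_abs_sub_le_of_continuousOn hΨ
    (b ^ 2 * (20 * (C * b ^ 2 / ω ^ 2) + 2 * C / ecc ω h)) (η := η / 40) (by positivity),
    eventually_mul_lt (M * B) (d := η / 40) (by positivity),
    eventually_mul_lt (M * (20 * (C * b ^ 2 / ω ^ 2) / (40 * (ecc ω h / 80 / ω ^ 2))))
      (half_pos hη)] with ε hε hclose hB hP p r t₁ hs ht₁ c χ hc hχ hχ1 hcχ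
  have hsol := hs.toIsPlanarSol
  have hT : 0 ≤ 2 * t₁ := by linarith [ht₁.pos]
  have hrate := hsol.continuous_rate S
  have hkc := S.continuous_keplerRadius
  have hΨr : Continuous fun t => Ψ (r t, ε) :=
    hΨ.comp_continuous (hsol.continuous_r.prodMk continuous_const) fun t =>
      ⟨hsol.mem t, hε.mem_Icc⟩
  have hΨ0 : Continuous fun θ => Ψ (keplerRadius ω h θ, 0) :=
    hΨ.comp_continuous (hkc.prodMk continuous_const) fun θ =>
      ⟨S.keplerRadius_mem θ, le_rfl, by norm_num⟩
  have hg : Continuous fun θ => Ψ (keplerRadius ω h θ, 0) * χ θ := hΨ0.mul hχ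
  have hgP := hg.comp (hsol.continuous_clock S)
  have hint := fun x y => hg.intervalIntegrable (μ := volume) x y
  have hsub : ∫ t in (0 : ℝ)..(2 * t₁),
      ((fun θ => Ψ (keplerRadius ω h θ, 0) * χ θ) ∘ clock ω r) t * (|ω| / r t ^ 2) =
      ∫ θ in (0 : ℝ)..(clock ω r (2 * t₁)), Ψ (keplerRadius ω h θ, 0) * χ θ := by
    rw [intervalIntegral.integral_comp_mul_deriv (fun t _ => hsol.hasDerivAt_clock S t)
      hrate.continuousOn hg, clock_zero]
  have h1 : |(∫ t in (0 : ℝ)..(2 * t₁), Ψ (r t, ε) * c t * (|ω| / r t ^ 2)) -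
      ∫ θ in (0 : ℝ)..(clock ω r (2 * t₁)), Ψ (keplerRadius ω h θ, 0) * χ θ| ≤ η / 2 := by
    have hi1 : Continuous fun t => Ψ (r t, ε) * c t * (|ω| / r t ^ 2) := (hΨr.mul hc).mul hrate
    have hi2 : Continuous fun t =>
        ((fun θ => Ψ (keplerRadius ω h θ, 0) * χ θ) ∘ clock ω r) t * (|ω| / r t ^ 2) :=
      hgP.mul hrate
    rw [← hsub, ← intervalIntegral.integral_sub (hi1.intervalIntegrable _ _)
      (hi2.intervalIntegrable _ _)]
    have h2 : ∫ t in (0 : ℝ)..(2 * t₁), η / 20 * (|ω| / r t ^ 2) ≤ η / 2 := by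
      rw [intervalIntegral.integral_const_mul]
      have := hs.clock_period_lt hε S ht₁
      rw [clock] at this
      nlinarith
    have hi3 : IntervalIntegrable (fun t => η / 20 * (|ω| / r t ^ 2)) volume 0 (2 * t₁) :=
      (continuous_const.mul hrate).intervalIntegrable _ _
    -- the angular period is less than `10`, so that it suffices to have the error `η / 20` pointwise
    suffices hb : ∀ t ∈ Ioc 0 (2 * t₁), ‖Ψ (r t, ε) * c t * (|ω| / r t ^ 2) -
        ((fun θ => Ψ (keplerRadius ω h θ, 0) * χ θ) ∘ clock ω r) t * (|ω| / r t ^ 2)‖ ≤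
        η / 20 * (|ω| / r t ^ 2) from
      (intervalIntegral.norm_integral_le_of_norm_le hT (Eventually.of_forall hb) hi3).trans h2
    intro t ht
    have htm : t ∈ Icc 0 (2 * t₁) := ⟨ht.1.le, ht.2⟩
    have h3 := hclose (r t) (hsol.mem t) _ (S.keplerRadius_mem (clock ω r t))
      (hs.abs_sub_keplerRadius_le hε S ht₁ htm)
    have h4 := hcχ t htm
    have h5 : |Ψ (r t, ε)| ≤ M := hM _ ⟨hsol.mem t, hε.mem_Icc⟩
    rw [Function.comp_apply, ← sub_mul, Real.norm_eq_abs, abs_mul,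
      abs_of_pos (hsol.rate_pos S t)]
    refine mul_le_mul_of_nonneg_right ?_ (hsol.rate_pos S t).le
    rw [show Ψ (r t, ε) * c t - Ψ (keplerRadius ω h (clock ω r t), 0) * χ (clock ω r t) =
      (Ψ (r t, ε) - Ψ (keplerRadius ω h (clock ω r t), 0)) * χ (clock ω r t) +
      Ψ (r t, ε) * (c t - χ (clock ω r t)) by ring]
    refine (abs_add_le _ _).trans ?_
    rw [abs_mul, abs_mul]
    have h6 := mul_le_mul h3 (hχ1 (clock ω r t)) (abs_nonneg _) (by positivity)
    have h7 := mul_le_mul h5 h4 (abs_nonneg _) hM0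
    linarith
  have h2 : |(∫ θ in (0 : ℝ)..(clock ω r (2 * t₁)), Ψ (keplerRadius ω h θ, 0) * χ θ) -
      ∫ θ in (0 : ℝ)..(2 * Real.pi), Ψ (keplerRadius ω h θ, 0) * χ θ| ≤ η / 2 := by
    rw [intervalIntegral.integral_interval_sub_left (hint _ _) (hint _ _)]
    have h3 := intervalIntegral.norm_integral_le_of_norm_le_const (a := 2 * Real.pi)
      (b := clock ω r (2 * t₁)) (C := M) (f := fun θ => Ψ (keplerRadius ω h θ, 0) * χ θ)
      fun θ _ => by
        rw [norm_mul]
        have h4 := mul_le_mul (hM (keplerRadius ω h θ, 0) ⟨S.keplerRadius_mem θ, le_rfl, by norm_num⟩)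
          (hχ1 θ) (abs_nonneg _) hM0
        rw [mul_one] at h4
        exact h4
    have h5 := mul_le_mul_of_nonneg_left (hs.abs_clock_period_sub_le hε S ht₁) hM0
    rw [Real.norm_eq_abs] at h3
    linarith
  have h3 := abs_add_le ((∫ t in (0 : ℝ)..(2 * t₁), Ψ (r t, ε) * c t * (|ω| / r t ^ 2)) -
    ∫ θ in (0 : ℝ)..(clock ω r (2 * t₁)), Ψ (keplerRadius ω h θ, 0) * χ θ)
    ((∫ θ in (0 : ℝ)..(clock ω r (2 * t₁)), Ψ (keplerRadius ω h θ, 0) * χ θ) -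
      ∫ θ in (0 : ℝ)..(2 * Real.pi), Ψ (keplerRadius ω h θ, 0) * χ θ)
  rw [sub_add_sub_cancel] at h3
  linarith

theorem integral_two_pi_eq {k : ℝ → ℝ} (hk : Continuous k) :
    ∫ θ in (0 : ℝ)..(2 * Real.pi), k θ =
      ∫ θ in (0 : ℝ)..Real.pi, (k θ + k (2 * Real.pi - θ)) := by
  have hint := fun x y => hk.intervalIntegrable (μ := volume) x y
  have hk' : Continuous fun θ => k (2 * Real.pi - θ) := by fun_prop
  rw [intervalIntegral.integral_add (hint _ _) (hk'.intervalIntegrable _ _),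
    intervalIntegral.integral_comp_sub_left (fun θ => k θ) (2 * Real.pi), sub_zero,
    show 2 * Real.pi - Real.pi = Real.pi by ring,
    intervalIntegral.integral_add_adjacent_intervals (hint _ _) (hint _ _)]

theorem keplerRadius_two_pi_sub (ω h θ : ℝ) :
    keplerRadius ω h (2 * Real.pi - θ) = keplerRadius ω h θ := by
  rw [keplerRadius, keplerRadius, Real.cos_two_pi_sub]

theorem KeplerPert.continuousOn_radD (S : KeplerPert f ω h a b C) :
    ContinuousOn (fun x : ℝ × ℝ => radD f x.1 x.2) (Icc a b ×ˢ Icc (0 : ℝ) (1 / 2)) :=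
  (S.sym.smoothPert.dirD eR).continuousOn_plane.mono fun _ hx =>
    ⟨S.pos_of_mem hx.1, hx.2.1, hx.2.2.trans_lt (by norm_num)⟩

theorem KeplerPert.integral_radD_mul_cos (S : KeplerPert f ω h a b C) :
    ∫ θ in (0 : ℝ)..(2 * Real.pi), radD f (keplerRadius ω h θ) 0 * keplerRadius ω h θ ^ 2 / ω ^ 2 *
      Real.cos θ = ecc ω h / ω ^ 2 * Ttilde f ω h := by
  have hk := S.continuous_keplerRadius
  have h1 : Continuous fun θ => radD f (keplerRadius ω h θ) 0 :=
    S.continuousOn_radD.comp_continuous (hk.prodMk continuous_const) fun θ =>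
      ⟨S.keplerRadius_mem θ, le_rfl, by norm_num⟩
  have he := S.ecc_pos.ne'
  have h2 : Continuous fun θ => radD f (keplerRadius ω h θ) 0 * keplerRadius ω h θ ^ 2 / ω ^ 2 *
      Real.cos θ := ((h1.mul (hk.pow 2)).div_const _).mul Real.continuous_cos
  rw [integral_two_pi_eq h2, Ttilde,
    ← mul_assoc, ← intervalIntegral.integral_const_mul]
  refine intervalIntegral.integral_congr fun θ _ => ?_
  rw [keplerRadius_two_pi_sub, Real.cos_two_pi_sub,
    radialDeriv_eq S.sym.smoothPert (S.pos_of_mem (S.keplerRadius_mem θ))]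
  field_simp
  ring

/-- Folding the ellipse along its axis of symmetry turns `sin² (α + θ)` into
`1 - cos 2θ cos 2α`. -/
theorem KeplerPert.integral_transK_mul_sin_sq (S : KeplerPert f ω h a b C) (α : ℝ) :
    ∫ θ in (0 : ℝ)..(2 * Real.pi), transK f ω 0 (keplerRadius ω h θ) * Real.sin (α + θ) ^ 2 =
      ((∫ θ in (0 : ℝ)..Real.pi, keplerRadius ω h θ ^ 2 * latitudeDeriv2 f (keplerRadius ω h θ)) -
        (∫ θ in (0 : ℝ)..Real.pi, keplerRadius ω h θ ^ 2 *
          latitudeDeriv2 f (keplerRadius ω h θ) * Real.cos (2 * θ)) * Real.cos (2 * α)) / ω ^ 2 := by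
  have hk := S.continuous_keplerRadius
  have h1 : Continuous fun θ => transK f ω 0 (keplerRadius ω h θ) :=
    S.continuousOn_transK.comp_continuous (hk.prodMk continuous_const) fun θ =>
      ⟨S.keplerRadius_mem θ, le_rfl, by norm_num⟩
  have hω := S.ω_ne
  have h2 : ∀ θ, keplerRadius ω h θ ^ 2 * latitudeDeriv2 f (keplerRadius ω h θ) =
      ω ^ 2 * transK f ω 0 (keplerRadius ω h θ) := by
    intro θ
    rw [latitudeDeriv2_eq S.sym (S.pos_of_mem (S.keplerRadius_mem θ)), transK]
    field_simp
  simp only [h2]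
  have h3 : Continuous fun θ => ω ^ 2 * transK f ω 0 (keplerRadius ω h θ) := h1.const_mul _
  have h4 : Continuous fun θ => ω ^ 2 * transK f ω 0 (keplerRadius ω h θ) * Real.cos (2 * θ) *
      Real.cos (2 * α) := by
    fun_prop
  rw [integral_two_pi_eq (by fun_prop), ← intervalIntegral.integral_mul_const,
    ← intervalIntegral.integral_sub (h3.intervalIntegrable _ _)
      (h4.intervalIntegrable _ _), ← intervalIntegral.integral_div]
  refine intervalIntegral.integral_congr fun θ _ => ?_
  simp only [keplerRadius_two_pi_sub]
  have h5 : Real.sin (α + (2 * Real.pi - θ)) = Real.sin (α - θ) := by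
    rw [show α + (2 * Real.pi - θ) = α - θ + 2 * Real.pi by ring, Real.sin_add_two_pi]
  have h6 : Real.sin (α + θ) ^ 2 + Real.sin (α - θ) ^ 2 =
      1 - Real.cos (2 * θ) * Real.cos (2 * α) := by
    rw [Real.sin_add, Real.sin_sub, Real.cos_two_mul', Real.cos_two_mul']
    have hα := Real.sin_sq_add_cos_sq α
    have hθ := Real.sin_sq_add_cos_sq θ
    linear_combination (Real.sin θ ^ 2 + Real.cos θ ^ 2) * hα + hθ
  rw [h5, ← mul_add, h6]
  field_simp

end averaging

section asymptotics
variable {f : EuclideanSpace ℝ (Fin 3) → ℝ → ℝ} {ω h a b C ε t₁ : ℝ} {p r : ℝ → ℝ}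

theorem abs_sub_sin_le {x : ℝ} (hx : |x| ≤ 1) : |x - Real.sin x| ≤ x ^ 2 := by
  have h1 := Real.sin_bound hx
  have h2 : |x| ^ 5 ≤ |x| ^ 2 := pow_le_pow_of_le_one (abs_nonneg x) hx (by norm_num)
  have h3 : |x ^ 3 / 6| ≤ |x| ^ 2 / 6 := by
    rw [abs_div, abs_pow, abs_of_pos (by norm_num : (0 : ℝ) < 6)]
    have := pow_le_pow_of_le_one (abs_nonneg x) hx (by norm_num : 2 ≤ 3)
    linarith
  have h4 : |x - Real.sin x| ≤ |Real.sin x - (x - x ^ 3 / 6)| + |x ^ 3 / 6| := by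
    rw [show x - Real.sin x = -(Real.sin x - (x - x ^ 3 / 6)) + x ^ 3 / 6 by ring]
    exact (abs_add_le _ _).trans (by rw [abs_neg])
  rw [sq_abs] at h2 h3
  linarith [sq_nonneg x]

/-- The first order of the angular period: it is read off from `eccX` after one period, which is
the integral of the perturbation along the orbit, and which is the sine of the angular period times
`eccY`. -/
theorem KeplerPert.eventually_clock_period (S : KeplerPert f ω h a b C) {η : ℝ} (hη : 0 < η) :
    ∀ᶠ ε in 𝓝[≥] (0 : ℝ), ∀ p r t₁, IsPericentric f ω h a b ε p r → IsHalfPeriod ω p r t₁ →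
      |clock ω r (2 * t₁) - 2 * Real.pi - ε * Ttilde f ω h| ≤ η * ε := by
  set e₀ := ecc ω h / ω ^ 2 with he₀
  have he₀pos : 0 < e₀ := div_pos S.ecc_pos S.ω_sq_pos
  set c₁ := 20 * (C * b ^ 2 / ω ^ 2) / (40 * (ecc ω h / 80 / ω ^ 2)) with hc₁
  set c₂ := 2 * C / ecc ω h with hc₂
  have hC := S.C_pos
  have hecc := S.ecc_pos
  have hωsq := S.ω_sq_pos
  have hc₁0 : 0 ≤ c₁ := by positivity
  have hc₂0 : 0 ≤ c₂ := by positivity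
  have hΨ : ContinuousOn (fun x : ℝ × ℝ => radD f x.1 x.2 * x.1 ^ 2 / ω ^ 2)
      (Icc a b ×ˢ Icc (0 : ℝ) (1 / 2)) := by
    have := S.continuousOn_radD
    fun_prop
  filter_upwards [S.eventually_isSmall,
    S.eventually_abs_integral_sub_le hΨ 0 (η := e₀ * (η / 3)) (by positivity),
    eventually_mul_lt (c₁ ^ 2) (d := η / 3) (by positivity),
    eventually_mul_lt c₁ (d := 1) one_pos,
    eventually_mul_lt (c₂ * c₁) (d := e₀ * (η / 3)) (by positivity)] with
    ε hε hint hsq h1 hc p r t₁ hs ht₁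
  have hε0 := hε.nonneg
  have hsol := hs.toIsPlanarSol
  have hI := hint p r t₁ hs ht₁ (fun t => Real.cos (clock ω r t)) Real.cos
    (Real.continuous_cos.comp (hsol.continuous_clock S)) Real.continuous_cos Real.abs_cos_le_one
    fun t _ => by simp
  simp only [S.integral_radD_mul_cos] at hI
  set I := ∫ t in (0 : ℝ)..(2 * t₁),
    radD f (r t) ε * r t ^ 2 / ω ^ 2 * Real.cos (clock ω r t) * (|ω| / r t ^ 2) with hIdef
  have hX : eccX ω p r (2 * t₁) = ε * I := by
    have hcont : Continuous fun t =>
        radD f (r t) ε * r t ^ 2 / ω ^ 2 * Real.cos (clock ω r t) * (|ω| / r t ^ 2) := by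
      have h2 : Continuous fun t => radD f (r t) ε * r t ^ 2 / ω ^ 2 :=
        hΨ.comp_continuous (hsol.continuous_r.prodMk continuous_const) fun t =>
          ⟨hsol.mem t, hε.mem_Icc⟩
      exact (h2.mul (Real.continuous_cos.comp (hsol.continuous_clock S))).mul
        (hsol.continuous_rate S)
    have h3 := intervalIntegral.integral_eq_sub_of_hasDerivAt (a := 0) (b := 2 * t₁)
      (fun t _ => (hsol.hasDerivAt_ecc S t).1) ((continuous_const.mul hcont).intervalIntegrable _ _)
    rw [hs.eccX_zero, sub_zero, intervalIntegral.integral_const_mul] at h3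
    exact h3.symm
  have hP := hs.abs_clock_period_sub_le hε S ht₁
  rw [(hs.eccX_period hε S ht₁).1, ← Real.sin_sub_two_pi] at hX
  have hY := hs.abs_eccY_zero_sub_le hε S
  rw [← he₀, ← hc₂] at hY
  set x := clock ω r (2 * t₁) - 2 * Real.pi
  set y := eccY ω p r 0
  rw [← hc₁] at hP
  have hsin := abs_sub_sin_le (hP.trans h1.le)
  have hx2 : x ^ 2 ≤ ε * (η / 3) := by
    rw [← sq_abs]
    calc |x| ^ 2 ≤ (ε * c₁) ^ 2 := by gcongr
      _ = ε * (ε * c₁ ^ 2) := by ring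
      _ ≤ _ := by gcongr
  have hsinle : |Real.sin x| ≤ ε * c₁ := Real.abs_sin_le_abs.trans hP
  have h4 : e₀ * |Real.sin x - ε * Ttilde f ω h| ≤ e₀ * (ε * (2 * η / 3)) := by
    rw [← abs_of_pos he₀pos, ← abs_mul, abs_of_pos he₀pos,
      show e₀ * (Real.sin x - ε * Ttilde f ω h) = -((y - e₀) * Real.sin x) +
        ε * (I - e₀ * Ttilde f ω h) by linear_combination hX]
    refine (abs_add_le _ _).trans ?_
    rw [abs_neg, abs_mul, abs_mul, abs_of_nonneg hε0]
    have h5 : |y - e₀| * |Real.sin x| ≤ ε * c₂ * (ε * c₁) :=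
      mul_le_mul hY hsinle (abs_nonneg _) (by positivity)
    have h6 := mul_le_mul_of_nonneg_left hc.le hε0
    have h7 := mul_le_mul_of_nonneg_left hI hε0
    linarith
  have h5 := le_of_mul_le_mul_left h4 he₀pos
  have h6 := abs_add_le (x - Real.sin x) (Real.sin x - ε * Ttilde f ω h)
  rw [sub_add_sub_cancel] at h6
  linarith

/-- The first order of the transversal angle after one period: the clock contributes the change of
the angular period, and the perturbation an average over the Kepler ellipse. -/
theorem KeplerPert.eventually_transAngle (S : KeplerPert f ω h a b C) {η : ℝ} (hη : 0 < η) :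
    ∀ᶠ ε in 𝓝[≥] (0 : ℝ), ∀ p r t₁, IsPericentric f ω h a b ε p r → IsHalfPeriod ω p r t₁ →
      ∀ A, IsTransAngle f ω ε r A →
      |A (2 * t₁) - A 0 - 2 * Real.pi - ε * (Efun f ω h / ω ^ 2 -
        (∫ θ in (0 : ℝ)..Real.pi, keplerRadius ω h θ ^ 2 *
          latitudeDeriv2 f (keplerRadius ω h θ) * Real.cos (2 * θ)) / ω ^ 2 *
          Real.cos (2 * A 0))| ≤ η * ε := by
  filter_upwards [S.eventually_isSmall, S.eventually_clock_period (half_pos hη),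
    S.eventually_abs_integral_sub_le S.continuousOn_transK (2 * (transBound ω b C * 10))
      (half_pos hη)] with ε hε hP hint p r t₁ hs ht₁ A hA
  have hε0 := hε.nonneg
  have hsol := hs.toIsPlanarSol
  have hAc := hA.continuous
  have hB := S.transBound_nonneg
  have hI := hint p r t₁ hs ht₁ (fun t => Real.sin (A t) ^ 2) (fun θ => Real.sin (A 0 + θ) ^ 2)
    (by fun_prop) (by fun_prop) (fun x => by
      rw [abs_of_nonneg (sq_nonneg _)]
      exact Real.sin_sq_le_one _) fun t ht => by
      refine (abs_sin_sq_sub_le _ _).trans ?_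
      have h1 := hA.abs_sub_clock_le hε S hsol ht.1
      have h2 := mul_le_mul_of_nonneg_left (hs.clock_mem hε S ht₁ ht).2 (mul_nonneg hε0 hB)
      rw [← sub_sub]
      linarith
  simp only [S.integral_transK_mul_sin_sq] at hI
  have hA1 : A (2 * t₁) - A 0 = clock ω r (2 * t₁) + ε * ∫ t in (0 : ℝ)..(2 * t₁),
      transK f ω ε (r t) * Real.sin (A t) ^ 2 * (|ω| / r t ^ 2) := by
    have hcont : Continuous fun t =>
        transK f ω ε (r t) * Real.sin (A t) ^ 2 * (|ω| / r t ^ 2) :=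
      ((hsol.continuous_transK hε S).mul (by fun_prop)).mul (hsol.continuous_rate S)
    have h3 := intervalIntegral.integral_eq_sub_of_hasDerivAt (a := 0) (b := 2 * t₁)
      (f := fun t => A t - clock ω r t)
      (f' := fun t => ε * (transK f ω ε (r t) * Real.sin (A t) ^ 2 * (|ω| / r t ^ 2)))
      (fun t _ => ((hA t).sub (hsol.hasDerivAt_clock S t)).congr_deriv (by ring))
      ((continuous_const.mul hcont).intervalIntegrable _ _)
    rw [intervalIntegral.integral_const_mul, clock_zero] at h3
    linarith
  have hP1 := hP p r t₁ hs ht₁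
  have h5 := mul_le_mul_of_nonneg_left hI hε0
  rw [← abs_of_nonneg hε0, ← abs_mul, abs_of_nonneg hε0] at h5
  have h6 := (abs_add_le _ _).trans (add_le_add hP1 h5)
  have hω := S.ω_ne
  refine le_trans (le_of_eq ?_) (h6.trans (le_of_eq (by ring)))
  rw [hA1, Efun]
  generalize (∫ t in (0 : ℝ)..(2 * t₁),
    transK f ω ε (r t) * Real.sin (A t) ^ 2 * (|ω| / r t ^ 2)) = I₁
  generalize (∫ θ in (0 : ℝ)..Real.pi, keplerRadius ω h θ ^ 2 *
    latitudeDeriv2 f (keplerRadius ω h θ)) = I₂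
  generalize (∫ θ in (0 : ℝ)..Real.pi, keplerRadius ω h θ ^ 2 *
    latitudeDeriv2 f (keplerRadius ω h θ) * Real.cos (2 * θ)) = I₃
  congr 1
  field_simp
  ring

end asymptotics

/-! ### The Seifert rotation number of the planar orbit -/

section rotation
variable {f : EuclideanSpace ℝ (Fin 3) → ℝ → ℝ} {ω h a b C ε t₁ : ℝ} {p r : ℝ → ℝ}
  {ξ : ℝ → PhaseSpace}

theorem IsHill.zero (q : ℝ → ℝ) : IsHill q (fun _ => 0) fun _ => 0 := fun t =>
  ⟨by simpa using hasDerivAt_const t (0 : ℝ), hasDerivAt_const t 0⟩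

/-- The fundamental solution along a planar curve is the symplectic sum of the fundamental matrices
of the two Hill equations. -/
theorem isFundamentalSolution_iff_eq_dsum (hf : IsSymmetricPerturbation f)
    (hx : ∀ t, 0 < ξ t (Sum.inr 0)) (hz : ∀ t, ξ t (Sum.inr 1) = 0) (hε : ε ∈ Ico (0 : ℝ) 1)
    {N : Fin 2 → ℝ → Matrix (Fin 2) (Fin 2) ℝ}
    (hN₀ : IsHillMatrix (fun t => effV'' f ω ε (ξ t (Sum.inr 0))) (N 0))
    (hN₁ : IsHillMatrix (fun t => vertQ f ε (ξ t (Sum.inr 0))) (N 1)) (γ : ℝ → Mat2 2) :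
    IsFundamentalSolution (reducedHam f ω ε) ξ γ ↔ γ = fun t => dsum fun i => N i t := by
  rw [isFundamentalSolution_iff hf hx hz hε]
  constructor
  · rintro ⟨h0, h⟩
    funext t
    ext i j
    have e₀ := fun j => hN₀.eq_mul (h j).1 t
    have e₁ := fun j => hN₁.eq_mul (h j).2 t
    simp only [h0] at e₀ e₁
    rcases i with i | i <;> rcases j with j | j <;> fin_cases i <;> fin_cases j <;>
      simp [dsum, e₀, e₁]
  · rintro rfl
    refine ⟨?_, fun j => ?_⟩
    · have : ∀ i, N i 0 = 1 := fun i => by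
        fin_cases i
        · exact hN₀.1
        · exact hN₁.1
      simp only [this, dsum_one]
    · rcases j with j | j <;> fin_cases j
      · exact ⟨by simpa [dsum] using hN₀.2 0, by simpa [dsum] using IsHill.zero _⟩
      · exact ⟨by simpa [dsum] using IsHill.zero _, by simpa [dsum] using hN₁.2 0⟩
      · exact ⟨by simpa [dsum] using hN₀.2 1, by simpa [dsum] using IsHill.zero _⟩
      · exact ⟨by simpa [dsum] using IsHill.zero _, by simpa [dsum] using hN₁.2 1⟩

theorem IsPlanarSol.exists_isHillMatrix_planar (hε : IsSmall ω h a b C ε)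
    (S : KeplerPert f ω h a b C) (hs : IsPlanarSol f ω h a b ε p r) :
    ∃ N, IsHillMatrix (fun t => effV'' f ω ε (r t)) N := by
  have hr : ∀ t, r t ≠ 0 := fun t => (hs.r_pos S t).ne'
  have hrc := hs.continuous_r
  have h1 : Continuous fun t => radDD f (r t) ε :=
    ((S.sym.smoothPert.dirD eR).dirD eR).continuousOn_plane.comp_continuous
      (hrc.prodMk continuous_const) fun t => ⟨hs.r_pos S t, hε.mem_Ico⟩
  refine exists_isHillMatrix ?_ fun t => hε.abs_effV''_le S (hs.mem t)
  unfold effV''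
  fun_prop (disch := simp [hr])

theorem IsPlanarSol.exists_isHillMatrix_transversal (hε : IsSmall ω h a b C ε)
    (S : KeplerPert f ω h a b C) (hs : IsPlanarSol f ω h a b ε p r) :
    ∃ N, IsHillMatrix (fun t => vertQ f ε (r t)) N := by
  have hr : ∀ t, r t ≠ 0 := fun t => (hs.r_pos S t).ne'
  have hrc := hs.continuous_r
  have h1 : Continuous fun t => vertDD f (r t) ε :=
    ((S.sym.smoothPert.dirD eZ).dirD eZ).continuousOn_plane.comp_continuous
      (hrc.prodMk continuous_const) fun t => ⟨hs.r_pos S t, hε.mem_Ico⟩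
  refine exists_isHillMatrix (B := 1 / a ^ 3 + ε * C) ?_ fun t => ?_
  · unfold vertQ
    fun_prop (disch := simp [hr])
  · have h2 := hs.r_pos S t
    have ha := S.a_pos
    rw [vertQ]
    refine (abs_add_le _ _).trans (add_le_add ?_ ?_)
    · rw [abs_of_pos (by positivity)]
      have := (hs.mem t).1
      gcongr
    · rw [abs_mul, abs_of_nonneg hε.nonneg]
      exact mul_le_mul_of_nonneg_left (S.vertDD_le _ (hs.mem t) ε hε.mem_Icc) hε.nonneg

/-- The planar block contributes one full turn to the mean index, and the transversal block its
translation number. -/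
theorem IsPericentric.isSeifertRotationNumber_iff (hε : IsSmall ω h a b C ε)
    (S : KeplerPert f ω h a b C) (hs : IsPericentric f ω h a b ε p r)
    (ht₁ : IsHalfPeriod ω p r t₁) {F : CircleDeg1Lift}
    (hF : ∀ A, IsTransAngle f ω ε r A →
      F (A 0 / (2 * Real.pi)) = A (2 * t₁) / (2 * Real.pi))
    {s : ℝ} (hξ : ∀ t, ξ t = planarCurve p r (t + s)) (x : ℝ) :
    IsSeifertRotationNumber (reducedHam f ω ε) ξ (2 * t₁) x ↔ x = F.translationNumber := by
  have hs' := hs.toIsPlanarSol.comp_add s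
  have hξr : ∀ t, ξ t (Sum.inr 0) = r (t + s) := fun t => by simp [hξ, planarCurve]
  have hξz : ∀ t, ξ t (Sum.inr 1) = 0 := fun t => by simp [hξ, planarCurve]
  have hper : ∀ t, r (t + 2 * t₁ + s) = r (t + s) := fun t => by
    rw [add_right_comm]
    exact (hs.periodic hε S ht₁ _).2
  obtain ⟨N₀, hN₀⟩ := hs'.exists_isHillMatrix_planar hε S
  obtain ⟨N₁, hN₁⟩ := hs'.exists_isHillMatrix_transversal hε S
  obtain ⟨p₀, z₀, A₀, hp₀, hne₀, hA₀, hlim₀⟩ := (hs.hasMeanRotation_planar hε S ht₁).comp_add s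
  obtain ⟨p₁, z₁, A₁, hp₁, hne₁, hA₁, hlim₁⟩ :=
    (hs.hasMeanRotation_transversal hε S ht₁ hF).comp_add s
  have hfund := isFundamentalSolution_iff_eq_dsum (ω := ω) (N := ![N₀, N₁]) S.sym
    (fun t => by rw [hξr]; exact hs.toIsPlanarSol.r_pos S _) hξz hε.mem_Ico
    (by simp only [hξr]; exact hN₀) (by simp only [hξr]; exact hN₁)
  have hmean := isMeanIndex_dsum_iff (T := 2 * t₁)
    (q := ![fun t => effV'' f ω ε (r (t + s)), fun t => vertQ f ε (r (t + s))])
    (N := ![N₀, N₁]) (p := ![p₀, p₁]) (z := ![z₀, z₁]) (A := ![A₀, A₁])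
    (ρ := ![1, F.translationNumber]) (Fin.forall_fin_two.2 ⟨hN₀, hN₁⟩) (by linarith [ht₁.pos])
    (Fin.forall_fin_two.2 ⟨fun t => by simp [hper], fun t => by simp [hper]⟩)
    (Fin.forall_fin_two.2 ⟨hp₀, hp₁⟩) (Fin.forall_fin_two.2 ⟨hne₀, hne₁⟩)
    (Fin.forall_fin_two.2 ⟨hA₀, hA₁⟩)
    (Fin.forall_fin_two.2 ⟨by simpa using hlim₀ 0, by simpa using hlim₁ 0⟩)
  simp only [Matrix.cons_val_zero, Matrix.cons_val_one] at hmean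
  constructor
  · rintro ⟨γ, i, hγ, hi, rfl⟩
    rw [(hfund γ).1 hγ, hmean] at hi
    rw [hi]
    ring
  · rintro rfl
    exact ⟨_, _, (hfund _).2 rfl, (hmean _).2 rfl, by ring⟩

end rotation

/-! ### First order in the parameter -/

/-- A first order estimate that holds up to every multiple of `ε` gives the one-sided derivative. -/
theorem hasDerivWithinAt_of_abs_sub_le {g : ℝ → ℝ} {g₀ g₁ : ℝ}
    (hg : ∀ η > 0, ∀ᶠ ε in 𝓝[≥] (0 : ℝ), |g ε - g₀ - ε * g₁| ≤ η * ε) :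
    HasDerivWithinAt g g₁ (Ici 0) 0 := by
  -- the estimate at `ε = 0`
  have h0 : g 0 = g₀ := by
    have h1 := (hg 1 one_pos).self_of_nhdsWithin (mem_Ici.2 le_rfl)
    simp only [zero_mul, mul_zero, sub_zero] at h1
    exact sub_eq_zero.1 (abs_nonpos_iff.1 h1)
  rw [hasDerivWithinAt_iff_isLittleO, Asymptotics.isLittleO_iff]
  intro η hη
  filter_upwards [hg η hη, self_mem_nhdsWithin] with ε hε hε0
  rw [sub_zero, h0, Real.norm_eq_abs, Real.norm_eq_abs, abs_of_nonneg (mem_Ici.1 hε0 : (0 : ℝ) ≤ ε), smul_eq_mul]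
  exact hε

/-- The circle maps of the transversal angle over one period of the planar orbit. -/
def transversalLifts (f : EuclideanSpace ℝ (Fin 3) → ℝ → ℝ) (ω h a b ε : ℝ) :
    Set CircleDeg1Lift :=
  {F | ∃ p r t₁, IsPericentric f ω h a b ε p r ∧ IsHalfPeriod ω p r t₁ ∧
    ∀ A, IsTransAngle f ω ε r A → F (A 0 / (2 * Real.pi)) = A (2 * t₁) / (2 * Real.pi)}

/-- The first order of the translation number of the transversal circle map. -/
theorem KeplerPert.eventually_translationNumber {f : EuclideanSpace ℝ (Fin 3) → ℝ → ℝ}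
    {ω h a b C : ℝ} (S : KeplerPert f ω h a b C) {η : ℝ} (hη : 0 < η) :
    ∀ᶠ ε in 𝓝[≥] (0 : ℝ), ∀ F ∈ transversalLifts f ω h a b ε,
      |F.translationNumber - 1 - ε * (if Dfun f ω h < 0 then 0
        else Real.sign (Efun f ω h) / (2 * Real.pi * ω ^ 2) * √(Dfun f ω h))| ≤ η * ε := by
  have hω := S.ω_sq_pos
  have hπ := Real.pi_pos
  have key := translationNumber_asymptotics (E := Efun f ω h / ω ^ 2)
    (K := (∫ θ in (0 : ℝ)..Real.pi, keplerRadius ω h θ ^ 2 *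
      latitudeDeriv2 f (keplerRadius ω h θ) * Real.cos (2 * θ)) / ω ^ 2)
    (𝓕 := transversalLifts f ω h a b) (fun η hη => by
      filter_upwards [S.eventually_isSmall, S.eventually_transAngle hη] with ε hε hA
      rintro F ⟨p, r, t₁, hs, ht₁, hF⟩ α
      obtain ⟨A, hA0, hAA⟩ := hs.toIsPlanarSol.exists_isTransAngle hε S α
      have h1 := hA p r t₁ hs ht₁ A hAA
      rw [← hA0, hF A hAA, mul_div_cancel₀ _ (by positivity)]
      exact h1) η hη
  have hD : (Efun f ω h / ω ^ 2) ^ 2 - ((∫ θ in (0 : ℝ)..Real.pi, keplerRadius ω h θ ^ 2 *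
      latitudeDeriv2 f (keplerRadius ω h θ) * Real.cos (2 * θ)) / ω ^ 2) ^ 2 =
      Dfun f ω h / (ω ^ 2) ^ 2 := by
    rw [Dfun]
    ring
  have hsign : Real.sign (Efun f ω h / ω ^ 2) = Real.sign (Efun f ω h) := by
    rcases lt_trichotomy (Efun f ω h) 0 with h0 | h0 | h0
    · rw [Real.sign_of_neg h0, Real.sign_of_neg (div_neg_of_neg_of_pos h0 hω)]
    · rw [h0, zero_div]
    · rw [Real.sign_of_pos h0, Real.sign_of_pos (div_pos h0 hω)]
  have hiff : Dfun f ω h / (ω ^ 2) ^ 2 < 0 ↔ Dfun f ω h < 0 := by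
    rw [div_lt_iff₀ (by positivity), zero_mul]
  rw [hD, hsign, Real.sqrt_div' _ (by positivity), Real.sqrt_sq hω.le] at key
  simp only [hiff] at key
  refine key.mono fun ε h1 F hF => (le_of_eq ?_).trans (h1 F hF)
  congr 3
  split_ifs
  · simp
  · field_simp

theorem mainTheorem5 (f : EuclideanSpace ℝ (Fin 3) → ℝ → ℝ) (hf : IsSymmetricPerturbation f)
    (ω h : ℝ) (hω : ω ≠ 0) (hlow : -1 < 2 * h * ω ^ 2) (hhigh : 2 * h * ω ^ 2 < 0)
    (a b : ℝ) (ha : 0 < a) (har : a < ω ^ 2 / (1 + ecc ω h)) (hbr : ω ^ 2 / (1 - ecc ω h) < b) :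
    ∃ (ε₀ : ℝ) (Rot P : ℝ → ℝ), 0 < ε₀ ∧ ε₀ ≤ 1 ∧
      (∀ ε ∈ Ico 0 ε₀,
        (∃ (ξ : ℝ → PhaseSpace) (T : ℝ), IsPlanarOrbit (reducedHam f ω ε) h a b ξ T ∧
          ∀ (ξ' : ℝ → PhaseSpace) (T' : ℝ), IsPlanarOrbit (reducedHam f ω ε) h a b ξ' T' →
            T' = T ∧ ∃ s : ℝ, ∀ t : ℝ, ξ' t = ξ (t + s)) ∧
        (∀ (ξ : ℝ → PhaseSpace) (T : ℝ), IsPlanarOrbit (reducedHam f ω ε) h a b ξ T →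
          angularPeriod ω ξ T = P ε ∧
          ∀ x : ℝ, IsSeifertRotationNumber (reducedHam f ω ε) ξ T x ↔ x = Rot ε)) ∧
      HasDerivWithinAt P (Ttilde f ω h) (Ici 0) 0 ∧
      HasDerivWithinAt Rot
        (if Dfun f ω h < 0 then 0
          else Real.sign (Efun f ω h) / (2 * Real.pi * ω ^ 2) * √(Dfun f ω h)) (Ici 0) 0 := by
  obtain ⟨C, S⟩ := exists_keplerPert hf hω hlow hhigh ha har hbr
  have hdata : ∀ ε, ∃ (p r : ℝ → ℝ) (t₁ : ℝ) (F : CircleDeg1Lift), IsSmall ω h a b C ε →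
      IsPericentric f ω h a b ε p r ∧ IsHalfPeriod ω p r t₁ ∧
      ∀ A, IsTransAngle f ω ε r A → F (A 0 / (2 * Real.pi)) = A (2 * t₁) / (2 * Real.pi) := by
    intro ε
    by_cases hε : IsSmall ω h a b C ε
    · obtain ⟨p, r, hs⟩ := hε.exists_isPericentric S
      obtain ⟨t₁, ht₁⟩ := hs.exists_isHalfPeriod hε S
      obtain ⟨F, hF⟩ := hs.toIsPlanarSol.exists_circleDeg1Lift hε S (T := 2 * t₁)
        (by linarith [ht₁.pos])
      exact ⟨p, r, t₁, F, fun _ => ⟨hs, ht₁, hF⟩⟩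
    · exact ⟨0, 0, 0, 1, fun h => absurd h hε⟩
  choose p r t₁ F hd using hdata
  obtain ⟨u, hu0, hu⟩ := mem_nhdsGE_iff_exists_Ico_subset.1 S.eventually_isSmall
  refine ⟨min u 1, fun ε => (F ε).translationNumber, fun ε => clock ω (r ε) (2 * t₁ ε),
    lt_min hu0 one_pos, min_le_right _ _, fun ε hε => ?_, ?_, ?_⟩
  · have hε' : IsSmall ω h a b C ε := hu ⟨hε.1, hε.2.trans_le (min_le_left _ _)⟩
    obtain ⟨hs, ht₁, hF⟩ := hd ε hε'
    refine ⟨⟨planarCurve (p ε) (r ε), 2 * t₁ ε, hs.isPlanarOrbit hε' S ht₁,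
      fun ξ T hξ => hξ.eq_translate hε' S hs ht₁⟩, fun ξ T hξ => ?_⟩
    obtain ⟨rfl, s, hs'⟩ := hξ.eq_translate hε' S hs ht₁
    exact ⟨angularPeriod_eq hε' S hs ht₁ hs',
      hs.isSeifertRotationNumber_iff hε' S ht₁ hF hs'⟩
  · refine hasDerivWithinAt_of_abs_sub_le (g₀ := 2 * Real.pi) fun η hη => ?_
    filter_upwards [S.eventually_isSmall, S.eventually_clock_period hη] with ε hε h1
    obtain ⟨hs, ht₁, -⟩ := hd ε hε
    exact h1 _ _ _ hs ht₁
  · refine hasDerivWithinAt_of_abs_sub_le (g₀ := 1) fun η hη => ?_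
    filter_upwards [S.eventually_isSmall, S.eventually_translationNumber hη] with ε hε h1
    obtain ⟨hs, ht₁, hF⟩ := hd ε hε
    exact h1 _ ⟨_, _, _, hs, ht₁, hF⟩
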